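/- Let $h$ be an indeterminate, $v=\exp(h/2)$, $q=v^2$ in $\mathbb Q[[h]]$. Let $U_h=U_h(sl_2)$ be the $h$-adically complete $\mathbb Q[[h]]$-algebra topologically generated by $H,E,F$ with relations $$HE-EH=2E,\quad HF-FH=-2F,\quad EF-FE=\frac{K-K^{-1}}{v-v^{-1}},\qquad K=\exp(hH/2),$$ and let $\hat\otimes$ be the $h$-adically completed tensor product over $\mathbb Q[[h]]$. Equip $U_h$ with the complete Hopf algebra structure $$\Delta(H)=H\otimes1+1\otimes H,\quad \Delta(E)=E\otimes 1+K\otimes E,\quad \Delta(F)=F\otimes K^{-1}+1\otimes F,$$ $$\epsilon(H)=\epsilon(E)=\epsilon(F)=0,\quad S(H)=-H,\quad S(E)=-K^{-1}E,\quad S(F)=-FK,$$ with multiplication $\mu$ and unit $\eta$, and with the universal $R$-matrix $$R=\exp\Bigl(\tfrac h4H\otimes H\Bigr)\sum_{n\ge0}v^{n(n-1)/2}\frac{(v-v^{-1})^n}{[n]!}F^n\otimes E^n=\sum\alpha\otimes\beta ,\qquad [n]=\frac{v^n-v^{-n}}{v-v^{-1}},\quad [n]!=[n]\cdots[1].$$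 Let $x\triangleright y=\sum x_{(1)}yS(x_{(2)})$ be the left adjoint action. The transmutation of $U_h$ has the structure maps $\mu,\eta,\epsilon$ and $$\psi(x\otimes y)=\sum(\beta\triangleright y)\otimes(\alpha\triangleright x),\quad \psi^{-1}(x\otimes y)=\sum(S(\alpha)\triangleright y)\otimes(\beta\triangleright x),$$ $$\underline\Delta(x)=\sum x_{(1)}S(\beta)\otimes(\alpha\triangleright x_{(2)}),\quad \underline S(x)=\sum\beta\,S(\alpha\triangleright x),\quad \underline S^{-1}(x)=\sum S^{-1}(\alpha\triangleright x)\,\beta .$$ Put $e=(v-v^{-1})E$ and $\tilde F^{(n)}=F^nK^n/[n]_q!$, where $[n]_q!=\prod_{i=1}^n\frac{q^i-1}{q-1}$. Let $U_q^{ev}\subset U_h$ be the $\mathbb Z[q,q^{-1}]$-subalgebra generated by $K^2,K^{-2},e$ and $\tilde F^{(n)}$ ($n\ge1$). For $p\ge 0$ put $\mathcal F_p(U_q^{ev})=U_q^{ev}e^pU_q^{ev}$ and $$\mathcal F_p((U_q^{ev})^{\otimes n})=\sum_{i=1}^n (U_q^{ev})^{\otimes(i-1)}\otimes\mathcal F_p(U_q^{ev})\otimes(U_q^{ev})^{\otimes(n-i)}\quad(n\ge1);$$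 for $n=0$ put $\mathcal F_0=\mathbb Z[q,q^{-1}]$ and $\mathcal F_p=0$ for $p>0$. Let $(\tilde U_q^{ev})^{\tilde\otimes n}\subset U_h^{\hat\otimes n}$ be the image of the natural map $\varprojlim_p (U_q^{ev})^{\otimes n}/\mathcal F_p\to U_h^{\hat\otimes n}$, with the quotient of the inverse limit topology; thus the images of the kernels of the projections of the inverse limit to the quotients by $\mathcal F_p$ form a basis of neighbourhoods of $0$. In particular $(\tilde U_q^{ev})^{\tilde\otimes 0}=\mathbb Z[q,q^{-1}]$ is discrete. **Theorem.** The braided Hopf algebra structure of the transmutation of $U_h$ induces a braided Hopf algebra structure with invertible antipode on $\tilde U_q^{ev}$, in the following sense. For every $$f\in\{\psi,\psi^{-1},\mu,\eta,\underline\Delta,\epsilon,\underline S,\underline S^{-1}\},\qquad f\colon U_h^{\hat\otimes i}\to U_h^{\hat\otimes j},$$ one has $f((\tilde U_q^{ev})^{\tilde\otimes i})\subset(\tilde U_q^{ev})^{\tilde\otimes j}$, and the induced map $f\colon(\tilde U_q^{ev})^{\tilde\otimes i}\to(\tilde U_q^{ev})^{\tilde\otimes j}$ is continuous. Moreover $\psi^{-1}$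 and $\underline S^{-1}$, as given by the formulas above, are two-sided inverses of $\psi$ and $\underline S$. -/

import Mathlib

open scoped TensorProduct

noncomputable section

namespace QuantumSl2

/-! ### The `h`-adic completion -/

/-- The ground ring `ℚ⟦h⟧`. -/
abbrev Rh : Type := PowerSeries ℚ

/-- The ideal `(h)` of `ℚ⟦h⟧`. -/
abbrev hId : Ideal Rh := Ideal.span {PowerSeries.X}

/-- The submodule `h ^ k M` of a `ℚ⟦h⟧`-module `M`. -/
abbrev hPow (M : Type*) [AddCommGroup M] [Module Rh M] (k : ℕ) : Submodule Rh M :=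
  hId ^ k • ⊤

/-- The `h`-adic completion of a `ℚ⟦h⟧`-module. -/
def HComp (M : Type*) [AddCommGroup M] [Module Rh M] : Type _ := AdicCompletion hId M

section Completion

variable {M : Type*} [AddCommGroup M] [Module Rh M]
variable {N : Type*} [AddCommGroup N] [Module Rh N]

instance : AddCommGroup (HComp M) := inferInstanceAs (AddCommGroup (AdicCompletion hId M))

instance : Module Rh (HComp M) := inferInstanceAs (Module Rh (AdicCompletion hId M))

theorem hId_fg : hId.FG := ⟨{PowerSeries.X}, by simp⟩

instance : IsAdicComplete hId (HComp M) := AdicCompletion.isAdicComplete hId_fg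

/-- The canonical map from a module to its `h`-adic completion. -/
def hof : M →ₗ[Rh] HComp M := AdicCompletion.of hId M

/-- The extension of a linear map `f` with `h`-adically complete target to the completion of its
source. -/
def hExtend [IsAdicComplete hId N] (f : M →ₗ[Rh] N) : HComp M →ₗ[Rh] N :=
  (AdicCompletion.ofLinearEquiv hId N).symm.toLinearMap ∘ₗ
    (AdicCompletion.map hId f).restrictScalars Rh

theorem mem_hPow_iff {k : ℕ} {x : M} : x ∈ hPow M k ↔ ∃ y, (PowerSeries.X : Rh) ^ k • y = x := by
  rw [hPow, hId, Ideal.span_singleton_pow, Submodule.ideal_span_singleton_smul,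
    Submodule.mem_smul_pointwise_iff_exists]
  simp

theorem mem_hPow_zero (x : M) : x ∈ hPow M 0 := mem_hPow_iff.2 ⟨x, by simp⟩

theorem map_mem_hPow (f : M →ₗ[Rh] N) {k : ℕ} {x : M} (hx : x ∈ hPow M k) : f x ∈ hPow N k := by
  obtain ⟨y, rfl⟩ := mem_hPow_iff.1 hx
  exact mem_hPow_iff.2 ⟨f y, by simp⟩

theorem eq_of_sub_mem_hPow [IsHausdorff hId M] {x y : M} (h : ∀ k, x - y ∈ hPow M k) : x = y := by
  refine sub_eq_zero.1 (IsHausdorff.haus inferInstance (I := hId) _ fun n => ?_)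
  rw [SModEq.zero]
  exact h n

theorem exists_hof_sub_mem (x : HComp M) (k : ℕ) : ∃ m : M, x - hof m ∈ hPow (HComp M) k := by
  obtain ⟨m, hm⟩ := Submodule.mkQ_surjective _ (AdicCompletion.eval hId M k x)
  refine ⟨m, ?_⟩
  have h2 : ∀ y : AdicCompletion hId M, AdicCompletion.eval hId M k y = 0 →
      y ∈ hPow (AdicCompletion hId M) k := fun y hy => by
    rw [hPow, AdicCompletion.pow_smul_top_eq_ker_eval hId_fg]
    exact hy
  exact h2 _ ((map_sub (AdicCompletion.eval hId M k) x (AdicCompletion.of hId M m)).trans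
    (sub_eq_zero.2 hm.symm))

/-- Linear maps out of a completion are determined on the dense submodule. -/
theorem hcomp_ext [IsHausdorff hId N] {f g : HComp M →ₗ[Rh] N}
    (h : ∀ m, f (hof m) = g (hof m)) : f = g := by
  ext x
  refine eq_of_sub_mem_hPow fun k => ?_
  obtain ⟨m, hm⟩ := exists_hof_sub_mem x k
  have := map_mem_hPow (f - g) hm
  simpa [h] using this

@[simp]
theorem hExtend_hof [IsAdicComplete hId N] (f : M →ₗ[Rh] N) (m : M) :
    hExtend f (hof m) = f m := by
  have : AdicCompletion.map hId f (AdicCompletion.of hId M m) = AdicCompletion.of hId N (f m) :=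
    AdicCompletion.map_of ..
  change (AdicCompletion.ofLinearEquiv hId N).symm (AdicCompletion.map hId f
    (AdicCompletion.of hId M m)) = _
  rw [this, AdicCompletion.ofLinearEquiv_symm_of]

/-- `hPair x f` is the value at `x` of the extension of `f` to the completion. If
`x = ∑ mᵢ` is an `h`-adically convergent sum of elements of `M`, then `hPair x f = ∑ f mᵢ`. -/
def hPair [IsAdicComplete hId N] : HComp M →ₗ[Rh] (M →ₗ[Rh] N) →ₗ[Rh] N :=
  LinearMap.mk₂ Rh (fun x f => hExtend f x)
    (fun x y f => map_add _ _ _) (fun c x f => map_smul _ _ _)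
    (fun x f g => by
      have : hExtend (f + g) = hExtend f + hExtend g := hcomp_ext fun m => by simp
      simp [this])
    (fun c x f => by
      have : hExtend (c • f) = c • hExtend f := hcomp_ext fun m => by simp
      simp [this])

@[simp]
theorem hPair_hof [IsAdicComplete hId N] (m : M) (f : M →ₗ[Rh] N) :
    hPair (hof m) f = f m := hExtend_hof f m

end Completion

section Algebra

variable {A : Type*} [Ring A] [Algebra Rh A]
variable {B : Type*} [Ring B] [Algebra Rh B]

/-- The multiplication of the `h`-adic completion of an algebra. -/
def hMul : HComp A →ₗ[Rh] HComp A →ₗ[Rh] HComp A :=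
  LinearMap.mk₂ Rh (fun x y => hPair x (hPair y ∘ₗ (LinearMap.compRight Rh hof ∘ₗ LinearMap.mul Rh A)))
    (fun x y f => by simp) (fun c x f => by simp)
    (fun x f g => by rw [map_add, LinearMap.add_comp, map_add])
    (fun c x f => by rw [map_smul, LinearMap.smul_comp, map_smul])

@[simp]
theorem hMul_hof (a b : A) : hMul (hof a) (hof b) = hof (a * b) := by
  simp [hMul]

theorem hMul_assoc (x y z : HComp A) : hMul (hMul x y) z = hMul x (hMul y z) := by
  have h1 : ∀ a b : A, hMul (hof (a * b)) = hMul (hof a) ∘ₗ hMul (hof b) := fun a b =>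
    hcomp_ext fun c => by simp [mul_assoc]
  have h2 : ∀ a : A, hMul.flip z ∘ₗ hMul (hof a) = hMul (hof a) ∘ₗ hMul.flip z := fun a =>
    hcomp_ext fun b => by simp [h1]
  have h3 : hMul.flip z ∘ₗ hMul.flip y = hMul.flip (hMul y z) :=
    hcomp_ext fun a => by simpa using LinearMap.congr_fun (h2 a) y
  exact LinearMap.congr_fun h3 x

instance : Mul (HComp A) := ⟨fun x y => hMul x y⟩

instance : One (HComp A) := ⟨hof 1⟩

theorem hcomp_mul_def (x y : HComp A) : x * y = hMul x y := rfl

theorem hof_one : hof (1 : A) = 1 := rfl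

theorem hof_mul (a b : A) : hof (a * b) = hof a * hof b := (hMul_hof a b).symm

instance : Ring (HComp A) :=
  { (inferInstance : AddCommGroup (HComp A)), (inferInstance : Mul (HComp A)),
    (inferInstance : One (HComp A)) with
    left_distrib := fun x y z => map_add (hMul x) y z
    right_distrib := fun x y z => LinearMap.map_add₂ hMul x y z
    zero_mul := fun x => LinearMap.map_zero₂ hMul x
    mul_zero := fun x => map_zero (hMul x)
    mul_assoc := hMul_assoc
    one_mul := fun x => LinearMap.congr_fun
      (hcomp_ext (f := hMul (hof (1 : A))) (g := LinearMap.id) fun a => by simp) x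
    mul_one := fun x => LinearMap.congr_fun
      (hcomp_ext (f := hMul.flip (hof (1 : A))) (g := LinearMap.id) fun a => by simp) x }

instance : Algebra Rh (HComp A) :=
  Algebra.ofModule (fun r x y => LinearMap.map_smul₂ hMul r x y) (fun r x y => map_smul (hMul x) r y)

/-- The canonical map from an algebra to its `h`-adic completion. -/
def hofAlg : A →ₐ[Rh] HComp A := AlgHom.ofLinearMap hof hof_one hof_mul

@[simp]
theorem hofAlg_apply (a : A) : hofAlg a = hof a := rfl

/-- The extension of an algebra homomorphism with `h`-adically complete target to the completion
of its source. -/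
def hExtendAlg [IsAdicComplete hId B] (f : A →ₐ[Rh] B) : HComp A →ₐ[Rh] B :=
  AlgHom.ofLinearMap (hExtend f.toLinearMap) (by rw [← hof_one, hExtend_hof]; simp) <| by
    intro x y
    have h1 : ∀ a : A, hExtend f.toLinearMap ∘ₗ LinearMap.mulLeft Rh (hof a) =
        LinearMap.mulLeft Rh (f a) ∘ₗ hExtend f.toLinearMap := fun a =>
      hcomp_ext fun b => by simp [← hof_mul]
    have h2 : hExtend f.toLinearMap ∘ₗ LinearMap.mulRight Rh y =
        LinearMap.mulRight Rh (hExtend f.toLinearMap y) ∘ₗ hExtend f.toLinearMap :=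
      hcomp_ext fun a => by simpa using LinearMap.congr_fun (h1 a) y
    exact LinearMap.congr_fun h2 x

@[simp]
theorem hExtendAlg_hof [IsAdicComplete hId B] (f : A →ₐ[Rh] B) (a : A) :
    hExtendAlg f (hof a) = f a := hExtend_hof f.toLinearMap a

theorem hcomp_algHom_ext [IsHausdorff hId B] {f g : HComp A →ₐ[Rh] B}
    (h : f.comp hofAlg = g.comp hofAlg) : f = g :=
  AlgHom.toLinearMap_injective (hcomp_ext fun a => AlgHom.congr_fun h a)

instance [IsAdicComplete hId B] : IsAdicComplete hId Bᵐᵒᵖ where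
  haus' x hx := MulOpposite.unop_injective <| IsHausdorff.haus (I := hId) inferInstance _ fun n => by
    have := hx n
    rw [SModEq.zero] at this ⊢
    exact map_mem_hPow (MulOpposite.opLinearEquiv Rh).symm.toLinearMap this
  prec' f hf := by
    obtain ⟨L, hL⟩ := IsPrecomplete.prec (I := hId) (M := B) inferInstance
      (f := fun n => (f n).unop) fun {m n} hmn => by
        have := hf hmn
        rw [SModEq.sub_mem] at this ⊢
        exact map_mem_hPow (MulOpposite.opLinearEquiv Rh).symm.toLinearMap this
    refine ⟨MulOpposite.op L, fun n => ?_⟩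
    have := hL n
    rw [SModEq.sub_mem] at this ⊢
    exact map_mem_hPow (MulOpposite.opLinearEquiv Rh).toLinearMap this

/-! ### Convergent power series in `h` -/

theorem exists_hSum [IsAdicComplete hId B] (a : PowerSeries B) : ∃ L : B, ∀ k,
    L - ∑ n ∈ Finset.range k, (PowerSeries.X : Rh) ^ n • PowerSeries.coeff n a ∈ hPow B k := by
  obtain ⟨L, hL⟩ := IsPrecomplete.prec (I := hId) (M := B) inferInstance
    (f := fun k => ∑ n ∈ Finset.range k, (PowerSeries.X : Rh) ^ n • PowerSeries.coeff n a)
    fun {m n} hmn => by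
      rw [SModEq.comm, SModEq.sub_mem, ← Finset.sum_range_add_sum_Ico _ hmn, add_sub_cancel_left]
      refine Submodule.sum_mem _ fun i hi => mem_hPow_iff.2
        ⟨(PowerSeries.X : Rh) ^ (i - m) • PowerSeries.coeff i a, ?_⟩
      rw [smul_smul, ← pow_add, Nat.add_sub_cancel' (Finset.mem_Ico.1 hi).1]
  exact ⟨L, fun k => (SModEq.sub_mem).1 (hL k).symm⟩

/-- The sum `∑ hⁿ aₙ` of a power series with coefficients in an `h`-adically complete algebra. -/
def hSum [IsAdicComplete hId B] (a : PowerSeries B) : B := (exists_hSum a).choose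

theorem hSum_spec [IsAdicComplete hId B] (a : PowerSeries B) (k : ℕ) :
    hSum a - ∑ n ∈ Finset.range k, (PowerSeries.X : Rh) ^ n • PowerSeries.coeff n a ∈ hPow B k :=
  (exists_hSum a).choose_spec k

theorem hSum_unique [IsAdicComplete hId B] {a : PowerSeries B} {x : B} (h : ∀ k,
    x - ∑ n ∈ Finset.range k, (PowerSeries.X : Rh) ^ n • PowerSeries.coeff n a ∈ hPow B k) :
    hSum a = x :=
  eq_of_sub_mem_hPow fun k => by
    simpa using Submodule.sub_mem _ (hSum_spec a k) (h k)

theorem hSum_map {C : Type*} [Ring C] [Algebra Rh C] [IsAdicComplete hId B] [IsAdicComplete hId C]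
    (f : B →ₐ[Rh] C) (a : PowerSeries B) : hSum (PowerSeries.map (f : B →+* C) a) = f (hSum a) :=
  hSum_unique fun k => by
    simpa using map_mem_hPow f.toLinearMap (hSum_spec a k)

theorem hSum_add [IsAdicComplete hId B] (a b : PowerSeries B) :
    hSum (a + b) = hSum a + hSum b :=
  hSum_unique fun k => by
    have := Submodule.add_mem _ (hSum_spec a k) (hSum_spec b k)
    simp only [map_add, smul_add, Finset.sum_add_distrib]
    convert this using 1
    abel

theorem hSum_C [IsAdicComplete hId B] (b : B) : hSum (PowerSeries.C b) = b :=
  hSum_unique fun k => by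
    rcases k with _ | k
    · exact mem_hPow_zero _
    · rw [Finset.sum_range_succ', Finset.sum_eq_zero]
      · simp
      · intro i _
        simp

theorem hSum_X_mul [IsAdicComplete hId B] (a : PowerSeries B) :
    hSum (PowerSeries.X * a) = (PowerSeries.X : Rh) • hSum a :=
  hSum_unique fun k => by
    rcases k with _ | k
    · exact mem_hPow_zero _
    · rw [Finset.sum_range_succ']
      obtain ⟨y, hy⟩ := mem_hPow_iff.1 (hSum_spec a k)
      refine mem_hPow_iff.2 ⟨y, ?_⟩
      rw [pow_succ', mul_smul, hy]
      simp [smul_sub, Finset.smul_sum, smul_smul, ← pow_succ', PowerSeries.coeff_succ_X_mul]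

theorem hSum_C_mul [IsAdicComplete hId B] (b : B) (a : PowerSeries B) :
    hSum (PowerSeries.C b * a) = b * hSum a :=
  hSum_unique fun k => by
    simpa [mul_sub, Finset.mul_sum] using
      map_mem_hPow (LinearMap.mulLeft Rh b) (hSum_spec a k)

theorem hSum_mul [IsAdicComplete hId B] (a b : PowerSeries B) :
    hSum (a * b) = hSum a * hSum b := by
  refine eq_of_sub_mem_hPow fun k => ?_
  induction k generalizing a with
  | zero => exact mem_hPow_zero _
  | succ k ih =>
    have ha : a = PowerSeries.X * PowerSeries.mk (fun p => PowerSeries.coeff (p + 1) a) +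
        PowerSeries.C (PowerSeries.constantCoeff a) := PowerSeries.eq_X_mul_shift_add_const a
    generalize PowerSeries.mk (fun p => PowerSeries.coeff (p + 1) a) = a' at ha
    obtain ⟨y, hy⟩ := mem_hPow_iff.1 (ih a')
    refine mem_hPow_iff.2 ⟨y, ?_⟩
    rw [ha, add_mul, hSum_add, hSum_add, hSum_C_mul, hSum_C, mul_assoc, hSum_X_mul, hSum_X_mul,
      pow_succ', mul_smul, hy, smul_sub, add_mul, smul_mul_assoc]
    abel

theorem hSum_one [IsAdicComplete hId B] : hSum (1 : PowerSeries B) = 1 := by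
  simpa using hSum_C (1 : B)

theorem hSum_neg [IsAdicComplete hId B] (a : PowerSeries B) : hSum (-a) = -hSum a := by
  refine eq_neg_of_add_eq_zero_left ?_
  rw [← hSum_add]
  simpa using hSum_C (0 : B)

/-- The rational number `c` as an element of `ℚ⟦h⟧`. -/
abbrev cst (c : ℚ) : Rh := PowerSeries.C c

/-- The formal exponential `∑ xⁿ Tⁿ / n!`. -/
def expS (x : B) : PowerSeries B :=
  PowerSeries.mk fun n => cst ((n.factorial : ℚ)⁻¹) • x ^ n

/-- The coefficients of `exp (t / 2) - exp (-t / 2)`. -/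
def shCoeff (n : ℕ) : ℚ := ((1 / 2) ^ n - (-1 / 2) ^ n) * (n.factorial : ℚ)⁻¹

/-- The formal power series `(exp (x T / 2) - exp (-x T / 2)) / T`. -/
def shS (x : B) : PowerSeries B :=
  PowerSeries.mk fun n => cst (shCoeff (n + 1)) • x ^ (n + 1)

/-- The exponential `exp (h x)` in an `h`-adically complete algebra. -/
def hExp [IsAdicComplete hId B] (x : B) : B := hSum (expS x)

/-- `v ^ a = exp (a h / 2)`; in particular `v = vPow 1` and `q ^ a = vPow (2 * a)`. -/
def vPow (a : ℤ) : Rh := PowerSeries.rescale ((a : ℚ) / 2) (PowerSeries.exp ℚ)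

/-- The invertible power series `(v - v⁻¹) / h`. -/
def sh : Rh := PowerSeries.mk fun n => shCoeff (n + 1)

/-- The element `(exp (h x / 2) - exp (-h x / 2)) / (v - v⁻¹)`. Numerator and
denominator are both divided by `h`. -/
def qBr [IsAdicComplete hId B] (x : B) : B := (sh⁻¹ : Rh) • hSum (shS x)

theorem X_mul_shS (x : B) :
    PowerSeries.X * shS x = expS (cst (1 / 2) • x) - expS (-(cst (1 / 2) • x)) := by
  ext n
  rcases n with _ | n
  · simp [expS]
  · rw [PowerSeries.coeff_succ_X_mul]
    simp only [shS, expS, PowerSeries.coeff_mk, map_sub, ← neg_smul, smul_pow, smul_smul, ← sub_smul]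
    congr 1
    simp only [shCoeff, cst, ← map_neg, ← map_pow, ← map_mul, ← map_sub]
    congr 1
    ring

theorem X_mul_sh : PowerSeries.X * sh = vPow 1 - vPow (-1) := by
  ext n
  rcases n with _ | n
  · rw [PowerSeries.coeff_zero_X_mul, map_sub, vPow, vPow, PowerSeries.coeff_rescale,
      PowerSeries.coeff_rescale, pow_zero, pow_zero, sub_self]
  · rw [PowerSeries.coeff_succ_X_mul]
    simp [sh, vPow, PowerSeries.coeff_rescale, shCoeff, PowerSeries.coeff_exp]
    ring

theorem sh_mul_inv : sh * sh⁻¹ = 1 := PowerSeries.mul_inv_cancel _ (by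
  simp [sh, shCoeff]; norm_num)

/-- `qBr x` is the quotient of `exp (h x / 2) - exp (-h x / 2)` by `v - v⁻¹`. -/
theorem smul_qBr [IsAdicComplete hId B] (x : B) : (vPow 1 - vPow (-1)) • qBr x =
    hExp (cst (1 / 2) • x) - hExp (-(cst (1 / 2) • x)) := by
  rw [← X_mul_sh, qBr, smul_smul, mul_assoc, sh_mul_inv, mul_one, ← hSum_X_mul, X_mul_shS, hExp,
    hExp, sub_eq_add_neg, hSum_add, hSum_neg, sub_eq_add_neg]

theorem expS_add {x y : B} (h : Commute x y) : expS (x + y) = expS x * expS y := by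
  ext n
  simp only [expS, PowerSeries.coeff_mul, PowerSeries.coeff_mk, h.add_pow', Finset.smul_sum,
    smul_mul_smul_comm]
  refine Finset.sum_congr rfl fun m hm => ?_
  rw [← Nat.cast_smul_eq_nsmul Rh, smul_smul]
  congr 1
  have : ((n.choose m.1 : ℕ) : Rh) = cst (n.choose m.1 : ℚ) := by simp [cst]
  rw [this, ← map_mul, ← map_mul]
  congr 1
  rw [Finset.HasAntidiagonal.mem_antidiagonal] at hm
  rw [← hm, Nat.choose_symm_add, Nat.add_choose, Nat.cast_div (Nat.factorial_mul_factorial_dvd_factorial_add _ _)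
    (by positivity)]
  have := Nat.factorial_ne_zero (m.1 + m.2)
  push_cast
  field_simp

theorem expS_zero : expS (0 : B) = 1 := by
  ext n
  rcases n with _ | n <;> simp [expS, PowerSeries.coeff_one]

theorem hExp_add [IsAdicComplete hId B] {x y : B} (h : Commute x y) :
    hExp (x + y) = hExp x * hExp y := by
  rw [hExp, expS_add h, hSum_mul, hExp, hExp]

theorem hExp_zero [IsAdicComplete hId B] : hExp (0 : B) = 1 := by
  rw [hExp, expS_zero, hSum_one]

theorem map_expS {C : Type*} [Ring C] [Algebra Rh C] (f : B →ₐ[Rh] C) (x : B) :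
    PowerSeries.map (f : B →+* C) (expS x) = expS (f x) := by
  ext n
  simp [expS]

theorem map_hExp {C : Type*} [Ring C] [Algebra Rh C] [IsAdicComplete hId B] [IsAdicComplete hId C]
    (f : B →ₐ[Rh] C) (x : B) : f (hExp x) = hExp (f x) := by
  rw [hExp, ← hSum_map, map_expS, hExp]

theorem map_qBr {C : Type*} [Ring C] [Algebra Rh C] [IsAdicComplete hId B] [IsAdicComplete hId C]
    (f : B →ₐ[Rh] C) (x : B) : f (qBr x) = qBr (f x) := by
  rw [qBr, map_smul, ← hSum_map, qBr]
  congr 2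
  ext n
  simp [shS]

theorem hExp_cst [IsAdicComplete hId B] (a : ℤ) :
    hExp (algebraMap Rh B (cst (a / 2))) = algebraMap Rh B (vPow a) := by
  have h1 : hExp (cst (a / 2)) = vPow a := hSum_unique fun k => by
    refine mem_hPow_iff.2 ?_
    have h2 : (PowerSeries.X : Rh) ^ k ∣ vPow a - ∑ n ∈ Finset.range k,
        (PowerSeries.X : Rh) ^ n • PowerSeries.coeff n (expS (cst ((a : ℚ) / 2))) := by
      rw [PowerSeries.X_pow_dvd_iff]
      intro m hm
      have h3 : ∀ n, (PowerSeries.X : Rh) ^ n • PowerSeries.coeff n (expS (cst ((a : ℚ) / 2))) =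
          PowerSeries.monomial n (((a : ℚ) / 2) ^ n * (n.factorial : ℚ)⁻¹) := fun n => by
        rw [expS, PowerSeries.coeff_mk, smul_eq_mul, smul_eq_mul, ← map_pow, ← map_mul, mul_comm,
          mul_comm (a := _ ^ n)]
        ext i
        rw [PowerSeries.coeff_C_mul_X_pow, PowerSeries.coeff_monomial]
      simp only [h3, map_sub, map_sum, PowerSeries.coeff_monomial]
      rw [Finset.sum_ite_eq, if_pos (Finset.mem_range.2 hm)]
      simp [vPow, PowerSeries.coeff_rescale, PowerSeries.coeff_exp]
    obtain ⟨y, hy⟩ := h2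
    exact ⟨y, hy.symm⟩
  rw [← h1]
  exact (map_hExp (Algebra.ofId Rh B) _).symm

theorem vPow_add (a b : ℤ) : vPow (a + b) = vPow a * vPow b := by
  have := hExp_add (B := Rh) (Commute.all (cst (a / 2)) (cst (b / 2)))
  rw [← map_add, ← add_div, ← Int.cast_add] at this
  have h := fun c : ℤ => hExp_cst (B := Rh) c
  simp only [Algebra.algebraMap_self, RingHom.id_apply] at h
  rwa [h, h, h] at this

theorem vPow_zero : vPow 0 = 1 := by
  ext n
  rcases n with _ | n <;> simp [vPow]

/-- A function of `x` passes through `y` if `x y = y x'`. -/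
theorem hExp_mul_comm [IsAdicComplete hId B] {x x' y : B} (h : x * y = y * x') :
    hExp x * y = y * hExp x' := by
  have h1 : ∀ n, x ^ n * y = y * x' ^ n := fun n => by
    induction n with
    | zero => simp
    | succ n ih => rw [pow_succ, mul_assoc, h, ← mul_assoc, ih, mul_assoc, ← pow_succ]
  have h2 : expS x * PowerSeries.C y = PowerSeries.C y * expS x' := by
    ext n
    simp [expS, h1]
  have := congrArg hSum h2
  rwa [hSum_mul, hSum_mul, hSum_C] at this

theorem hExp_shift [IsAdicComplete hId B] {x y : B} (a : ℤ)
    (h : x * y = y * (x + algebraMap Rh B (cst (a / 2)))) :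
    hExp x * y = vPow a • (y * hExp x) := by
  rw [hExp_mul_comm h, hExp_add (Algebra.commutes' _ x).symm, hExp_cst, ← mul_assoc,
    ← Algebra.commutes, Algebra.smul_def]

theorem qBr_neg [IsAdicComplete hId B] (x : B) : qBr (-x) = -qBr x := by
  have : shS (-x) = - shS x := by
    ext n
    simp only [shS, PowerSeries.coeff_mk, map_neg]
    rcases Nat.even_or_odd (n + 1) with h | h
    · have : shCoeff (n + 1) = 0 := by
        rw [shCoeff, neg_div, h.neg_pow, sub_self, zero_mul]
      simp [this]
    · rw [h.neg_pow, smul_neg]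
  rw [qBr, this, hSum_neg, smul_neg, qBr]

theorem qBr_zero [IsAdicComplete hId B] : qBr (0 : B) = 0 := by
  have : shS (0 : B) = 0 := by
    ext n
    simp [shS]
  rw [qBr, this]
  have := hSum_C (0 : B)
  rw [map_zero] at this
  rw [this, smul_zero]

theorem qBr_add [IsAdicComplete hId B] {x y : B} (h : Commute x y) :
    qBr (x + y) = qBr x * hExp (-(cst (1 / 2) • y)) + hExp (cst (1 / 2) • x) * qBr y := by
  have key : shS (x + y) = shS x * expS (-(cst (1 / 2) • y)) + expS (cst (1 / 2) • x) * shS y := by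
    have hX : ∀ a b : PowerSeries B, PowerSeries.X * a = PowerSeries.X * b → a = b :=
      fun a b hab => by
        ext n
        rw [← PowerSeries.coeff_succ_X_mul, hab, PowerSeries.coeff_succ_X_mul]
    apply hX
    have h1 : Commute (cst (1 / 2) • x) (cst (1 / 2) • y) :=
      (h.smul_left _).smul_right _
    rw [mul_add, ← mul_assoc, ← mul_assoc, ← (PowerSeries.commute_X (expS (cst (1 / 2) • x))).eq,
      mul_assoc (expS _), X_mul_shS, X_mul_shS, X_mul_shS, smul_add, neg_add, expS_add h1,
      expS_add h1.neg_left.neg_right]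
    noncomm_ring
  rw [qBr, key, hSum_add, hSum_mul, hSum_mul, smul_add, qBr, qBr, hExp, hExp, smul_mul_assoc,
    mul_smul_comm]

end Algebra

/-! ### The algebra `U_h(sl₂)` -/

/-- The names of the topological generators. -/
inductive Gen
  | H
  | E
  | F

/-- The `h`-adically completed free algebra on `H`, `E`, `F`. -/
def FreeH : Type := HComp (FreeAlgebra Rh Gen)

instance : Ring FreeH := inferInstanceAs (Ring (HComp (FreeAlgebra Rh Gen)))

instance : Algebra Rh FreeH := inferInstanceAs (Algebra Rh (HComp (FreeAlgebra Rh Gen)))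

instance : IsAdicComplete hId FreeH :=
  inferInstanceAs (IsAdicComplete hId (HComp (FreeAlgebra Rh Gen)))

/-- The generators of the completed free algebra. -/
def freeGen (g : Gen) : FreeH := hof (M := FreeAlgebra Rh Gen) (FreeAlgebra.ι Rh g)

/-- The relations of `U_h(sl₂)`; here `qBr H = (K - K⁻¹) / (v - v⁻¹)` with `K = exp (h H / 2)`. -/
inductive UhRel : FreeH → FreeH → Prop
  | HE : UhRel (freeGen .H * freeGen .E - freeGen .E * freeGen .H) ((2 : ℕ) • freeGen .E)
  | HF : UhRel (freeGen .H * freeGen .F - freeGen .F * freeGen .H) (-((2 : ℕ) • freeGen .F))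
  | EF : UhRel (freeGen .E * freeGen .F - freeGen .F * freeGen .E) (qBr (freeGen .H))

/-- The algebra `U_h(sl₂)`: the `h`-adically complete algebra topologically generated by
`H`, `E`, `F` subject to the relations `UhRel`, i.e. the separated completion of the quotient of
the completed free algebra by the two-sided ideal generated by the relations (equivalently, its
quotient by the closure of that ideal). -/
def Uh : Type := HComp (RingQuot UhRel)

instance : Ring Uh := inferInstanceAs (Ring (HComp (RingQuot UhRel)))

instance : Algebra Rh Uh := inferInstanceAs (Algebra Rh (HComp (RingQuot UhRel)))

instance : IsAdicComplete hId Uh := inferInstanceAs (IsAdicComplete hId (HComp (RingQuot UhRel)))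

/-- The canonical map from the completed free algebra to `U_h`. -/
def freeToUh : FreeH →ₐ[Rh] Uh :=
  (hofAlg (A := RingQuot UhRel)).comp (RingQuot.mkAlgHom Rh UhRel)

/-- The generators of `U_h`. -/
def gen (g : Gen) : Uh := freeToUh (freeGen g)

section UniversalProperty

variable {B : Type*} [Ring B] [Algebra Rh B] [IsAdicComplete hId B]

/-- The relations of `U_h(sl₂)` for elements of an `h`-adically complete algebra. -/
structure SatRel (f : Gen → B) : Prop where
  HE : f .H * f .E - f .E * f .H = (2 : ℕ) • f .E
  HF : f .H * f .F - f .F * f .H = -((2 : ℕ) • f .F)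
  EF : f .E * f .F - f .F * f .E = qBr (f .H)

/-- The homomorphism from the completed free algebra with prescribed values. -/
def freeLift (f : Gen → B) : FreeH →ₐ[Rh] B :=
  hExtendAlg (A := FreeAlgebra Rh Gen) (FreeAlgebra.lift Rh f)

theorem freeLift_gen (f : Gen → B) (g : Gen) : freeLift f (freeGen g) = f g :=
  (hExtendAlg_hof (A := FreeAlgebra Rh Gen) _ _).trans (FreeAlgebra.lift_ι_apply f g)

/-- The homomorphism from `U_h` with prescribed values on the generators. -/
def uhLift (f : Gen → B) (hf : SatRel f) : Uh →ₐ[Rh] B :=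
  hExtendAlg (A := RingQuot UhRel) (RingQuot.liftAlgHom Rh ⟨freeLift f, by
    intro x y hxy
    cases hxy with
    | HE => simpa only [map_sub, map_mul, map_nsmul, freeLift_gen] using hf.HE
    | HF => simpa only [map_sub, map_mul, map_neg, map_nsmul, freeLift_gen] using hf.HF
    | EF => simpa only [map_sub, map_mul, map_qBr, freeLift_gen] using hf.EF⟩)

@[simp]
theorem uhLift_gen (f : Gen → B) (hf : SatRel f) (g : Gen) : uhLift f hf (gen g) = f g := by
  refine (hExtendAlg_hof (A := RingQuot UhRel) _ _).trans ?_
  erw [RingQuot.liftAlgHom_mkAlgHom_apply]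
  exact freeLift_gen f g

theorem uh_hom_ext {f g : Uh →ₐ[Rh] B} (h : ∀ x, f (gen x) = g (gen x)) : f = g := by
  refine hcomp_algHom_ext (A := RingQuot UhRel) (RingQuot.ringQuot_ext' Rh _ _ ?_)
  refine hcomp_algHom_ext (A := FreeAlgebra Rh Gen) (FreeAlgebra.hom_ext ?_)
  ext x
  exact h x

end UniversalProperty

theorem satRel_gen : SatRel gen where
  HE := by
    have := congrArg (hofAlg (A := RingQuot UhRel)) (RingQuot.mkAlgHom_rel Rh UhRel.HE)
    change freeToUh _ = freeToUh _ at this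
    simpa only [gen, map_sub, map_mul, map_nsmul] using this
  HF := by
    have := congrArg (hofAlg (A := RingQuot UhRel)) (RingQuot.mkAlgHom_rel Rh UhRel.HF)
    change freeToUh _ = freeToUh _ at this
    simpa only [gen, map_sub, map_mul, map_neg, map_nsmul] using this
  EF := by
    have := congrArg (hofAlg (A := RingQuot UhRel)) (RingQuot.mkAlgHom_rel Rh UhRel.EF)
    change freeToUh _ = freeToUh _ at this
    simpa only [gen, map_sub, map_mul, map_qBr] using this

section Commutation

theorem half_mul_two {B : Type*} [Ring B] [Algebra Rh B] (x : B) : cst (1 / 2) • ((2 : ℕ) • x) = x := by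
  rw [← Nat.cast_smul_eq_nsmul Rh, smul_smul]
  have : cst (1 / 2) * ((2 : ℕ) : Rh) = 1 := by
    rw [← map_natCast (PowerSeries.C (R := ℚ)), ← map_mul]
    norm_num
  rw [this, one_smul]

variable {B : Type*} [Ring B] [Algebra Rh B] [IsAdicComplete hId B] {f : Gen → B}

theorem SatRel.K_E (hf : SatRel f) : hExp (cst (1 / 2) • f .H) * f .E =
    vPow 2 • (f .E * hExp (cst (1 / 2) • f .H)) := by
  refine hExp_shift 2 ?_
  have h := congrArg (cst (1 / 2) • ·) (sub_eq_iff_eq_add.1 hf.HE)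
  simp only [smul_add, half_mul_two] at h
  simpa [mul_add, add_comm] using h

theorem SatRel.Kinv_E (hf : SatRel f) : hExp (-(cst (1 / 2) • f .H)) * f .E =
    vPow (-2) • (f .E * hExp (-(cst (1 / 2) • f .H))) := by
  refine hExp_shift (-2) ?_
  have h := congrArg (cst (1 / 2) • ·) (sub_eq_iff_eq_add.1 hf.HE)
  simp only [smul_add, half_mul_two] at h
  simpa [mul_add, add_comm] using congrArg Neg.neg h

theorem SatRel.K_F (hf : SatRel f) : hExp (cst (1 / 2) • f .H) * f .F =
    vPow (-2) • (f .F * hExp (cst (1 / 2) • f .H)) := by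
  refine hExp_shift (-2) ?_
  have h := congrArg (cst (1 / 2) • ·) (sub_eq_iff_eq_add.1 hf.HF)
  simp only [smul_add, smul_neg, half_mul_two] at h
  simpa [mul_add, add_comm] using h

theorem SatRel.Kinv_F (hf : SatRel f) : hExp (-(cst (1 / 2) • f .H)) * f .F =
    vPow 2 • (f .F * hExp (-(cst (1 / 2) • f .H))) := by
  refine hExp_shift 2 ?_
  have h := congrArg (cst (1 / 2) • ·) (sub_eq_iff_eq_add.1 hf.HF)
  simp only [smul_add, smul_neg, half_mul_two] at h
  simpa [mul_add, add_comm] using congrArg Neg.neg h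

end Commutation

namespace Uh

/-- The generator `H`. -/
def H : Uh := gen .H

/-- The generator `E`. -/
def E : Uh := gen .E

/-- The generator `F`. -/
def F : Uh := gen .F

/-- `K = exp (h H / 2)`. -/
def K : Uh := hExp (cst (1 / 2) • H)

/-- `K⁻¹ = exp (-h H / 2)`. -/
def Kinv : Uh := hExp (-(cst (1 / 2) • H))

theorem K_mul_Kinv : K * Kinv = 1 := by
  rw [K, Kinv, ← hExp_add ((Commute.refl _).neg_right), add_neg_cancel, hExp_zero]

theorem Kinv_mul_K : Kinv * K = 1 := by
  rw [K, Kinv, ← hExp_add ((Commute.refl _).neg_left), neg_add_cancel, hExp_zero]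

end Uh

/-! ### The completed tensor square and the Hopf algebra structure -/

/-- The `h`-adically completed tensor product `U_h ⊗̂ U_h`. -/
def Uh2 : Type := HComp (Uh ⊗[Rh] Uh)

instance : Ring Uh2 := inferInstanceAs (Ring (HComp (Uh ⊗[Rh] Uh)))

instance : Algebra Rh Uh2 := inferInstanceAs (Algebra Rh (HComp (Uh ⊗[Rh] Uh)))

instance : IsAdicComplete hId Uh2 := inferInstanceAs (IsAdicComplete hId (HComp (Uh ⊗[Rh] Uh)))

/-- The canonical map from the algebraic tensor square to the completed one. -/
def toUh2 : Uh ⊗[Rh] Uh →ₐ[Rh] Uh2 := hofAlg (A := Uh ⊗[Rh] Uh)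

/-- The tensor `x ⊗ y` in the completed tensor square. -/
def tm (x y : Uh) : Uh2 := toUh2 (x ⊗ₜ[Rh] y)

/-- `x ↦ x ⊗ 1`. -/
def inl : Uh →ₐ[Rh] Uh2 := toUh2.comp Algebra.TensorProduct.includeLeft

/-- `x ↦ 1 ⊗ x`. -/
def inr : Uh →ₐ[Rh] Uh2 := toUh2.comp Algebra.TensorProduct.includeRight

theorem tm_mul (a b c d : Uh) : tm a b * tm c d = tm (a * c) (b * d) := by
  rw [tm, tm, ← map_mul, Algebra.TensorProduct.tmul_mul_tmul, tm]

theorem inl_apply (x : Uh) : inl x = tm x 1 := rfl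

theorem inr_apply (x : Uh) : inr x = tm 1 x := rfl

theorem tm_eq (x y : Uh) : tm x y = inl x * inr y := by
  rw [inl_apply, inr_apply, tm_mul, mul_one, one_mul]

theorem commute_inl_inr (x y : Uh) : Commute (inl x) (inr y) := by
  rw [Commute, SemiconjBy, inl_apply, inr_apply, tm_mul, tm_mul]
  simp

theorem tm_add_left (x y z : Uh) : tm (x + y) z = tm x z + tm y z := by
  rw [tm, TensorProduct.add_tmul, map_add, tm, tm]

theorem tm_add_right (x y z : Uh) : tm x (y + z) = tm x y + tm x z := by
  rw [tm, TensorProduct.tmul_add, map_add, tm, tm]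

theorem tm_smul_left (c : Rh) (x y : Uh) : tm (c • x) y = c • tm x y := by
  rw [tm, ← TensorProduct.smul_tmul', map_smul, tm]

theorem tm_smul_right (c : Rh) (x y : Uh) : tm x (c • y) = c • tm x y := by
  rw [tm, TensorProduct.tmul_smul, map_smul, tm]

open Uh

theorem H_mul_E : H * E = (2 : Rh) • E + E * H := by
  have h := sub_eq_iff_eq_add.1 satRel_gen.HE
  rwa [← Nat.cast_smul_eq_nsmul Rh] at h

theorem H_mul_F : H * F = (-2 : Rh) • F + F * H := by
  have h := sub_eq_iff_eq_add.1 satRel_gen.HF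
  rwa [← Nat.cast_smul_eq_nsmul Rh, ← neg_smul] at h

theorem E_mul_F : E * F = qBr H + F * E := sub_eq_iff_eq_add.1 satRel_gen.EF

theorem H_mul_K : H * K = K * H :=
  (hExp_mul_comm (by rw [smul_mul_assoc, mul_smul_comm])).symm

theorem H_mul_Kinv : H * Kinv = Kinv * H :=
  (hExp_mul_comm (by rw [neg_mul, mul_neg, smul_mul_assoc, mul_smul_comm])).symm

theorem K_mul_E : K * E = vPow 2 • (E * K) := satRel_gen.K_E

theorem Kinv_mul_E : Kinv * E = vPow (-2) • (E * Kinv) := satRel_gen.Kinv_E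

theorem K_mul_F : K * F = vPow (-2) • (F * K) := satRel_gen.K_F

theorem Kinv_mul_F : Kinv * F = vPow 2 • (F * Kinv) := satRel_gen.Kinv_F

/-- The values of the comultiplication on the generators. -/
def comulGen : Gen → Uh2
  | .H => tm H 1 + tm 1 H
  | .E => tm E 1 + tm K E
  | .F => tm F Kinv + tm 1 F

theorem satRel_comulGen : SatRel comulGen where
  HE := by
    rw [← Nat.cast_smul_eq_nsmul Rh]
    simp only [comulGen, mul_add, add_mul, tm_mul, mul_one, one_mul, H_mul_K, H_mul_E,
      tm_add_left, tm_add_right, tm_smul_left, tm_smul_right, smul_add, Nat.cast_ofNat]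
    abel
  HF := by
    rw [← Nat.cast_smul_eq_nsmul Rh, ← neg_smul]
    simp only [comulGen, mul_add, add_mul, tm_mul, mul_one, one_mul, H_mul_Kinv, H_mul_F,
      tm_add_left, tm_add_right, tm_smul_left, tm_smul_right, smul_add, Nat.cast_ofNat]
    abel
  EF := by
    have h1 : qBr (inl H + inr H) = tm (qBr H) Kinv + tm K (qBr H) := by
      rw [qBr_add (commute_inl_inr H H), tm_eq, tm_eq, map_qBr, map_qBr, Kinv, map_hExp, K,
        map_hExp, map_neg, map_smul, map_smul]
    change _ = qBr (inl H + inr H)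
    have h2 : (vPow 2 * vPow (-2) : Rh) = 1 := by
      rw [← vPow_add]
      exact vPow_zero
    have h3 : E * Kinv = vPow 2 • (Kinv * E) := by
      rw [Kinv_mul_E, smul_smul, h2, one_smul]
    rw [h1]
    simp only [comulGen, mul_add, add_mul, tm_mul, mul_one, one_mul, K_mul_F, h3, E_mul_F,
      tm_add_left, tm_add_right, tm_smul_left, tm_smul_right, smul_smul, h2, one_smul]
    abel

/-- The comultiplication `Δ : U_h → U_h ⊗̂ U_h`. -/
def comul : Uh →ₐ[Rh] Uh2 := uhLift comulGen satRel_comulGen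

theorem satRel_counit : SatRel (fun _ : Gen => (0 : Rh)) where
  HE := by simp
  HF := by simp
  EF := by simp [qBr_zero]

/-- The counit `ε : U_h → ℚ⟦h⟧`, which vanishes on the generators. -/
def counit : Uh →ₐ[Rh] Rh := uhLift (fun _ => 0) satRel_counit

/-- The values of the antipode on the generators. -/
def antipodeGen : Gen → Uhᵐᵒᵖ
  | .H => .op (-H)
  | .E => .op (-(Kinv * E))
  | .F => .op (-(F * K))

/-- The values of the inverse of the antipode on the generators. -/
def antipodeInvGen : Gen → Uhᵐᵒᵖ
  | .H => .op (-H)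
  | .E => .op (-(E * Kinv))
  | .F => .op (-(K * F))

theorem qBr_op (x : Uh) : qBr (MulOpposite.op x) = MulOpposite.op (qBr x) := by
  rw [qBr, qBr, MulOpposite.op_smul]
  congr 1
  refine hSum_unique fun k => ?_
  have := map_mem_hPow (MulOpposite.opLinearEquiv Rh).toLinearMap (hSum_spec (shS x) k)
  simpa [shS] using this

theorem hExp_op (x : Uh) : hExp (MulOpposite.op x) = MulOpposite.op (hExp x) := by
  refine hSum_unique fun k => ?_
  have := map_mem_hPow (MulOpposite.opLinearEquiv Rh).toLinearMap (hSum_spec (expS x) k)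
  simpa [hExp, expS] using this

theorem EF_comm_Kinv : Kinv * (E * F) = E * F * Kinv := by
  have h2 : (vPow (-2) * vPow 2 : Rh) = 1 := by
    rw [← vPow_add]
    exact vPow_zero
  rw [← mul_assoc, Kinv_mul_E, smul_mul_assoc, mul_assoc, Kinv_mul_F, mul_smul_comm, smul_smul,
    h2, one_smul, mul_assoc]

theorem satRel_antipodeGen : SatRel antipodeGen where
  HE := by
    rw [← Nat.cast_smul_eq_nsmul Rh]
    apply MulOpposite.unop_injective
    simp only [antipodeGen, MulOpposite.unop_sub, MulOpposite.unop_mul, MulOpposite.unop_op,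
      MulOpposite.unop_smul, neg_mul_neg, ← mul_assoc, H_mul_Kinv]
    simp only [mul_assoc, H_mul_E, mul_add, mul_smul_comm, smul_neg, Nat.cast_ofNat]
    abel
  HF := by
    rw [← Nat.cast_smul_eq_nsmul Rh, ← neg_smul]
    apply MulOpposite.unop_injective
    simp only [antipodeGen, MulOpposite.unop_sub, MulOpposite.unop_mul, MulOpposite.unop_op,
      MulOpposite.unop_smul, neg_mul_neg, ← mul_assoc, H_mul_F, add_mul, smul_mul_assoc]
    simp only [mul_assoc, H_mul_K, smul_neg, Nat.cast_ofNat, neg_smul]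
    abel
  EF := by
    change _ = qBr (MulOpposite.op (-H))
    rw [qBr_op, qBr_neg]
    apply MulOpposite.unop_injective
    simp only [antipodeGen, MulOpposite.unop_sub, MulOpposite.unop_mul, MulOpposite.unop_op,
      neg_mul_neg]
    have h1 : F * K * (Kinv * E) = F * E := by
      rw [mul_assoc, ← mul_assoc K, K_mul_Kinv, one_mul]
    have h2 : Kinv * E * (F * K) = E * F := by
      rw [mul_assoc, ← mul_assoc E, ← mul_assoc Kinv, EF_comm_Kinv, mul_assoc, Kinv_mul_K, mul_one]
    rw [h1, h2, E_mul_F]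
    abel

theorem satRel_antipodeInvGen : SatRel antipodeInvGen where
  HE := by
    rw [← Nat.cast_smul_eq_nsmul Rh]
    apply MulOpposite.unop_injective
    simp only [antipodeInvGen, MulOpposite.unop_sub, MulOpposite.unop_mul, MulOpposite.unop_op,
      MulOpposite.unop_smul, neg_mul_neg, ← mul_assoc, H_mul_E, add_mul, smul_mul_assoc]
    simp only [mul_assoc, H_mul_Kinv, smul_neg, Nat.cast_ofNat]
    abel
  HF := by
    rw [← Nat.cast_smul_eq_nsmul Rh, ← neg_smul]
    apply MulOpposite.unop_injective
    simp only [antipodeInvGen, MulOpposite.unop_sub, MulOpposite.unop_mul, MulOpposite.unop_op,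
      MulOpposite.unop_smul, neg_mul_neg, ← mul_assoc, H_mul_K]
    simp only [mul_assoc, H_mul_F, mul_add, mul_smul_comm, smul_neg, Nat.cast_ofNat]
    simp only [neg_smul]
    abel
  EF := by
    change _ = qBr (MulOpposite.op (-H))
    rw [qBr_op, qBr_neg]
    apply MulOpposite.unop_injective
    simp only [antipodeInvGen, MulOpposite.unop_sub, MulOpposite.unop_mul, MulOpposite.unop_op,
      neg_mul_neg]
    have h1 : K * F * (E * Kinv) = F * E := by
      have h3 : (vPow 2 * vPow (-2) : Rh) = 1 := by
        rw [← vPow_add]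
        exact vPow_zero
      have h4 : E * Kinv = vPow 2 • (Kinv * E) := by
        rw [Kinv_mul_E, smul_smul, h3, one_smul]
      rw [h4, K_mul_F, smul_mul_smul_comm, mul_comm, h3, one_smul, mul_assoc, ← mul_assoc K,
        K_mul_Kinv, one_mul]
    have h2 : E * Kinv * (K * F) = E * F := by
      rw [mul_assoc, ← mul_assoc Kinv, Kinv_mul_K, one_mul]
    rw [h1, h2, E_mul_F]
    abel

/-- The antipode as a homomorphism to the opposite algebra. -/
def antipodeOp : Uh →ₐ[Rh] Uhᵐᵒᵖ := uhLift antipodeGen satRel_antipodeGen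

/-- The inverse of the antipode as a homomorphism to the opposite algebra. -/
def antipodeInvOp : Uh →ₐ[Rh] Uhᵐᵒᵖ := uhLift antipodeInvGen satRel_antipodeInvGen

/-- The antipode `S : U_h → U_h`. -/
def antipode : Uh →ₗ[Rh] Uh :=
  (MulOpposite.opLinearEquiv Rh).symm.toLinearMap ∘ₗ antipodeOp.toLinearMap

/-- The inverse `S⁻¹ : U_h → U_h` of the antipode. -/
def antipodeInv : Uh →ₗ[Rh] Uh :=
  (MulOpposite.opLinearEquiv Rh).symm.toLinearMap ∘ₗ antipodeInvOp.toLinearMap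

theorem antipode_mul (x y : Uh) : antipode (x * y) = antipode y * antipode x := by
  simp [antipode]

theorem antipodeInv_mul (x y : Uh) : antipodeInv (x * y) = antipodeInv y * antipodeInv x := by
  simp [antipodeInv]

theorem antipode_H : antipode H = -H :=
  congrArg MulOpposite.unop (uhLift_gen antipodeGen satRel_antipodeGen .H)

theorem antipode_E : antipode E = -(Kinv * E) :=
  congrArg MulOpposite.unop (uhLift_gen antipodeGen satRel_antipodeGen .E)

theorem antipode_F : antipode F = -(F * K) :=
  congrArg MulOpposite.unop (uhLift_gen antipodeGen satRel_antipodeGen .F)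

theorem antipodeInv_H : antipodeInv H = -H :=
  congrArg MulOpposite.unop (uhLift_gen antipodeInvGen satRel_antipodeInvGen .H)

theorem antipodeInv_E : antipodeInv E = -(E * Kinv) :=
  congrArg MulOpposite.unop (uhLift_gen antipodeInvGen satRel_antipodeInvGen .E)

theorem antipodeInv_F : antipodeInv F = -(K * F) :=
  congrArg MulOpposite.unop (uhLift_gen antipodeInvGen satRel_antipodeInvGen .F)

theorem antipode_hExp (x : Uh) : antipode (hExp x) = hExp (antipode x) := by
  apply MulOpposite.op_injective
  rw [← hExp_op]
  exact map_hExp antipodeOp x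

theorem antipodeInv_hExp (x : Uh) : antipodeInv (hExp x) = hExp (antipodeInv x) := by
  apply MulOpposite.op_injective
  rw [← hExp_op]
  exact map_hExp antipodeInvOp x

theorem antipode_K : antipode K = Kinv := by
  rw [K, antipode_hExp, map_smul, antipode_H, smul_neg, Kinv]

theorem antipode_Kinv : antipode Kinv = K := by
  rw [Kinv, antipode_hExp, map_neg, map_smul, antipode_H, smul_neg, neg_neg, K]

theorem antipodeInv_K : antipodeInv K = Kinv := by
  rw [K, antipodeInv_hExp, map_smul, antipodeInv_H, smul_neg, Kinv]

theorem antipodeInv_Kinv : antipodeInv Kinv = K := by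
  rw [Kinv, antipodeInv_hExp, map_neg, map_smul, antipodeInv_H, smul_neg, neg_neg, K]

theorem antipodeInv_antipode (x : Uh) : antipodeInv (antipode x) = x := by
  have h := uh_hom_ext (f := AlgHom.ofLinearMap (antipodeInv ∘ₗ antipode)
    (by simp [antipode, antipodeInv])
    (fun x y => by simp [antipode_mul, antipodeInv_mul])) (g := AlgHom.id Rh Uh) (by
      rintro (_ | _ | _)
      · change antipodeInv (antipode H) = H
        rw [antipode_H, map_neg, antipodeInv_H, neg_neg]
      · change antipodeInv (antipode E) = E
        rw [antipode_E, map_neg, antipodeInv_mul, antipodeInv_E, antipodeInv_Kinv, neg_mul,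
          neg_neg, mul_assoc, Kinv_mul_K, mul_one]
      · change antipodeInv (antipode F) = F
        rw [antipode_F, map_neg, antipodeInv_mul, antipodeInv_F, antipodeInv_K, mul_neg,
          neg_neg, ← mul_assoc, Kinv_mul_K, one_mul])
  exact AlgHom.congr_fun h x

theorem antipode_antipodeInv (x : Uh) : antipode (antipodeInv x) = x := by
  have h := uh_hom_ext (f := AlgHom.ofLinearMap (antipode ∘ₗ antipodeInv)
    (by simp [antipode, antipodeInv])
    (fun x y => by simp [antipode_mul, antipodeInv_mul])) (g := AlgHom.id Rh Uh) (by
      rintro (_ | _ | _)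
      · change antipode (antipodeInv H) = H
        rw [antipodeInv_H, map_neg, antipode_H, neg_neg]
      · change antipode (antipodeInv E) = E
        rw [antipodeInv_E, map_neg, antipode_mul, antipode_E, antipode_Kinv, mul_neg,
          neg_neg, ← mul_assoc, K_mul_Kinv, one_mul]
      · change antipode (antipodeInv F) = F
        rw [antipodeInv_F, map_neg, antipode_mul, antipode_F, antipode_K, neg_mul,
          neg_neg, mul_assoc, K_mul_Kinv, mul_one])
  exact AlgHom.congr_fun h x

/-! ### The universal `R`-matrix -/

/-- The quantum integer `[n] = (vⁿ - v⁻ⁿ) / (v - v⁻¹) = v^(n-1) + v^(n-3) + ⋯ + v^(1-n)`. -/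
def qInt (n : ℕ) : Rh := ∑ j ∈ Finset.range n, vPow ((n : ℤ) - 1 - 2 * j)

/-- The quantum factorial `[n]!`. -/
def qFact (n : ℕ) : Rh := ∏ i ∈ Finset.range n, qInt (i + 1)

/-- `D = exp (h / 4 H ⊗ H)`. -/
def Dmat : Uh2 := hExp (cst (1 / 4) • tm H H)

/-- The universal `R`-matrix
`D (∑ v^(n(n-1)/2) (v - v⁻¹)ⁿ / [n]! Fⁿ ⊗ Eⁿ)`, where `v - v⁻¹ = h sh`. -/
def Rmat : Uh2 :=
  Dmat * hSum (PowerSeries.mk fun n =>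
    (vPow (n * (n - 1) / 2) * sh ^ n * (qFact n)⁻¹) • tm (F ^ n) (E ^ n))

/-! ### The transmutation of `U_h` -/

/-- Summation `∑ f (x' ⊗ x'')` over the tensors of an element `x = ∑ x' ⊗ x''` of the completed
tensor square. -/
def sum2 {N : Type*} [AddCommGroup N] [Module Rh N] [IsAdicComplete hId N] :
    Uh2 →ₗ[Rh] (Uh ⊗[Rh] Uh →ₗ[Rh] N) →ₗ[Rh] N := hPair (M := Uh ⊗[Rh] Uh)

/-- The extension to the completed tensor square. -/
def ext2 {N : Type*} [AddCommGroup N] [Module Rh N] [IsAdicComplete hId N]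
    (f : Uh ⊗[Rh] Uh →ₗ[Rh] N) : Uh2 →ₗ[Rh] N := hExtend (M := Uh ⊗[Rh] Uh) f

/-- The left adjoint action `x ▷ y = ∑ x₍₁₎ y S(x₍₂₎)`. -/
def ad : Uh →ₗ[Rh] Uh →ₗ[Rh] Uh :=
  LinearMap.mk₂ Rh
    (fun x y => sum2 (comul x)
      (LinearMap.mul' Rh Uh ∘ₗ TensorProduct.map (LinearMap.mulRight Rh y) antipode))
    (fun x x' y => by simp) (fun c x y => by simp)
    (fun x y y' => by
      rw [← map_add]
      congr 1
      exact TensorProduct.ext' fun a b => by simp [mul_add, add_mul])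
    (fun c x y => by
      rw [← map_smul]
      congr 1
      exact TensorProduct.ext' fun a b => by simp)

/-- The map `a ⊗ b ↦ g b ⊗ f a` into the completed tensor square. -/
def swapMap (f g : Uh →ₗ[Rh] Uh) : Uh ⊗[Rh] Uh →ₗ[Rh] Uh2 :=
  toUh2.toLinearMap ∘ₗ TensorProduct.map g f ∘ₗ (TensorProduct.comm Rh Uh Uh).toLinearMap

theorem swapMap_tmul (f g : Uh →ₗ[Rh] Uh) (a b : Uh) :
    swapMap f g (a ⊗ₜ b) = tm (g b) (f a) := rfl

theorem tm_zero_left (x : Uh) : tm 0 x = 0 := by simp [tm]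

/-- The bilinear map `(f, g) ↦ swapMap f g`. -/
def swapMap₂ : (Uh →ₗ[Rh] Uh) →ₗ[Rh] (Uh →ₗ[Rh] Uh) →ₗ[Rh] (Uh ⊗[Rh] Uh →ₗ[Rh] Uh2) :=
  LinearMap.mk₂ Rh swapMap
    (fun f f' g => TensorProduct.ext' fun a b => by simp [swapMap_tmul, tm_add_right])
    (fun c f g => TensorProduct.ext' fun a b => by simp [swapMap_tmul, tm_smul_right])
    (fun f g g' => TensorProduct.ext' fun a b => by simp [swapMap_tmul, tm_add_left])
    (fun c f g => TensorProduct.ext' fun a b => by simp [swapMap_tmul, tm_smul_left])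

/-- The braiding `ψ (x ⊗ y) = ∑ (β ▷ y) ⊗ (α ▷ x)`, where `R = ∑ α ⊗ β`. -/
def braiding : Uh2 →ₗ[Rh] Uh2 :=
  ext2 (TensorProduct.lift (LinearMap.mk₂ Rh
    (fun x y => sum2 Rmat (swapMap₂ (ad.flip x) (ad.flip y)))
    (fun x x' y => by simp) (fun c x y => by simp)
    (fun x y y' => by simp) (fun c x y => by simp)))

/-- The inverse braiding `ψ⁻¹ (x ⊗ y) = ∑ (S(α) ▷ y) ⊗ (β ▷ x)`, where `R = ∑ α ⊗ β`. -/
def braidingInv : Uh2 →ₗ[Rh] Uh2 :=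
  ext2 (TensorProduct.lift (LinearMap.mk₂ Rh
    (fun x y => sum2 Rmat (toUh2.toLinearMap ∘ₗ
      TensorProduct.map (ad.flip y ∘ₗ antipode) (ad.flip x)))
    (fun x x' y => by
      rw [← map_add]
      congr 1
      exact TensorProduct.ext' fun a b => by simp [TensorProduct.tmul_add])
    (fun c x y => by
      rw [← map_smul]
      congr 1
      exact TensorProduct.ext' fun a b => by simp)
    (fun x y y' => by
      rw [← map_add]
      congr 1
      exact TensorProduct.ext' fun a b => by simp [TensorProduct.add_tmul])
    (fun c x y => by
      rw [← map_smul]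
      congr 1
      exact TensorProduct.ext' fun a b => by simp [← TensorProduct.smul_tmul'])))

/-- The multiplication `μ : U_h ⊗̂ U_h → U_h`. -/
def mult : Uh2 →ₗ[Rh] Uh := ext2 (LinearMap.mul' Rh Uh)

/-- The unit `η : ℚ⟦h⟧ → U_h`. -/
def unit : Rh →ₗ[Rh] Uh := Algebra.linearMap Rh Uh

/-- The braided comultiplication `x ↦ ∑ x₍₁₎ S(β) ⊗ (α ▷ x₍₂₎)`, where `R = ∑ α ⊗ β`. -/
def bComul : Uh →ₗ[Rh] Uh2 :=
  ext2 (TensorProduct.lift (LinearMap.mk₂ Rh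
    (fun x y => sum2 Rmat (swapMap₂ (ad.flip y) (LinearMap.mulLeft Rh x ∘ₗ antipode)))
    (fun x x' y => by
      rw [← map_add]
      congr 1
      exact TensorProduct.ext' fun a b => by simp [swapMap₂, swapMap_tmul, add_mul, tm_add_left])
    (fun c x y => by
      rw [← map_smul]
      congr 1
      exact TensorProduct.ext' fun a b => by simp [swapMap₂, swapMap_tmul, tm_smul_left])
    (fun x y y' => by simp) (fun c x y => by simp))) ∘ₗ comul.toLinearMap

/-- The braided antipode `x ↦ ∑ β S(α ▷ x)`, where `R = ∑ α ⊗ β`. -/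
def bAntipode : Uh →ₗ[Rh] Uh :=
  sum2 Rmat ∘ₗ
    { toFun := fun x => LinearMap.mul' Rh Uh ∘ₗ
        TensorProduct.map LinearMap.id (antipode ∘ₗ ad.flip x) ∘ₗ
          (TensorProduct.comm Rh Uh Uh).toLinearMap
      map_add' := fun x y => TensorProduct.ext' fun a b => by simp [mul_add]
      map_smul' := fun c x => TensorProduct.ext' fun a b => by simp }

/-- The inverse braided antipode `x ↦ ∑ S⁻¹(α ▷ x) β`, where `R = ∑ α ⊗ β`. -/
def bAntipodeInv : Uh →ₗ[Rh] Uh :=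
  sum2 Rmat ∘ₗ
    { toFun := fun x => LinearMap.mul' Rh Uh ∘ₗ
        TensorProduct.map (antipodeInv ∘ₗ ad.flip x) LinearMap.id
      map_add' := fun x y => TensorProduct.ext' fun a b => by simp [add_mul]
      map_smul' := fun c x => TensorProduct.ext' fun a b => by simp }

/-! ### The even integral form and its completions -/

/-- The subring `ℤ[q, q⁻¹]` of `ℚ⟦h⟧`. -/
def Zq : Subring Rh := Subring.closure {vPow 2, vPow (-2)}

/-- `e = (v - v⁻¹) E`. -/
def e : Uh := (vPow 1 - vPow (-1)) • E

/-- The quantum integer `[n]_q = (qⁿ - 1) / (q - 1) = 1 + q + ⋯ + q^(n-1)`. -/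
def qIntQ (n : ℕ) : Rh := ∑ j ∈ Finset.range n, vPow (2 * j)

/-- The quantum factorial `[n]_q!`. -/
def qFactQ (n : ℕ) : Rh := ∏ i ∈ Finset.range n, qIntQ (i + 1)

/-- The divided power `Fⁿ Kⁿ / [n]_q!`. -/
def Fdiv (n : ℕ) : Uh := (qFactQ n)⁻¹ • (F ^ n * K ^ n)

/-- The even integral form: the `ℤ[q, q⁻¹]`-subalgebra of `U_h` generated by `K²`, `K⁻²`, `e` and
`Fdiv n` for `n ≥ 1`. -/
def Uev : Subalgebra Zq Uh :=
  Algebra.adjoin Zq ({K ^ 2, Kinv ^ 2, e} ∪ {x | ∃ n : ℕ, 1 ≤ n ∧ x = Fdiv n})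

/-- The two-sided ideal of the even integral form generated by `eᵖ`. -/
def fil1 (p : ℕ) : Submodule Zq Uh :=
  Submodule.span Zq {x | ∃ a ∈ Uev, ∃ b ∈ Uev, x = a * e ^ p * b}

/-- The filtration of the tensor square of the even integral form, inside `U_h ⊗̂ U_h`. -/
def fil2 (p : ℕ) : Submodule Zq Uh2 :=
  Submodule.span Zq {z | ∃ x ∈ fil1 p, ∃ y ∈ Uev, z = tm x y} ⊔
    Submodule.span Zq {z | ∃ x ∈ Uev, ∃ y ∈ fil1 p, z = tm x y}

/-- The filtration of the zeroth tensor power `ℤ[q, q⁻¹]`, inside `ℚ⟦h⟧`. -/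
def fil0 (p : ℕ) : Submodule Zq Rh := if p = 0 then 1 else ⊥

section FilteredCompletion

variable {M : Type*} [AddCommGroup M] [Module Rh M]
variable {N : Type*} [AddCommGroup N] [Module Rh N]

/-- `h`-adic convergence of a sequence. -/
def HTendsto (w : ℕ → M) (x : M) : Prop := ∀ k, ∃ n₀, ∀ n ≥ n₀, w n - x ∈ hPow M k

/-- The `p`-th step of the filtration of the completion in `M` of the filtered module
`L 0 ⊇ L 1 ⊇ ⋯`. An element of the inverse limit of the quotients `L 0 / L n` is represented by a
sequence `w` in `L 0` with `w (n + 1) ≡ w n` modulo `L n`; it lies in the `p`-th step if its image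
in `L 0 / L p` vanishes; and its image in `M` is the `h`-adic limit of `w`. -/
def complFil (L : ℕ → Submodule Zq M) (p : ℕ) : Submodule Zq M where
  carrier := {x | ∃ w : ℕ → M, (∀ n, w n ∈ L 0) ∧ (∀ n, w (n + 1) - w n ∈ L n) ∧ w p ∈ L p ∧
    HTendsto w x}
  add_mem' := by
    rintro x y ⟨w, h1, h2, h3, h4⟩ ⟨w', h1', h2', h3', h4'⟩
    refine ⟨w + w', fun n => add_mem (h1 n) (h1' n), fun n => ?_, add_mem h3 h3', fun k => ?_⟩
    · simpa [add_sub_add_comm] using add_mem (h2 n) (h2' n)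
    · obtain ⟨n₀, hn⟩ := h4 k
      obtain ⟨n₁, hn'⟩ := h4' k
      refine ⟨max n₀ n₁, fun n hnn => ?_⟩
      simpa [add_sub_add_comm] using
        add_mem (hn n (le_of_max_le_left hnn)) (hn' n (le_of_max_le_right hnn))
  zero_mem' := ⟨0, by simp, by simp, by simp, fun k => ⟨0, by simp⟩⟩
  smul_mem' := by
    rintro c x ⟨w, h1, h2, h3, h4⟩
    refine ⟨c • w, fun n => Submodule.smul_mem _ _ (h1 n), fun n => ?_,
      Submodule.smul_mem _ _ h3, fun k => ?_⟩
    · simpa [smul_sub] using Submodule.smul_mem _ c (h2 n)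
    · obtain ⟨n₀, hn⟩ := h4 k
      refine ⟨n₀, fun n hnn => ?_⟩
      have := Submodule.smul_mem _ (c : Rh) (hn n hnn)
      rw [smul_sub] at this
      exact this

/-- The completion in `M` of a filtered module `L 0 ⊇ L 1 ⊇ ⋯`: the image in `M` of the inverse
limit of the quotients `L 0 / L n`. -/
def Compl (L : ℕ → Submodule Zq M) : Type _ := {x : M // x ∈ complFil L 0}

/-- The topology of the completion, generated by the cosets of the subgroups `complFil L p`
(which form a basis, as `L` is decreasing); it is the quotient of the inverse limit topology. -/
instance (L : ℕ → Submodule Zq M) : TopologicalSpace (Compl L) :=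
  TopologicalSpace.generateFrom
    {V | ∃ (x : Compl L) (p : ℕ), V = {y | y.1 - x.1 ∈ complFil L p}}

/-- A linear map restricts to a continuous map between the completions of filtered modules. -/
def RestrictsContinuously (f : M →ₗ[Rh] N) (L : ℕ → Submodule Zq M) (L' : ℕ → Submodule Zq N) :
    Prop :=
  ∃ hf : ∀ x ∈ complFil L 0, f x ∈ complFil L' 0,
    Continuous (X := Compl L) (Y := Compl L') fun x => ⟨f x.1, hf x.1 x.2⟩

end FilteredCompletion

end QuantumSl2

end

/-! On weight vectors the Cartan factor D of the R-matrix turns into a power of K or a power of v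
(`ext2_Dmat_mul`). Hence each structure map built from R becomes an explicit h-adic series whose
n-th term pairs Fⁿ with Eⁿ (`hasHSum_braiding`, `hasHSum_bComulAux`, `hasHSum_bAntipode` and their
companions). Weight vectors are dense, so such series determine the maps.

Integrality. Writing [n]! in terms of [n]_q! makes the power of v in the n-th term even, and the
remaining scalars split into 1/[n]_q! for Fⁿ and (v - v⁻¹)ⁿ for Eⁿ (`X_pow_smul_rCoeff_smul`). By a
q-binomial expansion, Fⁿ/[n]_q! acts on x through products F̃⁽ⁱ⁾ x F̃⁽ʲ⁾ with coefficients ± powers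
of q (`ad_F_pow_mem_filWt`). The power eⁿ acts on y through products eⁱ y eʲ with i + j = n, so the
result lies in step n/2 of the filtration (`ad_e_pow_mem_fil1`). Thus each term is integral and the
series converge for the filtration. The antipode and Δ introduce odd powers of K and so leave the
even form, but these powers are governed by weights: `filWt` and `twFil` record the corrected
conditions, and the powers of K coming from D supply the correction.
`RestrictsContinuously.of_map_mem` then passes to completions; there a map may lose half of the
filtration degree, as the braided comultiplication does in the estimate used.

Invertibility. The cancellations rest on the alternating q-binomial sum `sum_neg_one_pow_qfInv`. For
ψ ψ⁻¹ it applies directly. For the antipode, the series of S ∘ S̲⁻¹ and of S̲ are regrouped around t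
= `tElt` and w = `wElt`; t commutes with powers of E up to powers of K and v (`tElt_mul_E`), and t w
= 1, so in the composite t and w cancel and the alternating sum removes all terms but the first. The
opposite compositions follow because the relevant maps are the identity modulo h, hence injective
(`injective_of_sub_mem_hPow`). -/

open scoped TensorProduct

namespace QuantumSl2

open Uh
open Finset.HasAntidiagonal (antidiagonal mem_antidiagonal)

/-! ### Convergent sums in `h`-adically complete modules -/

section Sums

variable {M : Type*} [AddCommGroup M] [Module Rh M]
variable {N : Type*} [AddCommGroup N] [Module Rh N]

theorem hPow_anti {k l : ℕ} (h : k ≤ l) {x : M} (hx : x ∈ hPow M l) : x ∈ hPow M k := by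
  obtain ⟨y, rfl⟩ := mem_hPow_iff.1 hx
  refine mem_hPow_iff.2 ⟨(PowerSeries.X : Rh) ^ (l - k) • y, ?_⟩
  rw [smul_smul, ← pow_add, Nat.add_sub_cancel' h]

theorem X_pow_smul_mem_hPow (k : ℕ) (x : M) : (PowerSeries.X : Rh) ^ k • x ∈ hPow M k :=
  mem_hPow_iff.2 ⟨x, rfl⟩

theorem X_pow_smul_mem_hPow_add {k l : ℕ} {x : M} (hx : x ∈ hPow M l) :
    (PowerSeries.X : Rh) ^ k • x ∈ hPow M (k + l) := by
  obtain ⟨y, rfl⟩ := mem_hPow_iff.1 hx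
  exact mem_hPow_iff.2 ⟨y, by rw [smul_smul, pow_add]⟩

/-- The `h`-adically convergent sum `x = ∑ hⁿ aₙ`. -/
def HasHSum (a : ℕ → M) (x : M) : Prop :=
  ∀ k, x - ∑ n ∈ Finset.range k, (PowerSeries.X : Rh) ^ n • a n ∈ hPow M k

theorem HasHSum.unique [IsHausdorff hId M] {a : ℕ → M} {x y : M} (hx : HasHSum a x)
    (hy : HasHSum a y) : x = y :=
  eq_of_sub_mem_hPow fun k => by simpa using Submodule.sub_mem _ (hx k) (hy k)

theorem HasHSum.congr {a b : ℕ → M} {x : M} (hx : HasHSum a x) (h : ∀ n, a n = b n) :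
    HasHSum b x := (funext h : a = b) ▸ hx

theorem HasHSum.map {a : ℕ → M} {x : M} (hx : HasHSum a x) (f : M →ₗ[Rh] N) :
    HasHSum (fun n => f (a n)) (f x) := fun k => by
  simpa using map_mem_hPow f (hx k)

theorem HasHSum.sub {a b : ℕ → M} {x y : M} (hx : HasHSum a x) (hy : HasHSum b y) :
    HasHSum (fun n => a n - b n) (x - y) := fun k => by
  have := Submodule.sub_mem _ (hx k) (hy k)
  simp only [smul_sub, Finset.sum_sub_distrib]
  convert this using 1
  abel

theorem hasHSum_zero : HasHSum (fun _ => (0 : M)) 0 := fun k => by simp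

theorem hasHSum_single {a : ℕ → M} (h : ∀ n, a (n + 1) = 0) : HasHSum a (a 0) := fun k => by
  rcases k with _ | k
  · exact mem_hPow_zero _
  · rw [Finset.sum_range_succ', Finset.sum_eq_zero fun i _ => by rw [h, smul_zero]]
    simp

/-- A sum with vanishing constant term can be shifted. -/
theorem HasHSum.shift {a : ℕ → M} {x : M} (hx : HasHSum a x) (h0 : a 0 = 0) :
    HasHSum (fun n => (PowerSeries.X : Rh) • a (n + 1)) x := fun k => by
  have := hPow_anti (Nat.le_succ k) (hx (k + 1))
  rw [Finset.sum_range_succ', h0, smul_zero, add_zero] at this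
  simpa only [smul_smul, ← pow_succ] using this

theorem hasHSum_hSum {B : Type*} [Ring B] [Algebra Rh B] [IsAdicComplete hId B]
    (a : PowerSeries B) : HasHSum (fun n => PowerSeries.coeff n a) (hSum a) := hSum_spec a

/-- Summation of a double series along the antidiagonals. -/
theorem hasHSum_antidiagonal {s : ℕ → ℕ → M} {t : ℕ → M} (hs : ∀ i, HasHSum (s i) (t i)) {z : M} :
    HasHSum (fun n => ∑ p ∈ antidiagonal n, s p.1 p.2) z ↔ HasHSum t z := by
  refine forall_congr' fun k => ?_
  -- Truncating row i at k - i makes an error in hᵏ⁻ⁱ, which the factor hⁱ moves into hᵏ; so the two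
  -- partial sums agree modulo hᵏ.
  have key : ∑ i ∈ Finset.range k, (PowerSeries.X : Rh) ^ i • t i -
      ∑ n ∈ Finset.range k, (PowerSeries.X : Rh) ^ n • ∑ p ∈ antidiagonal n, s p.1 p.2 ∈
        hPow M k := by
    have h1 : ∑ n ∈ Finset.range k, (PowerSeries.X : Rh) ^ n •
        ∑ p ∈ antidiagonal n, s p.1 p.2 =
        ∑ i ∈ Finset.range k, (PowerSeries.X : Rh) ^ i •
          ∑ j ∈ Finset.range (k - i), (PowerSeries.X : Rh) ^ j • s i j := by
      simp only [Finset.smul_sum, smul_smul, ← pow_add]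
      rw [Finset.sum_sigma', Finset.sum_sigma']
      refine Finset.sum_bij' (fun x _ => ⟨x.2.1, x.2.2⟩) (fun x _ => ⟨x.1 + x.2, (x.1, x.2)⟩)
        ?_ ?_ ?_ ?_ ?_
      · rintro ⟨n, p⟩ h
        simp only [Finset.mem_sigma, Finset.mem_range, mem_antidiagonal] at h ⊢
        omega
      · rintro ⟨n, p⟩ h
        simp only [Finset.mem_sigma, Finset.mem_range, mem_antidiagonal] at h ⊢
        exact ⟨by omega, trivial⟩
      · rintro ⟨n, p⟩ h
        simp only [Finset.mem_sigma, Finset.mem_range, mem_antidiagonal] at h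
        obtain ⟨_, rfl⟩ := h
        rfl
      · rintro ⟨n, p⟩ h
        rfl
      · rintro ⟨n, p⟩ h
        simp only [Finset.mem_sigma, Finset.mem_range, mem_antidiagonal] at h
        obtain ⟨_, rfl⟩ := h
        rfl
    rw [h1, ← Finset.sum_sub_distrib]
    refine Submodule.sum_mem _ fun i hi => ?_
    rw [← smul_sub]
    have := X_pow_smul_mem_hPow_add (k := i) (hs i (k - i))
    rwa [Nat.add_sub_cancel' (Finset.mem_range.1 hi).le] at this
  constructor <;> intro h
  · have := Submodule.sub_mem _ h key
    convert this using 1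
    abel
  · have := Submodule.add_mem _ h key
    convert this using 1
    abel

/-- Two linear maps which agree on corresponding powers agree on exponentials. -/
theorem map_hExp_eq {B C : Type*} [Ring B] [Algebra Rh B] [IsAdicComplete hId B] [Ring C]
    [Algebra Rh C] [IsAdicComplete hId C] [IsHausdorff hId N] (f : B →ₗ[Rh] N) (g : C →ₗ[Rh] N)
    {x : B} {y : C} (h : ∀ n, f (x ^ n) = g (y ^ n)) : f (hExp x) = g (hExp y) := by
  refine ((hasHSum_hSum (expS x)).map f).unique (((hasHSum_hSum (expS y)).map g).congr fun n => ?_)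
  simp [expS, h]

/-- An endomorphism of a separated module which is the identity modulo `h` is injective. -/
theorem injective_of_sub_mem_hPow [IsHausdorff hId M] (f : M →ₗ[Rh] M)
    (hf : ∀ x, f x - x ∈ hPow M 1) : Function.Injective f := by
  rw [injective_iff_map_eq_zero]
  intro x hx
  refine eq_of_sub_mem_hPow fun k => ?_
  rw [sub_zero]
  induction k with
  | zero => exact mem_hPow_zero _
  | succ k ih =>
    obtain ⟨y, rfl⟩ := mem_hPow_iff.1 ih
    -- If hᵏ y is in the kernel, then hᵏ (f y - y) = -hᵏ y, and the left side lies in hᵏ⁺¹ M.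
    have h1 := X_pow_smul_mem_hPow_add (k := k) (hf y)
    rwa [smul_sub, ← map_smul, hx, zero_sub, Submodule.neg_mem_iff] at h1

end Sums

/-! ### Completions of filtered modules -/

section FilteredCompletion

variable {M : Type*} [AddCommGroup M] [Module Rh M]
variable {N : Type*} [AddCommGroup N] [Module Rh N]

theorem HTendsto.map {w : ℕ → M} {x : M} (h : HTendsto w x) (f : M →ₗ[Rh] N) :
    HTendsto (fun n => f (w n)) (f x) := fun k => by
  obtain ⟨n₀, hn⟩ := h k
  exact ⟨n₀, fun n hnn => by simpa using map_mem_hPow f (hn n hnn)⟩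

theorem HasHSum.hTendsto {a : ℕ → M} {x : M} (h : HasHSum a x) :
    HTendsto (fun k => ∑ n ∈ Finset.range k, (PowerSeries.X : Rh) ^ n • a n) x := fun k =>
  ⟨k, fun n hn => by
    have := Submodule.neg_mem _ (hPow_anti hn (h n))
    rwa [neg_sub] at this⟩

theorem le_complFil {L : ℕ → Submodule Zq M} (hL : Antitone L) (p : ℕ) : L p ≤ complFil L p :=
  fun x hx => ⟨fun _ => x, fun _ => hL (Nat.zero_le p) hx, fun n => by simp, hx,
    fun k => ⟨0, fun n _ => by simp⟩⟩

/-- An element of the `p`-th step of a completion is represented by a sequence that vanishes up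
to `p`. -/
theorem exists_seq_of_mem_complFil {L : ℕ → Submodule Zq M} {p : ℕ} {x : M}
    (hx : x ∈ complFil L p) : ∃ w : ℕ → M, (∀ n, w n ∈ L 0) ∧ (∀ n, w (n + 1) - w n ∈ L n) ∧
      (∀ n ≤ p, w n = 0) ∧ HTendsto w x := by
  obtain ⟨w, h1, h2, h3, h4⟩ := hx
  refine ⟨fun n => if n ≤ p then 0 else w n, fun n => ?_, fun n => ?_, fun n hn => if_pos hn,
    fun k => ?_⟩
  · dsimp only
    split_ifs
    · exact zero_mem _
    · exact h1 n
  · dsimp only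
    rcases lt_trichotomy n p with h | rfl | h
    · rw [if_pos h.le, if_pos (Nat.succ_le_of_lt h), sub_zero]
      exact zero_mem _
    -- The only new jump is from 0 to `w (p + 1)`; it lies in `L p` because both `w p` and `w (p +
    -- 1) - w p` do.
    · rw [if_pos le_rfl, if_neg (by omega), sub_zero]
      simpa using add_mem (h2 n) h3
    · rw [if_neg (by omega), if_neg (by omega)]
      exact h2 n
  · obtain ⟨n₀, hn⟩ := h4 k
    refine ⟨max n₀ (p + 1), fun n hnn => ?_⟩
    dsimp only
    rw [if_neg (by have := le_of_max_le_right hnn; omega)]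
    exact hn n (le_of_max_le_left hnn)

/-- All increments after the m-th stay in hᵐ M, so the rate of convergence is the same for every
representative. This uniformity is what allows diagonal sequences below. -/
theorem HTendsto.sub_mem_hPow {L : ℕ → Submodule Zq M} (hh : ∀ n, ∀ x ∈ L n, x ∈ hPow M n)
    {w : ℕ → M} (h2 : ∀ n, w (n + 1) - w n ∈ L n) {x : M} (h : HTendsto w x) (m : ℕ) :
    w m - x ∈ hPow M m := by
  have h3 : ∀ l, w (m + l) - w m ∈ hPow M m := fun l => by
    induction l with
    | zero => simp
    | succ l ih =>
      have := add_mem (hPow_anti (Nat.le_add_right m l) (hh _ _ (h2 (m + l)))) ih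
      rwa [sub_add_sub_cancel] at this
  obtain ⟨n₀, hn⟩ := h m
  have := sub_mem (hn (m + n₀) (Nat.le_add_left _ _)) (h3 n₀)
  simpa using this

/-- Completeness of the completions of filtered modules. -/
theorem mem_complFil_of_hTendsto {L : ℕ → Submodule Zq M}
    (hh : ∀ n, ∀ x ∈ L n, x ∈ hPow M n) {p : ℕ} {z : ℕ → M}
    (hz : ∀ k, z k ∈ complFil L (max p (k / 2))) {y : M}
    (hy : HTendsto (fun k => ∑ n ∈ Finset.range k, z n) y) : y ∈ complFil L p := by
  choose u h1 h2 h3 h4 using fun k => exists_seq_of_mem_complFil (hz k)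
  -- Diagonal choice: the m-th approximant sums the m-th entries of the first 2m representatives.
  -- The omitted entries vanish, since m ≤ k / 2 for k ≥ 2m.
  refine ⟨fun m => ∑ k ∈ Finset.range (2 * m), u k m, fun n => sum_mem fun k _ => h1 k n,
    fun n => ?_, ?_, fun k => ?_⟩
  · have h5 : ∑ k ∈ Finset.range (2 * n), u k n = ∑ k ∈ Finset.range (2 * (n + 1)), u k n := by
      refine Finset.sum_subset (fun i hi => ?_) fun i _ hi => h3 i n ?_
      · simp only [Finset.mem_range] at hi ⊢
        omega
      · simp only [Finset.mem_range] at hi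
        exact le_max_of_le_right (by omega)
    dsimp only
    rw [h5, ← Finset.sum_sub_distrib]
    exact sum_mem fun k _ => h2 k n
  · dsimp only
    rw [Finset.sum_eq_zero fun k _ => h3 k p (le_max_left _ _)]
    exact zero_mem _
  · obtain ⟨n₀, hn⟩ := hy k
    refine ⟨max n₀ k, fun n hnn => ?_⟩
    have h5 := hn (2 * n) (by have := le_of_max_le_left hnn; omega)
    have h6 : ∑ i ∈ Finset.range (2 * n), u i n - ∑ i ∈ Finset.range (2 * n), z i ∈ hPow M k := by
      rw [← Finset.sum_sub_distrib]
      exact sum_mem fun i _ =>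
        hPow_anti (le_of_max_le_right hnn) (HTendsto.sub_mem_hPow hh (h2 i) (h4 i) n)
    have := add_mem h6 h5
    rwa [sub_add_sub_cancel] at this

theorem mem_complFil_of_hasHSum {L : ℕ → Submodule Zq M} (hL : Antitone L)
    (hh : ∀ n, ∀ x ∈ L n, x ∈ hPow M n) {p : ℕ} {a : ℕ → M} {y : M} (hy : HasHSum a y)
    (ha : ∀ k, (PowerSeries.X : Rh) ^ k • a k ∈ L (max p (k / 2))) : y ∈ complFil L p :=
  mem_complFil_of_hTendsto hh (fun k => le_complFil hL _ (ha k)) hy.hTendsto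

/-- An element of step 2p has a representative vanishing up to 2p. Its increments with index k ≥ 2p
are sent to step k / 2 ≥ p, and completeness sums them. Losing half of the degree is therefore
harmless for continuity. -/
theorem RestrictsContinuously.of_map_mem {f : M →ₗ[Rh] N} {L : ℕ → Submodule Zq M}
    {L' : ℕ → Submodule Zq N}
    (hh : ∀ n, ∀ x ∈ L' n, x ∈ hPow N n)
    (hf : ∀ p, ∀ x ∈ L p, f x ∈ complFil L' (p / 2)) : RestrictsContinuously f L L' := by
  have key : ∀ p, ∀ x ∈ complFil L (2 * p), f x ∈ complFil L' p := by
    intro p x hx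
    obtain ⟨w, h1, h2, h3, h4⟩ := exists_seq_of_mem_complFil hx
    refine mem_complFil_of_hTendsto hh (z := fun k => f (w (k + 1) - w k)) (fun k => ?_) ?_
    · rcases lt_or_ge k (2 * p) with h | h
      · rw [h3 k h.le, h3 (k + 1) h, sub_zero, map_zero]
        exact zero_mem _
      · rw [max_eq_right (by omega)]
        exact hf k _ (h2 k)
    · have h5 : ∀ k, ∑ n ∈ Finset.range k, f (w (n + 1) - w n) = f (w k) := fun k => by
        rw [← map_sum, Finset.sum_range_sub, h3 0 (Nat.zero_le _), sub_zero]
      simp only [h5]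
      exact h4.map f
  refine ⟨fun x hx => key 0 x hx, continuous_generateFrom_iff.2 ?_⟩
  rintro V ⟨x, p, rfl⟩
  rw [isOpen_iff_forall_mem_open]
  intro y hy
  -- By linearity and `key`, the coset of step 2p through y is mapped into the given coset of step
  -- p.
  refine ⟨{z | z.1 - y.1 ∈ complFil L (2 * p)}, fun z hz => ?_,
    TopologicalSpace.isOpen_generateFrom_of_mem ⟨y, 2 * p, rfl⟩, ?_⟩
  · have := add_mem (key p _ hz) hy
    rw [map_sub] at this
    change f z.1 - x.1 ∈ complFil L' p
    convert this using 1
    change _ = _ + (f y.1 - x.1)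
    abel
  · change y.1 - y.1 ∈ complFil L (2 * p)
    rw [sub_self]
    exact zero_mem _

end FilteredCompletion

/-! ### Weights -/

/-- Specialised to U_h so that simplification with it leaves products of scalars alone. -/
theorem uh_mul_assoc (a b c : Uh) : a * b * c = a * (b * c) := mul_assoc a b c

/-- The element `x` of `U_h` has weight `m`: `[H, x] = 2 m x`. -/
def IsWt (m : ℤ) (x : Uh) : Prop := H * x = x * H + cst (2 * m) • x

/-- `Kz a = K ^ a = exp (a h H / 2)` for an integer `a`. -/
noncomputable def Kz (a : ℤ) : Uh := hExp (cst ((a : ℚ) / 2) • H)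

theorem Kz_add (a b : ℤ) : Kz (a + b) = Kz a * Kz b := by
  rw [Kz, Kz, Kz, ← hExp_add (((Commute.refl H).smul_left _).smul_right _), ← add_smul, ← map_add]
  push_cast
  rw [add_div]

theorem Kz_zero : Kz 0 = 1 := by
  rw [Kz]
  simp [hExp_zero]

theorem Kz_one : Kz 1 = K := by
  rw [Kz, K]
  simp

theorem Kz_neg_one : Kz (-1) = Kinv := by
  rw [Kz, Kinv, ← neg_smul, ← map_neg]
  congr 4
  push_cast
  ring

theorem Kz_mul_neg (a : ℤ) : Kz a * Kz (-a) = 1 := by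
  rw [← Kz_add, add_neg_cancel, Kz_zero]

theorem Kz_neg_mul (a : ℤ) : Kz (-a) * Kz a = 1 := by
  rw [← Kz_add, neg_add_cancel, Kz_zero]

theorem K_pow (n : ℕ) : K ^ n = Kz n := by
  induction n with
  | zero => simp [Kz_zero]
  | succ n ih => rw [pow_succ, ih, ← Kz_one, ← Kz_add]; simp

theorem Kinv_pow (n : ℕ) : Kinv ^ n = Kz (-n) := by
  induction n with
  | zero => simp [Kz_zero]
  | succ n ih =>
    rw [pow_succ, ih, ← Kz_neg_one, ← Kz_add]
    congr 1
    push_cast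
    ring

/-- The exponent 2am is even, so moving powers of K past weight vectors only costs units of ℤ[q,
q⁻¹]. -/
theorem IsWt.Kz_mul {m : ℤ} {x : Uh} (hx : IsWt m x) (a : ℤ) :
    Kz a * x = vPow (2 * a * m) • (x * Kz a) := by
  refine hExp_shift (2 * a * m) ?_
  rw [smul_mul_assoc, hx, mul_add, mul_smul_comm, smul_add, smul_smul, ← map_mul,
    ← Algebra.commutes, ← Algebra.smul_def]
  congr 3
  push_cast
  ring

theorem IsWt.Kz_mul_assoc {m : ℤ} {x : Uh} (hx : IsWt m x) (a : ℤ) (y : Uh) :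
    Kz a * (x * y) = vPow (2 * a * m) • (x * (Kz a * y)) := by
  rw [← mul_assoc, hx.Kz_mul, smul_mul_assoc, mul_assoc (x : Uh)]

theorem Kz_mul_Kz_assoc (a b : ℤ) (y : Uh) : Kz a * (Kz b * y) = Kz (a + b) * y := by
  rw [Kz_add, mul_assoc]

theorem vPow_mul_neg (a : ℤ) : vPow a * vPow (-a) = 1 := by
  rw [← vPow_add, add_neg_cancel, vPow_zero]

theorem vPow_smul_smul {M : Type*} [AddCommGroup M] [Module Rh M] (a b : ℤ) (x : M) :
    vPow a • vPow b • x = vPow (a + b) • x := by rw [smul_smul, vPow_add]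

theorem IsWt.mul_Kz {m : ℤ} {x : Uh} (hx : IsWt m x) (a : ℤ) :
    x * Kz a = vPow (-(2 * a * m)) • (Kz a * x) := by
  rw [hx.Kz_mul, vPow_smul_smul, neg_add_cancel, vPow_zero, one_smul]

theorem IsWt.mul {m n : ℤ} {x y : Uh} (hx : IsWt m x) (hy : IsWt n y) : IsWt (m + n) (x * y) := by
  rw [IsWt, ← mul_assoc, hx, add_mul, mul_assoc, hy, mul_add, mul_smul_comm, ← mul_assoc,
    smul_mul_assoc, add_assoc, ← add_smul, ← map_add]
  congr 3
  push_cast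
  ring

theorem IsWt.add {m : ℤ} {x y : Uh} (hx : IsWt m x) (hy : IsWt m y) : IsWt m (x + y) := by
  rw [IsWt, mul_add, hx, hy, add_mul, smul_add]
  abel

theorem IsWt.smul {m : ℤ} {x : Uh} (hx : IsWt m x) (c : Rh) : IsWt m (c • x) := by
  rw [IsWt, mul_smul_comm, hx, smul_add, smul_mul_assoc, smul_comm c]

theorem IsWt.neg {m : ℤ} {x : Uh} (hx : IsWt m x) : IsWt m (-x) := by
  simpa using hx.smul (-1)

theorem IsWt.sub {m : ℤ} {x y : Uh} (hx : IsWt m x) (hy : IsWt m y) : IsWt m (x - y) := by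
  rw [sub_eq_add_neg]
  exact hx.add hy.neg

theorem isWt_zero (m : ℤ) : IsWt m 0 := by simp [IsWt]

theorem isWt_one : IsWt 0 1 := by simp [IsWt]

theorem isWt_H : IsWt 0 H := by simp [IsWt]

theorem isWt_E : IsWt 1 E := by
  rw [IsWt, H_mul_E, add_comm, Int.cast_one, mul_one, cst, map_ofNat]

theorem isWt_F : IsWt (-1) F := by
  rw [IsWt, H_mul_F, add_comm, Int.cast_neg, Int.cast_one, mul_neg, mul_one, cst, map_neg,
    map_ofNat]

theorem isWt_Kz (a : ℤ) : IsWt 0 (Kz a) := by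
  have : Kz a * H = H * Kz a := hExp_mul_comm (by rw [smul_mul_assoc, mul_smul_comm])
  simp [IsWt, this]

theorem isWt_K : IsWt 0 K := Kz_one ▸ isWt_Kz 1

theorem IsWt.pow {m : ℤ} {x : Uh} (hx : IsWt m x) (n : ℕ) : IsWt (n * m) (x ^ n) := by
  induction n with
  | zero => simpa using isWt_one
  | succ n ih =>
    rw [pow_succ]
    convert ih.mul hx using 1
    push_cast
    ring

theorem IsWt.congr {m n : ℤ} {x : Uh} (hx : IsWt m x) (h : m = n) : IsWt n x := h ▸ hx

theorem isWt_E_pow (n : ℕ) : IsWt n (E ^ n) := (isWt_E.pow n).congr (mul_one _)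

theorem isWt_F_pow (n : ℕ) : IsWt (-n) (F ^ n) := (isWt_F.pow n).congr (by ring)

theorem IsWt.of_hasHSum {m : ℤ} {a : ℕ → Uh} {x : Uh} (h : HasHSum a x) (ha : ∀ n, IsWt m (a n)) :
    IsWt m x := by
  have h1 := (h.map (LinearMap.mulLeft Rh H)).sub
    (h.map (LinearMap.mulRight Rh H + cst (2 * m) • LinearMap.id))
  refine sub_eq_zero.1 (h1.unique (hasHSum_zero.congr fun n => ?_))
  exact (sub_eq_zero.2 (ha n)).symm

theorem Kz_mul_E_pow (a : ℤ) (n : ℕ) : Kz a * E ^ n = vPow (2 * a * n) • (E ^ n * Kz a) :=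
  (isWt_E_pow n).Kz_mul a

theorem Kz_mul_F_pow (a : ℤ) (n : ℕ) : Kz a * F ^ n = vPow (2 * a * -n) • (F ^ n * Kz a) :=
  (isWt_F_pow n).Kz_mul a

theorem Kz_mul_F (a : ℤ) : Kz a * F = vPow (2 * a * -1) • (F * Kz a) := isWt_F.Kz_mul a

theorem Kz_mul_E (a : ℤ) : Kz a * E = vPow (2 * a * 1) • (E * Kz a) := isWt_E.Kz_mul a

/-! ### Density -/

/-- The bilinear map `(x, y) ↦ x ⊗ y`. -/
noncomputable def tmL : Uh →ₗ[Rh] Uh →ₗ[Rh] Uh2 :=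
  (TensorProduct.mk Rh Uh Uh).compr₂ toUh2.toLinearMap

section Density

variable {N : Type*} [AddCommGroup N] [Module Rh N] [IsHausdorff hId N]

/-- Linear maps out of the completed tensor square are determined on tensors. -/
theorem uh2_ext {f g : Uh2 →ₗ[Rh] N} (h : ∀ a b, f (tm a b) = g (tm a b)) : f = g := by
  refine hcomp_ext (M := Uh ⊗[Rh] Uh) fun z => ?_
  have : f ∘ₗ toUh2.toLinearMap = g ∘ₗ toUh2.toLinearMap := TensorProduct.ext' h
  exact LinearMap.congr_fun this z

/-- H, E, F are weight vectors and weights add under products, so every noncommutative polynomial in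
them is a sum of weight vectors. -/
theorem freeToUh_mem_span (a : FreeAlgebra Rh Gen) :
    freeToUh (hof (M := FreeAlgebra Rh Gen) a) ∈ Submodule.span Rh {x | ∃ m, IsWt m x} := by
  have h2 : freeToUh.comp (hofAlg (A := FreeAlgebra Rh Gen)) = FreeAlgebra.lift Rh gen :=
    FreeAlgebra.hom_ext (funext fun g => by
      rw [Function.comp_apply, Function.comp_apply, FreeAlgebra.lift_ι_apply]
      rfl)
  have h3 : freeToUh (hof (M := FreeAlgebra Rh Gen) a) = FreeAlgebra.lift Rh gen a :=
    AlgHom.congr_fun h2 a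
  rw [h3]
  induction a using FreeAlgebra.induction with
  | grade0 r =>
    rw [AlgHom.commutes, Algebra.algebraMap_eq_smul_one]
    exact Submodule.smul_mem _ _ (Submodule.subset_span ⟨0, isWt_one⟩)
  | grade1 g =>
    rw [FreeAlgebra.lift_ι_apply]
    refine Submodule.subset_span ?_
    cases g
    exacts [⟨0, isWt_H⟩, ⟨1, isWt_E⟩, ⟨-1, isWt_F⟩]
  | mul a b ha hb =>
    rw [map_mul]
    have := Submodule.mul_mem_mul (ha (AlgHom.congr_fun h2 a)) (hb (AlgHom.congr_fun h2 b))
    rw [Submodule.span_mul_span] at this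
    refine Submodule.span_mono ?_ this
    rintro _ ⟨x, ⟨m, hx⟩, y, ⟨n, hy⟩, rfl⟩
    exact ⟨_, hx.mul hy⟩
  | add a b ha hb =>
    rw [map_add]
    exact Submodule.add_mem _ (ha (AlgHom.congr_fun h2 a)) (hb (AlgHom.congr_fun h2 b))

/-- Linear maps out of `U_h` are determined on the weight vectors. -/
theorem uh_ext {f g : Uh →ₗ[Rh] N} (h : ∀ m x, IsWt m x → f x = g x) : f = g := by
  refine hcomp_ext (M := RingQuot UhRel) fun z => ?_
  obtain ⟨z, rfl⟩ := RingQuot.mkAlgHom_surjective Rh UhRel z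
  have h1 : f ∘ₗ freeToUh.toLinearMap = g ∘ₗ freeToUh.toLinearMap := by
    refine hcomp_ext (M := FreeAlgebra Rh Gen) fun a => ?_
    have h2 := freeToUh_mem_span a
    change f (freeToUh _) = g (freeToUh _)
    generalize freeToUh (hof (M := FreeAlgebra Rh Gen) a) = y at h2 ⊢
    induction h2 using Submodule.span_induction with
    | mem x hx => exact h _ x hx.choose_spec
    | zero => simp
    | add x y _ _ hx hy => rw [map_add, map_add, hx, hy]
    | smul c x _ hx => rw [map_smul, map_smul, hx]
  exact LinearMap.congr_fun h1 z

/-- Linear maps out of the completed tensor square are determined on the tensors of weight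
vectors. -/
theorem uh2_ext_wt {f g : Uh2 →ₗ[Rh] N}
    (h : ∀ m n x y, IsWt m x → IsWt n y → f (tm x y) = g (tm x y)) : f = g := by
  have h1 : tmL.compr₂ f = tmL.compr₂ g := by
    have h2 : ∀ b, (tmL.compr₂ f).flip b = (tmL.compr₂ g).flip b := fun b =>
      uh_ext fun m x hx => LinearMap.congr_fun (uh_ext (f := tmL.compr₂ f x)
        (g := tmL.compr₂ g x) fun n y hy => h m n x y hx hy) b
    exact LinearMap.ext₂ fun a b => LinearMap.congr_fun (h2 b) a
  exact uh2_ext fun a b => LinearMap.congr_fun₂ h1 a b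

end Density

/-! ### The adjoint action and the antipode -/

/-- The map `a ⊗ b ↦ a y S(b)`. -/
noncomputable def adBase (y : Uh) : Uh ⊗[Rh] Uh →ₗ[Rh] Uh :=
  LinearMap.mul' Rh Uh ∘ₗ TensorProduct.map (LinearMap.mulRight Rh y) antipode

theorem ad_apply (x y : Uh) : ad x y = ext2 (adBase y) (comul x) := rfl

@[simp]
theorem ext2_tm {N : Type*} [AddCommGroup N] [Module Rh N] [IsAdicComplete hId N]
    (f : Uh ⊗[Rh] Uh →ₗ[Rh] N) (a b : Uh) : ext2 f (tm a b) = f (a ⊗ₜ b) :=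
  hExtend_hof (M := Uh ⊗[Rh] Uh) f _

theorem adBase_tmul (y a b : Uh) : adBase y (a ⊗ₜ b) = a * y * antipode b := rfl

/-- On tensors this is (a a') y S(b b') = a (a' y S(b')) S(b), by anti-multiplicativity of S;
density does the rest. With multiplicativity of Δ it makes `ad` an action. -/
theorem ext2_adBase_mul (z z' : Uh2) (y : Uh) :
    ext2 (adBase y) (z * z') = ext2 (adBase (ext2 (adBase y) z')) z := by
  have h1 : ∀ a b, ext2 (adBase y) ∘ₗ LinearMap.mulLeft Rh (tm a b) =
      LinearMap.mulLeft Rh a ∘ₗ LinearMap.mulRight Rh (antipode b) ∘ₗ ext2 (adBase y) :=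
    fun a b => uh2_ext fun c d => by
      simp [tm_mul, adBase_tmul, antipode_mul, mul_assoc]
  have h2 : ext2 (adBase y) ∘ₗ LinearMap.mulRight Rh z' = ext2 (adBase (ext2 (adBase y) z')) :=
    uh2_ext fun a b => by
      have := LinearMap.congr_fun (h1 a b) z'
      simpa [adBase_tmul, mul_assoc] using this
  exact LinearMap.congr_fun h2 z

theorem ad_mul (a b y : Uh) : ad (a * b) y = ad a (ad b y) := by
  rw [ad_apply, map_mul, ext2_adBase_mul, ← ad_apply, ← ad_apply]

theorem antipode_one : antipode 1 = 1 := by simp [antipode]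

theorem antipodeInv_one : antipodeInv 1 = 1 := by simp [antipodeInv]

theorem ad_one (y : Uh) : ad 1 y = y := by
  have : comul 1 = tm 1 1 := map_one comul
  rw [ad_apply, this, ext2_tm, adBase_tmul, antipode_one, one_mul, mul_one]

theorem comul_H : comul H = tm H 1 + tm 1 H := uhLift_gen comulGen satRel_comulGen .H

theorem comul_E : comul E = tm E 1 + tm K E := uhLift_gen comulGen satRel_comulGen .E

theorem comul_F : comul F = tm F Kinv + tm 1 F := uhLift_gen comulGen satRel_comulGen .F

theorem ad_H (y : Uh) : ad H y = H * y - y * H := by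
  rw [ad_apply, comul_H, map_add, ext2_tm, ext2_tm, adBase_tmul, adBase_tmul, antipode_one,
    antipode_H]
  noncomm_ring

theorem ad_E (y : Uh) : ad E y = E * y - K * y * Kinv * E := by
  rw [ad_apply, comul_E, map_add, ext2_tm, ext2_tm, adBase_tmul, adBase_tmul, antipode_one,
    antipode_E]
  noncomm_ring

theorem ad_F (y : Uh) : ad F y = (F * y - y * F) * K := by
  rw [ad_apply, comul_F, map_add, ext2_tm, ext2_tm, adBase_tmul, adBase_tmul, antipode_Kinv,
    antipode_F]
  noncomm_ring

theorem IsWt.ad_H {m : ℤ} {y : Uh} (hy : IsWt m y) : ad H y = cst (2 * m) • y := by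
  rw [QuantumSl2.ad_H, hy, add_sub_cancel_left]

theorem IsWt.ad_H_pow {m : ℤ} {y : Uh} (hy : IsWt m y) (n : ℕ) :
    ad (H ^ n) y = cst (2 * m) ^ n • y := by
  induction n with
  | zero => simp [ad_one]
  | succ n ih => rw [pow_succ, ad_mul, hy.ad_H, map_smul, ih, smul_smul, pow_succ']

theorem IsWt.conj_K {m : ℤ} {y : Uh} (hy : IsWt m y) : K * y * Kinv = vPow (2 * m) • y := by
  rw [← Kz_one, hy.Kz_mul, smul_mul_assoc, mul_one, Kz_one, mul_assoc y, K_mul_Kinv, mul_one]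

theorem IsWt.ad_E {m : ℤ} {y : Uh} (hy : IsWt m y) : ad E y = E * y - vPow (2 * m) • (y * E) := by
  rw [QuantumSl2.ad_E, hy.conj_K, smul_mul_assoc]

theorem IsWt.isWt_ad_E {m : ℤ} {y : Uh} (hy : IsWt m y) : IsWt (m + 1) (ad E y) := by
  rw [hy.ad_E]
  exact ((isWt_E.mul hy).congr (add_comm _ _)).sub ((hy.mul isWt_E).smul _)

theorem IsWt.isWt_ad_F {m : ℤ} {y : Uh} (hy : IsWt m y) : IsWt (m - 1) (ad F y) := by
  rw [QuantumSl2.ad_F]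
  exact ((((isWt_F.mul hy).congr (by ring)).sub (hy.mul isWt_F)).mul isWt_K).congr (by ring)

theorem IsWt.isWt_ad_E_pow {m : ℤ} {y : Uh} (hy : IsWt m y) (n : ℕ) :
    IsWt (m + n) (ad (E ^ n) y) := by
  induction n with
  | zero => simpa [ad_one] using hy
  | succ n ih =>
    rw [pow_succ', ad_mul]
    exact ih.isWt_ad_E.congr (by push_cast; ring)

theorem IsWt.isWt_ad_F_pow {m : ℤ} {y : Uh} (hy : IsWt m y) (n : ℕ) :
    IsWt (m - n) (ad (F ^ n) y) := by
  induction n with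
  | zero => simpa [ad_one] using hy
  | succ n ih =>
    rw [pow_succ', ad_mul]
    exact ih.isWt_ad_F.congr (by push_cast; ring)

theorem hExp_cst_Rh (a : ℤ) : hExp (cst ((a : ℚ) / 2)) = vPow a := by
  simpa using hExp_cst (B := Rh) a

theorem IsWt.ad_Kz {m : ℤ} {y : Uh} (hy : IsWt m y) (a : ℤ) :
    ad (Kz a) y = vPow (2 * a * m) • y := by
  rw [← hExp_cst_Rh, Kz]
  refine map_hExp_eq (ad.flip y) (LinearMap.toSpanSingleton Rh Uh y) fun n => ?_
  rw [LinearMap.flip_apply, LinearMap.toSpanSingleton_apply, smul_pow, map_smul,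
    LinearMap.smul_apply, hy.ad_H_pow, smul_smul, ← mul_pow, ← map_mul]
  congr 3
  push_cast
  ring

theorem antipode_Kz (a : ℤ) : antipode (Kz a) = Kz (-a) := by
  rw [Kz, antipode_hExp, map_smul, antipode_H, smul_neg, Kz, ← neg_smul, ← map_neg]
  congr 4
  push_cast
  ring

theorem antipodeInv_Kz (a : ℤ) : antipodeInv (Kz a) = Kz (-a) := by
  rw [Kz, antipodeInv_hExp, map_smul, antipodeInv_H, smul_neg, Kz, ← neg_smul, ← map_neg]
  congr 4
  push_cast
  ring

theorem antipode_pow (x : Uh) (n : ℕ) : antipode (x ^ n) = antipode x ^ n := by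
  simp [antipode]

theorem IsWt.antipode {m : ℤ} {x : Uh} (hx : IsWt m x) : IsWt m (antipode x) := by
  have h := congrArg QuantumSl2.antipode hx
  rw [antipode_mul, map_add, antipode_mul, antipode_H, map_smul, mul_neg, neg_mul] at h
  rw [IsWt, ← neg_neg (H * _), ← sub_eq_iff_eq_add.2 h]
  abel

theorem IsWt.antipodeInv {m : ℤ} {x : Uh} (hx : IsWt m x) : IsWt m (antipodeInv x) := by
  have h := congrArg QuantumSl2.antipodeInv hx
  rw [antipodeInv_mul, map_add, antipodeInv_mul, antipodeInv_H, map_smul, mul_neg, neg_mul] at h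
  rw [IsWt, ← neg_neg (H * _), ← sub_eq_iff_eq_add.2 h]
  abel

/-- Evaluation of `D = exp (h / 4 H ⊗ H)` when `H` acts by a scalar on the first factor. -/
theorem ext2_Dmat_mul {N : Type*} [AddCommGroup N] [Module Rh N] [IsAdicComplete hId N]
    (f : Uh ⊗[Rh] Uh →ₗ[Rh] N) {a : Uh} {w : ℤ}
    (h : ∀ n b, f ((H ^ n * a) ⊗ₜ b) = cst (2 * w) ^ n • f (a ⊗ₜ b)) (b : Uh) :
    ext2 f (Dmat * tm a b) = f (a ⊗ₜ (Kz w * b)) := by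
  refine map_hExp_eq (ext2 f ∘ₗ LinearMap.mulRight Rh (tm a b))
    (f ∘ₗ TensorProduct.mk Rh Uh Uh a ∘ₗ LinearMap.mulRight Rh b) fun n => ?_
  have h1 : tm H H ^ n = tm (H ^ n) (H ^ n) := by
    rw [tm, ← map_pow, Algebra.TensorProduct.tmul_pow, tm]
  simp only [LinearMap.comp_apply, LinearMap.mulRight_apply, smul_pow, h1, tm_mul,
    map_smul, ext2_tm, h, smul_smul, TensorProduct.mk_apply, ← mul_pow, ← map_mul]
  congr 3
  ring

/-! ### Quantum factorials -/

/-- The inverse `1 / [n]_q!` of the quantum factorial. -/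
noncomputable def qfInv (n : ℕ) : Rh := (qFactQ n)⁻¹

theorem constantCoeff_vPow (a : ℤ) : PowerSeries.constantCoeff (vPow a) = 1 := by
  rw [← PowerSeries.coeff_zero_eq_constantCoeff_apply, vPow, PowerSeries.coeff_rescale]
  simp

theorem constantCoeff_qIntQ (n : ℕ) : PowerSeries.constantCoeff (qIntQ n) = n := by
  simp [qIntQ, constantCoeff_vPow]

theorem constantCoeff_qInt (n : ℕ) : PowerSeries.constantCoeff (qInt n) = n := by
  simp [qInt, constantCoeff_vPow]

/-- The constant term of [n]_q! is n!, which is nonzero in ℚ. -/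
theorem qFactQ_mul_qfInv (n : ℕ) : qFactQ n * qfInv n = 1 := by
  refine PowerSeries.mul_inv_cancel _ ?_
  rw [qFactQ, map_prod, Finset.prod_ne_zero_iff]
  intro i _
  rw [constantCoeff_qIntQ]
  exact Nat.cast_ne_zero.2 (Nat.succ_ne_zero i)

theorem qFact_mul_inv (n : ℕ) : qFact n * (qFact n)⁻¹ = 1 := by
  refine PowerSeries.mul_inv_cancel _ ?_
  rw [qFact, map_prod, Finset.prod_ne_zero_iff]
  intro i _
  rw [constantCoeff_qInt]
  exact Nat.cast_ne_zero.2 (Nat.succ_ne_zero i)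

theorem qfInv_zero : qfInv 0 = 1 := by
  have := qFactQ_mul_qfInv 0
  simpa [qFactQ] using this

theorem isUnit_qIntQ_succ (n : ℕ) : IsUnit (qIntQ (n + 1)) := by
  rw [PowerSeries.isUnit_iff_constantCoeff, constantCoeff_qIntQ, isUnit_iff_ne_zero]
  exact Nat.cast_ne_zero.2 (Nat.succ_ne_zero n)

theorem qIntQ_mul_qfInv (n : ℕ) : qIntQ (n + 1) * qfInv (n + 1) = qfInv n := by
  have h1 := qFactQ_mul_qfInv n
  have h2 := qFactQ_mul_qfInv (n + 1)
  rw [qFactQ, Finset.prod_range_succ, ← qFactQ] at h2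
  linear_combination (-(qIntQ (n + 1) * qfInv (n + 1))) * h1 + qfInv n * h2

theorem qIntQ_add (i j : ℕ) : qIntQ (i + j) = qIntQ j + vPow (2 * j) * qIntQ i := by
  rw [qIntQ, add_comm i j, Finset.sum_range_add, qIntQ, qIntQ, Finset.mul_sum]
  congr 1
  refine Finset.sum_congr rfl fun k _ => ?_
  rw [← vPow_add]
  congr 1
  push_cast
  ring

theorem qIntQ_eq (n : ℕ) : qIntQ n = vPow (n - 1) * qInt n := by
  rw [qInt, ← Finset.sum_range_reflect, qIntQ, Finset.mul_sum]
  refine Finset.sum_congr rfl fun j hj => ?_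
  rw [← vPow_add]
  congr 1
  have := Finset.mem_range.1 hj
  omega

theorem qFactQ_eq (n : ℕ) : qFactQ n = vPow (n * (n - 1) / 2) * qFact n := by
  induction n with
  | zero => simp [qFactQ, qFact, vPow_zero]
  | succ n ih =>
    rw [qFactQ, Finset.prod_range_succ, ← qFactQ, qFact, Finset.prod_range_succ, ← qFact, ih,
      qIntQ_eq]
    have : ((n + 1 : ℕ) : ℤ) * ((n + 1 : ℕ) - 1) / 2 = n * (n - 1) / 2 + ((n + 1 : ℕ) - 1) := by
      rw [show ((n + 1 : ℕ) : ℤ) * ((n + 1 : ℕ) - 1) = n * (n - 1) + n * 2 by push_cast; ring,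
        Int.add_mul_ediv_right _ _ two_ne_zero]
      push_cast
      ring
    rw [this, vPow_add]
    ring

/-- The coefficient of `hⁿ Fⁿ ⊗ Eⁿ` in the universal `R`-matrix. -/
noncomputable def rCoeff (n : ℕ) : Rh := vPow (n * (n - 1)) * sh ^ n * qfInv n

/-- Since [n]_q! = v^(n(n-1)/2) [n]!, trading [n]! for [n]_q! doubles the exponent n(n-1)/2 of v and
makes it even, as integrality over ℤ[q, q⁻¹] requires. -/
theorem rCoeff_eq (n : ℕ) :
    vPow (n * (n - 1) / 2) * sh ^ n * (qFact n)⁻¹ = rCoeff n := by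
  have h1 := qFactQ_mul_qfInv n
  have h2 := qFact_mul_inv n
  have h3 : (vPow (n * (n - 1)) : Rh) = vPow (n * (n - 1) / 2) * vPow (n * (n - 1) / 2) := by
    rw [← vPow_add]
    congr 1
    obtain ⟨k, hk⟩ := Int.even_mul_pred_self (n : ℤ)
    rw [hk]
    omega
  rw [qFactQ_eq] at h1
  rw [rCoeff, h3]
  linear_combination (vPow (n * (n - 1) / 2) * sh ^ n * vPow (n * (n - 1) / 2) * qfInv n) * h2 -
    (vPow (n * (n - 1) / 2) * sh ^ n * (qFact n)⁻¹) * h1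

theorem rCoeff_zero : rCoeff 0 = 1 := by simp [rCoeff, vPow_zero, qfInv_zero]

/-- The `q`-Pascal recursion for sums `∑ T(i, j) / ([i]_q! [j]_q!)` over `i + j = n`. -/
theorem qIntQ_smul_sum {M : Type*} [AddCommGroup M] [Module Rh M] (T : ℕ → ℕ → M) (n : ℕ) :
    qIntQ (n + 1) • ∑ p ∈ antidiagonal (n + 1), (qfInv p.1 * qfInv p.2) • T p.1 p.2 =
      ∑ p ∈ antidiagonal n, (qfInv p.1 * qfInv p.2) •
        (T p.1 (p.2 + 1) + vPow (2 * p.2) • T (p.1 + 1) p.2) := by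
  have h0 : qIntQ 0 = 0 := by simp [qIntQ]
  have h1 : qIntQ (n + 1) • ∑ p ∈ antidiagonal (n + 1), (qfInv p.1 * qfInv p.2) • T p.1 p.2 =
      ∑ p ∈ antidiagonal (n + 1), (qIntQ p.2 * (qfInv p.1 * qfInv p.2)) • T p.1 p.2 +
      ∑ p ∈ antidiagonal (n + 1),
        (vPow (2 * p.2) * qIntQ p.1 * (qfInv p.1 * qfInv p.2)) • T p.1 p.2 := by
    rw [Finset.smul_sum, ← Finset.sum_add_distrib]
    refine Finset.sum_congr rfl fun p hp => ?_
    -- The splitting [i + j]_q = [j]_q + qʲ [i]_q; each part cancels one factor of one of the two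
    -- factorials.
    rw [← mem_antidiagonal.1 hp, qIntQ_add, smul_smul, ← add_smul, add_mul]
  rw [h1, Finset.Nat.sum_antidiagonal_succ', Finset.Nat.sum_antidiagonal_succ]
  simp only [h0, zero_mul, mul_zero, zero_smul, zero_add]
  rw [← Finset.sum_add_distrib]
  refine Finset.sum_congr rfl fun p _ => ?_
  rw [smul_add, smul_smul]
  congr 2
  · rw [← qIntQ_mul_qfInv p.2]
    ring
  · rw [← qIntQ_mul_qfInv p.1]
    ring

/-- The sums s(n) over i + j = n satisfy [n+1]_q s(n+1) = (qⁿ - 1) s(n) by the q-Pascal recursion.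
The factor q⁰ - 1 kills s(1) and hence all later sums. This identity drives both inversion formulas.
-/
theorem sum_neg_one_pow_qfInv (n : ℕ) : ∑ p ∈ antidiagonal (n + 1),
    (qfInv p.1 * qfInv p.2) * ((-1) ^ p.1 * vPow (p.2 * (p.2 - 1))) = 0 := by
  have h : ∀ n, qIntQ (n + 1) * ∑ p ∈ antidiagonal (n + 1),
      (qfInv p.1 * qfInv p.2) * ((-1) ^ p.1 * vPow (p.2 * (p.2 - 1))) =
      (vPow (2 * n) - 1) * ∑ p ∈ antidiagonal n,
        (qfInv p.1 * qfInv p.2) * ((-1) ^ p.1 * vPow (p.2 * (p.2 - 1))) := fun n => by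
    have := qIntQ_smul_sum (M := Rh) (fun i j => (-1) ^ j * vPow (i * (i - 1))) n
    rw [← Finset.Nat.sum_antidiagonal_swap, ← Finset.Nat.sum_antidiagonal_swap (n := n)]
    simp only [Prod.fst_swap, Prod.snd_swap, mul_comm (qfInv (Prod.snd _))]
    refine this.trans ?_
    rw [Finset.mul_sum]
    refine Finset.sum_congr rfl fun p hp => ?_
    have h1 : (vPow (2 * p.2) * vPow ((p.1 + 1 : ℕ) * ((p.1 + 1 : ℕ) - 1)) : Rh) =
        vPow (2 * n) * vPow (p.1 * (p.1 - 1)) := by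
      rw [← vPow_add, ← vPow_add, ← mem_antidiagonal.1 hp]
      congr 1
      push_cast
      ring
    simp only [smul_eq_mul]
    linear_combination (qfInv p.1 * qfInv p.2) * (-1) ^ p.2 * h1
  refine (isUnit_qIntQ_succ n).mul_left_cancel ?_
  rw [mul_zero]
  induction n with
  | zero => rw [h, Nat.cast_zero, mul_zero, vPow_zero, sub_self, zero_mul]
  | succ n ih =>
    rw [h, (isUnit_qIntQ_succ n).mul_left_cancel (ih.trans (mul_zero _).symm), mul_zero]

/-! ### The universal `R`-matrix -/

theorem hasHSum_Rmat {N : Type*} [AddCommGroup N] [Module Rh N] [IsAdicComplete hId N]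
    (f : Uh ⊗[Rh] Uh →ₗ[Rh] N) :
    HasHSum (fun n => rCoeff n • ext2 f (Dmat * tm (F ^ n) (E ^ n))) (ext2 f Rmat) := by
  refine ((hasHSum_hSum _).map (ext2 f ∘ₗ LinearMap.mulLeft Rh Dmat)).congr fun n => ?_
  simp only [PowerSeries.coeff_mk, rCoeff_eq, map_smul, LinearMap.comp_apply,
    LinearMap.mulLeft_apply]

/-- Evaluation of the universal `R`-matrix when `H` acts by scalars on the first factor. -/
theorem hasHSum_Rmat_of_wt {N : Type*} [AddCommGroup N] [Module Rh N] [IsAdicComplete hId N]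
    (f : Uh ⊗[Rh] Uh →ₗ[Rh] N) (w : ℕ → ℤ)
    (h : ∀ k n b, f ((H ^ n * F ^ k) ⊗ₜ b) = cst (2 * w k) ^ n • f ((F ^ k) ⊗ₜ b)) :
    HasHSum (fun n => rCoeff n • f ((F ^ n) ⊗ₜ (Kz (w n) * E ^ n))) (ext2 f Rmat) :=
  (hasHSum_Rmat f).congr fun n => by rw [ext2_Dmat_mul f (h n)]

theorem IsWt.ad_H_pow_mul {m : ℤ} {x : Uh} (hx : IsWt m x) (n k : ℕ) :
    ad (H ^ n * F ^ k) x = cst (2 * (m - k : ℤ)) ^ n • ad (F ^ k) x := by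
  rw [ad_mul, (hx.isWt_ad_F_pow k).ad_H_pow]

theorem swapMap₂_tmul (f g : Uh →ₗ[Rh] Uh) (a b : Uh) :
    swapMap₂ f g (a ⊗ₜ b) = tm (g b) (f a) := rfl

/-- Fⁿ ▷ x and Eⁿ ▷ y have weights m - n and m' + n, so D contributes the scalar v^(2(m-n)(m'+n)).
-/
theorem hasHSum_braiding {m m' : ℤ} {x y : Uh} (hx : IsWt m x) (hy : IsWt m' y) :
    HasHSum (fun n => (rCoeff n * vPow (2 * (m - n) * (m' + n))) •
      tm (ad (E ^ n) y) (ad (F ^ n) x)) (braiding (tm x y)) := by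
  have h : braiding (tm x y) = ext2 (swapMap₂ (ad.flip x) (ad.flip y)) Rmat := ext2_tm _ _ _
  rw [h]
  refine (hasHSum_Rmat_of_wt _ (fun k => m - k) fun k n b => ?_).congr fun n => ?_
  · rw [swapMap₂_tmul, swapMap₂_tmul, LinearMap.flip_apply ad, LinearMap.flip_apply ad _ x,
      hx.ad_H_pow_mul, tm_smul_right, LinearMap.flip_apply ad]
  · rw [swapMap₂_tmul, LinearMap.flip_apply, LinearMap.flip_apply, ad_mul, (hy.isWt_ad_E_pow n).ad_Kz, tm_smul_left, smul_smul]

theorem FK_pow (n : ℕ) : (F * K) ^ n = vPow (-(n * (n - 1))) • (F ^ n * Kz n) := by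
  induction n with
  | zero => simp [vPow_zero, Kz_zero]
  | succ n ih =>
    rw [pow_succ, ih, smul_mul_assoc, mul_assoc, ← mul_assoc (Kz n), ← pow_one F, Kz_mul_F_pow,
      pow_one, smul_mul_assoc, mul_smul_comm, vPow_smul_smul, ← Kz_one, mul_assoc F, ← Kz_add,
      ← mul_assoc, ← pow_succ]
    congr 2
    push_cast
    ring

theorem antipode_F_pow (n : ℕ) :
    antipode (F ^ n) = ((-1) ^ n * vPow (-(n * (n - 1)))) • (F ^ n * Kz n) := by
  rw [antipode_pow, antipode_F, neg_pow, FK_pow, mul_smul, mul_smul_comm, smul_comm]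
  congr 1
  rw [Algebra.smul_def, map_pow, map_neg, map_one]

theorem IsWt.ad_antipode_F_pow {m : ℤ} {y : Uh} (hy : IsWt m y) (n : ℕ) :
    ad (QuantumSl2.antipode (F ^ n)) y =
      ((-1) ^ n * vPow (2 * n * m - n * (n - 1))) • ad (F ^ n) y := by
  rw [antipode_F_pow, map_smul, LinearMap.smul_apply, ad_mul, hy.ad_Kz, map_smul, smul_smul,
    mul_assoc, ← vPow_add]
  congr 3
  ring

theorem hasHSum_braidingInv {m m' : ℤ} {x y : Uh} (hx : IsWt m x) (hy : IsWt m' y) :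
    HasHSum (fun n => (rCoeff n * ((-1) ^ n * vPow (-(2 * m' * m) - n * (n - 1)))) •
      tm (ad (F ^ n) y) (ad (E ^ n) x)) (braidingInv (tm x y)) := by
  have h' : ∀ a b, (toUh2.toLinearMap ∘ₗ
      TensorProduct.map (ad.flip y ∘ₗ antipode) (ad.flip x)) (a ⊗ₜ b) =
        tm (ad (antipode a) y) (ad b x) := fun a b => rfl
  have h : braidingInv (tm x y) = ext2 (toUh2.toLinearMap ∘ₗ
      TensorProduct.map (ad.flip y ∘ₗ antipode) (ad.flip x)) Rmat := ext2_tm _ _ _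
  rw [h]
  -- S reverses products, so H acts on y before F lowers its weight: the eigenvalue does not depend
  -- on k.
  refine (hasHSum_Rmat_of_wt _ (fun _ => -m') fun k n b => ?_).congr fun n => ?_
  · rw [h', h', antipode_mul, ad_mul, ← tm_smul_left, ← map_smul, antipode_pow H, antipode_H,
      ← neg_one_smul Rh H, smul_pow, map_smul ad, LinearMap.smul_apply, hy.ad_H_pow, smul_smul,
      ← mul_pow, Int.cast_neg, mul_neg, neg_one_mul, ← map_neg]
  · rw [h', ad_mul, (hx.isWt_ad_E_pow n).ad_Kz, tm_smul_right, hy.ad_antipode_F_pow, tm_smul_left,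
      smul_smul, smul_smul]
    congr 1
    rw [mul_assoc, mul_left_comm (vPow _), ← vPow_add]
    congr 3
    ring

/-- The map `x ⊗ y ↦ ∑ x S(β) ⊗ (α ▷ y)`, where `R = ∑ α ⊗ β`. -/
noncomputable def bComulAux : Uh2 →ₗ[Rh] Uh2 :=
  ext2 (TensorProduct.lift (LinearMap.mk₂ Rh
    (fun x y => sum2 Rmat (swapMap₂ (ad.flip y) (LinearMap.mulLeft Rh x ∘ₗ antipode)))
    (fun x x' y => by
      rw [← map_add]
      congr 1
      exact TensorProduct.ext' fun a b => by simp [swapMap₂, swapMap_tmul, add_mul, tm_add_left])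
    (fun c x y => by
      rw [← map_smul]
      congr 1
      exact TensorProduct.ext' fun a b => by simp [swapMap₂, swapMap_tmul, tm_smul_left])
    (fun x y y' => by simp) (fun c x y => by simp)))

theorem bComul_apply (x : Uh) : bComul x = bComulAux (comul x) := rfl

theorem hasHSum_bComulAux {m : ℤ} (x : Uh) {y : Uh} (hy : IsWt m y) :
    HasHSum (fun n => rCoeff n • tm (x * antipode (E ^ n) * Kz (n - m)) (ad (F ^ n) y))
      (bComulAux (tm x y)) := by
  have h : bComulAux (tm x y) = ext2 (swapMap₂ (ad.flip y)
    (LinearMap.mulLeft Rh x ∘ₗ antipode)) Rmat := ext2_tm _ _ _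
  rw [h]
  refine (hasHSum_Rmat_of_wt _ (fun k => m - k) fun k n b => ?_).congr fun n => ?_
  · rw [swapMap₂_tmul, swapMap₂_tmul, LinearMap.flip_apply, hy.ad_H_pow_mul, tm_smul_right,
      LinearMap.flip_apply ad]
  · rw [swapMap₂_tmul, LinearMap.flip_apply, LinearMap.comp_apply, LinearMap.mulLeft_apply,
      antipode_mul, antipode_Kz, neg_sub, mul_assoc]

theorem hasHSum_bAntipode {m : ℤ} {x : Uh} (hx : IsWt m x) :
    HasHSum (fun n => rCoeff n • (Kz (m - n) * E ^ n * antipode (ad (F ^ n) x)))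
      (bAntipode x) := by
  have h' : ∀ a b, (LinearMap.mul' Rh Uh ∘ₗ
      TensorProduct.map LinearMap.id (antipode ∘ₗ ad.flip x) ∘ₗ
        (TensorProduct.comm Rh Uh Uh).toLinearMap) (a ⊗ₜ b) = b * antipode (ad a x) :=
    fun a b => rfl
  have h : bAntipode x = ext2 (LinearMap.mul' Rh Uh ∘ₗ
      TensorProduct.map LinearMap.id (antipode ∘ₗ ad.flip x) ∘ₗ
        (TensorProduct.comm Rh Uh Uh).toLinearMap) Rmat := rfl
  rw [h]
  refine (hasHSum_Rmat_of_wt _ (fun k => m - k) fun k n b => ?_).congr fun n => by rw [h']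
  rw [h', h', hx.ad_H_pow_mul, map_smul, mul_smul_comm]

theorem hasHSum_bAntipodeInv {m : ℤ} {x : Uh} (hx : IsWt m x) :
    HasHSum (fun n => rCoeff n • (antipodeInv (ad (F ^ n) x) * (Kz (m - n) * E ^ n)))
      (bAntipodeInv x) := by
  have h' : ∀ a b, (LinearMap.mul' Rh Uh ∘ₗ
      TensorProduct.map (antipodeInv ∘ₗ ad.flip x) LinearMap.id) (a ⊗ₜ b) =
        antipodeInv (ad a x) * b := fun a b => rfl
  have h : bAntipodeInv x = ext2 (LinearMap.mul' Rh Uh ∘ₗ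
      TensorProduct.map (antipodeInv ∘ₗ ad.flip x) LinearMap.id) Rmat := rfl
  rw [h]
  refine (hasHSum_Rmat_of_wt _ (fun k => m - k) fun k n b => ?_).congr fun n => by rw [h']
  rw [h', h', hx.ad_H_pow_mul, map_smul, smul_mul_assoc]

/-! ### The adjoint action of the divided powers of `F` -/

/-- A q-binomial expansion of the iterates of F ▷ y = (F y - y F) K. The factors 1/[i]_q! and
1/[j]_q! are those needed to form divided powers on the two sides of x. -/
theorem ad_F_pow (n : ℕ) (x : Uh) : qfInv n • ad (F ^ n) x = ∑ p ∈ antidiagonal n,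
    (qfInv p.1 * qfInv p.2) • ((-1) ^ p.2 * vPow (-(p.2 * (p.2 - 1)) - 2 * p.1 * p.2)) •
      (F ^ p.1 * x * F ^ p.2 * Kz (p.1 + p.2)) := by
  induction n with
  | zero => simp [qfInv_zero, ad_one, vPow_zero, Kz_zero]
  | succ n ih =>
    -- Multiplying by the unit [n+1]_q brings in the q-Pascal recursion.
    refine (isUnit_qIntQ_succ n).smul_left_cancel.1 ?_
    rw [smul_smul, qIntQ_mul_qfInv, pow_succ', ad_mul, ← map_smul, ih,
      qIntQ_smul_sum (fun i j => ((-1) ^ j * vPow (-(j * (j - 1)) - 2 * i * j) : Rh) •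
      (F ^ i * x * F ^ j * Kz (i + j))), map_sum]
    refine Finset.sum_congr rfl fun p _ => ?_
    obtain ⟨i, j⟩ := p
    have h1 : vPow (-((j + 1 : ℕ) * ((j + 1 : ℕ) - 1)) - 2 * i * (j + 1 : ℕ)) =
        vPow (-(j * (j - 1)) - 2 * i * j) * vPow (2 * (i + j) * -1) := by
      rw [← vPow_add]
      congr 1
      push_cast
      ring
    have h2 : vPow (2 * j) * vPow (-(j * (j - 1)) - 2 * (i + 1 : ℕ) * j) =
        vPow (-(j * (j - 1)) - 2 * i * j) := by
      rw [← vPow_add]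
      congr 1
      push_cast
      ring
    have h3 : Kz (i + j + 1) = Kz (i + (j + 1 : ℕ)) := by push_cast; rw [add_assoc]
    have h4 : Kz (i + j + 1) = Kz ((i + 1 : ℕ) + j) := by push_cast; rw [add_right_comm]
    rw [map_smul, map_smul, ad_F, sub_mul, ← Kz_one]
    dsimp only
    rw [h1, smul_smul (vPow (2 * j)), mul_left_comm (vPow (2 * j)), h2, ← h3, ← h4, pow_succ' F i,
      pow_succ F j, pow_succ (-1 : Rh)]
    simp only [uh_mul_assoc, ← Kz_add, isWt_F.Kz_mul_assoc, mul_smul_comm]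
    congr 1
    rw [smul_sub, sub_eq_neg_add, smul_smul, ← neg_smul]
    congr 2
    ring

/-! ### Normal ordering of scalars and monomials -/

section NormalOrder

variable {M : Type*} [AddCommGroup M] [Module Rh M]

/-- Scalars are sorted as power of v, power of `sh`, inverse factorials, sign. Used as rewriting
rules, these lemmas reduce identities between monomials mostly to a comparison of exponents of v. -/
theorem rCoeff_smul (n : ℕ) (x : M) :
    rCoeff n • x = vPow (n * (n - 1)) • sh ^ n • qfInv n • x := by
  rw [rCoeff, mul_smul, mul_smul]

theorem sh_pow_smul_vPow_smul (n : ℕ) (a : ℤ) (x : M) :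
    sh ^ n • vPow a • x = vPow a • sh ^ n • x := smul_comm _ _ _

theorem qfInv_smul_vPow_smul (n : ℕ) (a : ℤ) (x : M) :
    qfInv n • vPow a • x = vPow a • qfInv n • x := smul_comm _ _ _

theorem neg_one_pow_smul_vPow_smul (n : ℕ) (a : ℤ) (x : M) :
    (-1 : Rh) ^ n • vPow a • x = vPow a • (-1 : Rh) ^ n • x := smul_comm _ _ _

theorem qfInv_smul_sh_pow_smul (n k : ℕ) (x : M) :
    qfInv n • sh ^ k • x = sh ^ k • qfInv n • x := smul_comm _ _ _

theorem neg_one_pow_smul_sh_pow_smul (n k : ℕ) (x : M) :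
    (-1 : Rh) ^ n • sh ^ k • x = sh ^ k • (-1 : Rh) ^ n • x := smul_comm _ _ _

theorem neg_one_pow_smul_qfInv_smul (n k : ℕ) (x : M) :
    (-1 : Rh) ^ n • qfInv k • x = qfInv k • (-1 : Rh) ^ n • x := smul_comm _ _ _

theorem sh_pow_smul_sh_pow_smul (n k : ℕ) (x : M) :
    sh ^ n • sh ^ k • x = sh ^ (n + k) • x := by rw [smul_smul, pow_add]

theorem neg_one_pow_smul_neg_one_pow_smul (n k : ℕ) (x : M) :
    (-1 : Rh) ^ n • (-1 : Rh) ^ k • x = (-1 : Rh) ^ (n + k) • x := by rw [smul_smul, pow_add]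

end NormalOrder

theorem E_pow_mul_E_pow_mul (i j : ℕ) (x : Uh) : E ^ i * (E ^ j * x) = E ^ (i + j) * x := by
  rw [pow_add, mul_assoc]

theorem F_pow_mul_F_pow_mul (i j : ℕ) (x : Uh) : F ^ i * (F ^ j * x) = F ^ (i + j) * x := by
  rw [pow_add, mul_assoc]

theorem antipode_E_pow (n : ℕ) :
    antipode (E ^ n) = ((-1) ^ n * vPow (-(n * (n + 1)))) • (E ^ n * Kz (-n)) := by
  induction n with
  | zero => simp [vPow_zero, Kz_zero, antipode_one]
  | succ n ih =>
    rw [pow_succ E, antipode_mul, antipode_E, ih, ← Kz_neg_one, neg_mul, mul_smul_comm,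
      uh_mul_assoc, ← uh_mul_assoc E, ← pow_succ', ← pow_succ, (isWt_E_pow _).Kz_mul_assoc, ← Kz_add,
      smul_smul, ← neg_smul, mul_assoc, ← vPow_add, pow_succ (-1 : Rh), mul_neg_one, neg_mul]
    congr 1
    · push_cast
      ring_nf
    · congr 2
      push_cast
      ring

/-! ### The element relating the braided antipode to the antipode -/

/-- The element `γ⁻¹ u` of `U_h`, where `u = ∑ S(β) α` and `γ = exp (- h H² / 4)`. -/
noncomputable def tElt : Uh := hSum (PowerSeries.mk fun n =>
  ((-1) ^ n * vPow (n * (n - 1))) • rCoeff n • (E ^ n * Kz n * F ^ n))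

/-- The inverse of `tElt`. -/
noncomputable def wElt : Uh := hSum (PowerSeries.mk fun n =>
  vPow (2 * n - 2 * n * n) • rCoeff n • (E ^ n * Kz (-n) * F ^ n))

theorem hasHSum_tElt : HasHSum (fun n : ℕ =>
    ((-1) ^ n * vPow (n * (n - 1))) • rCoeff n • (E ^ n * Kz n * F ^ n)) tElt :=
  (hasHSum_hSum _).congr fun n => by rw [PowerSeries.coeff_mk]

theorem hasHSum_wElt : HasHSum (fun n : ℕ =>
    vPow (2 * n - 2 * n * n) • rCoeff n • (E ^ n * Kz (-n) * F ^ n)) wElt :=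
  (hasHSum_hSum _).congr fun n => by rw [PowerSeries.coeff_mk]

theorem isWt_tElt : IsWt 0 tElt := IsWt.of_hasHSum hasHSum_tElt fun n =>
  (((((isWt_E_pow n).mul (isWt_Kz n)).mul (isWt_F_pow n)).smul _).smul _).congr (by ring)

theorem Kz_mul_tElt (a : ℤ) (x : Uh) : Kz a * (tElt * x) = tElt * (Kz a * x) := by
  rw [isWt_tElt.Kz_mul_assoc, mul_zero, vPow_zero, one_smul]

/-- The factor h `sh` = v - v⁻¹ clears the denominator of [E, F] = (K - K⁻¹)/(v - v⁻¹); the rest is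
the Leibniz rule and the commutation of K with F. -/
theorem E_mul_F_pow_sub (n : ℕ) :
    (PowerSeries.X * sh : Rh) • (E * F ^ (n + 1) - F ^ (n + 1) * E) =
      qIntQ (n + 1) • (F ^ n * (vPow (-(2 * n)) • Kz 1 - Kz (-1))) := by
  have h0 : (PowerSeries.X * sh : Rh) • (E * F - F * E) = Kz 1 - Kz (-1) := by
    rw [E_mul_F, add_sub_cancel_right, X_mul_sh, smul_qBr, Kz_one, Kz_neg_one, K, Kinv]
  induction n with
  | zero => simpa [qIntQ, vPow_zero] using h0
  | succ n ih =>
    have h1 : E * F ^ (n + 1 + 1) - F ^ (n + 1 + 1) * E =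
        (E * F ^ (n + 1) - F ^ (n + 1) * E) * F + F ^ (n + 1) * (E * F - F * E) := by
      rw [pow_succ F (n + 1)]
      noncomm_ring
    -- Both splittings of [n+2]_q are needed: this one for the coefficient of K⁻¹, the next for that
    -- of K.
    have h2 : qIntQ (n + 1 + 1) = 1 + vPow 2 * qIntQ (n + 1) := by
      rw [qIntQ_add (n + 1) 1]
      simp [qIntQ, vPow_zero]
    have h3 : qIntQ (n + 1 + 1) = qIntQ (n + 1) + vPow (2 * (n + 1 : ℕ)) := by
      rw [add_comm (n + 1) 1, qIntQ_add 1 (n + 1)]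
      simp [qIntQ, vPow_zero]
    have h4 : (vPow (-(2 * n)) * vPow (-2) : Rh) = vPow (-(2 * (n + 1 : ℕ))) := by
      rw [← vPow_add]
      congr 1
      push_cast
      ring
    have h5 := vPow_mul_neg (2 * (n + 1 : ℕ))
    rw [h1, smul_add, ← smul_mul_assoc, ih, ← mul_smul_comm _ (F ^ (n + 1)), h0]
    simp only [smul_mul_assoc, uh_mul_assoc, sub_mul, mul_sub, mul_smul_comm, Kz_mul_F, smul_sub,
      smul_smul]
    simp only [← uh_mul_assoc, ← pow_succ]
    rw [show (2 * 1 * -1 : ℤ) = -2 by rfl, show (2 * -1 * -1 : ℤ) = 2 by rfl,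
      mul_assoc (qIntQ _), h4]
    generalize F ^ (n + 1) * Kz 1 = A
    generalize F ^ (n + 1) * Kz (-1) = B
    have h6 : qIntQ (n + 1 + 1) * vPow (-(2 * (n + 1 : ℕ))) =
        qIntQ (n + 1) * vPow (-(2 * (n + 1 : ℕ))) + 1 := by rw [h3, add_mul, h5]
    rw [h6, h2, add_smul, add_smul, one_smul, one_smul, mul_comm (vPow 2)]
    abel

/-- The difference of the two sides telescopes. Moving E past Fⁿ produces a series a with terms
containing [E, Fⁿ], and what is left over is the same series shifted by one index. -/
theorem tElt_mul_E : tElt * E = E * (Kz 2 * tElt) := by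
  have h1 : ∀ n : ℕ, E ^ n * Kz n * F ^ n * E = vPow (2 * n) • (E ^ (n + 1) * (Kz n * F ^ n)) -
      E ^ n * (Kz n * (E * F ^ n - F ^ n * E)) := fun n => by
    rw [mul_sub, mul_sub, ← uh_mul_assoc (Kz n) E, Kz_mul_E, smul_mul_assoc, mul_smul_comm,
      uh_mul_assoc E, ← uh_mul_assoc _ E, ← pow_succ, mul_one]
    simp only [uh_mul_assoc]
    abel
  have h2 : ∀ n : ℕ, E * (Kz 2 * (E ^ n * Kz n * F ^ n)) =
      vPow (4 * n) • (E ^ (n + 1) * (Kz (n + 2) * F ^ n)) := fun n => by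
    simp only [uh_mul_assoc, (isWt_E_pow _).Kz_mul_assoc, mul_smul_comm, Kz_mul_Kz_assoc]
    rw [← uh_mul_assoc E, ← pow_succ', add_comm 2 (n : ℤ), show (2 * 2 * n : ℤ) = 4 * n by ring]
  have hs := (hasHSum_tElt.map (LinearMap.mulRight Rh E)).sub
    (hasHSum_tElt.map (LinearMap.mulLeft Rh E ∘ₗ LinearMap.mulLeft Rh (Kz 2)))
  have hA : ∃ a, HasHSum (fun n : ℕ => ((-1) ^ n * vPow (n * (n - 1))) • rCoeff n •
      (E ^ n * (Kz n * (E * F ^ n - F ^ n * E)))) a :=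
    ⟨_, (hasHSum_hSum (PowerSeries.mk _)).congr fun n => PowerSeries.coeff_mk _ _⟩
  obtain ⟨a, ha⟩ := hA
  -- The constant term vanishes because E commutes with F⁰, so the shifted series has the same sum.
  have hb := ha.shift (by simp)
  refine sub_eq_zero.1 (hs.unique ?_)
  rw [← sub_self a]
  refine (hb.sub ha).congr fun n => ?_
  simp only [LinearMap.mulRight_apply, LinearMap.mulLeft_apply, LinearMap.comp_apply, map_smul, h1,
    h2]
  -- The factor [n+1]_q from the commutator with Fⁿ⁺¹ turns 1/[n+1]_q! into 1/[n]_q!, and h `sh` is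
  -- the extra factor in passing from n to n + 1.
  have h3 : (PowerSeries.X : Rh) • ((-1 : Rh) ^ (n + 1) *
      vPow ((n + 1 : ℕ) * ((n + 1 : ℕ) - 1))) • rCoeff (n + 1) •
      (E ^ (n + 1) * (Kz (n + 1 : ℕ) * (E * F ^ (n + 1) - F ^ (n + 1) * E))) =
      ((-1 : Rh) ^ (n + 1) * vPow ((n + 1 : ℕ) * ((n + 1 : ℕ) - 1))) •
        vPow ((n + 1 : ℕ) * ((n + 1 : ℕ) - 1)) • sh ^ n • qfInv n •
          (E ^ (n + 1) * (Kz (n + 1 : ℕ) * (F ^ n * (vPow (-(2 * n)) • Kz 1 - Kz (-1))))) := by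
    rw [← qIntQ_mul_qfInv n, mul_comm (qIntQ _), mul_smul (qfInv _), ← mul_smul_comm (qIntQ _),
      ← mul_smul_comm (qIntQ _), ← E_mul_F_pow_sub, rCoeff_smul, mul_smul_comm, mul_smul_comm,
      pow_succ sh]
    simp only [smul_smul]
    congr 1
    ring
  have h4 : ((-1 : Rh) ^ (n + 1) * vPow ((n + 1 : ℕ) * ((n + 1 : ℕ) - 1))) •
        vPow ((n + 1 : ℕ) * ((n + 1 : ℕ) - 1)) • sh ^ n • qfInv n •
          (E ^ (n + 1) * (Kz (n + 1 : ℕ) * (F ^ n * (vPow (-(2 * n)) • Kz 1 - Kz (-1))))) =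
      ((-1) ^ n * vPow (n * (n - 1))) • rCoeff n • vPow (2 * n) •
        (E ^ (n + 1) * (Kz n * F ^ n)) -
      ((-1) ^ n * vPow (n * (n - 1))) • rCoeff n • vPow (4 * n) •
        (E ^ (n + 1) * (Kz (n + 2) * F ^ n)) := by
    rw [mul_sub (F ^ n), mul_smul_comm, (isWt_F_pow n).mul_Kz, (isWt_F_pow n).mul_Kz,
      mul_sub (Kz _), mul_sub (E ^ _), pow_succ (-1 : Rh), mul_neg_one]
    simp only [mul_smul_comm, Kz_mul_Kz_assoc, smul_sub, mul_smul, neg_mul, neg_smul, rCoeff_smul,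
      sh_pow_smul_vPow_smul, qfInv_smul_vPow_smul, neg_one_pow_smul_vPow_smul, vPow_smul_smul,
      neg_one_pow_smul_sh_pow_smul, neg_one_pow_smul_qfInv_smul]
    rw [neg_sub_neg]
    congr 1
    · rw [show ((n + 1 : ℕ) + -1 : ℤ) = n by push_cast; ring]
      congr 2
      push_cast
      ring
    · rw [show ((n + 1 : ℕ) + 1 : ℤ) = n + 2 by push_cast; ring]
      congr 2
      push_cast
      ring
  rw [h3, h4]
  simp only [smul_sub]
  abel

theorem tElt_mul_E_pow (n : ℕ) (x : Uh) :
    tElt * (E ^ n * x) = vPow (2 * n * (n - 1)) • (E ^ n * (Kz (2 * n) * (tElt * x))) := by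
  induction n generalizing x with
  | zero => simp [vPow_zero, Kz_zero]
  | succ n ih =>
    rw [pow_succ, uh_mul_assoc, ih, ← uh_mul_assoc tElt, tElt_mul_E]
    simp only [uh_mul_assoc, isWt_E.Kz_mul_assoc, mul_smul_comm, Kz_mul_Kz_assoc, vPow_smul_smul]
    congr 1
    · congr 1
      push_cast
      ring

/-- Applying S gives terms S(Eⁿ) Kⁿ⁻ᵐ (Fⁿ ▷ z). After expanding Fⁿ ▷ z, the powers Fⁱ to the left of
z combine with Eⁱ into the series of t, and the powers Fʲ to the right index the outer sum. -/
theorem hasHSum_antipode_bAntipodeInv {m : ℤ} {z : Uh} (hz : IsWt m z) :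
    HasHSum (fun n : ℕ => vPow (-(2 * n * n)) • rCoeff n •
      (Kz (n - m) * (E ^ n * (tElt * (z * F ^ n))))) (antipode (bAntipodeInv z)) := by
  refine (hasHSum_antidiagonal (s := fun j i => vPow (-(2 * j * j)) • rCoeff j •
    ((-1 : Rh) ^ i * vPow (i * (i - 1))) • rCoeff i •
      (Kz (j - m) * (E ^ j * (E ^ i * Kz i * F ^ i * (z * F ^ j))))) fun j => ?_).1 ?_
  · refine (hasHSum_tElt.map (vPow (-(2 * j * j)) • rCoeff j • (LinearMap.mulLeft Rh (Kz (j - m)) ∘ₗ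
      LinearMap.mulLeft Rh (E ^ j) ∘ₗ LinearMap.mulRight Rh (z * F ^ j)))).congr fun i => ?_
    simp only [map_smul, LinearMap.smul_apply, LinearMap.comp_apply, LinearMap.mulLeft_apply,
      LinearMap.mulRight_apply]
    simp only [smul_smul]
    congr 1
    ring
  · refine ((hasHSum_bAntipodeInv hz).map antipode).congr fun n => ?_
    rw [map_smul, antipode_mul, antipode_mul, antipode_Kz, antipode_antipodeInv, antipode_E_pow,
      rCoeff, mul_smul, ← mul_smul_comm, ad_F_pow, ← Finset.Nat.sum_antidiagonal_swap,
      Finset.mul_sum, Finset.smul_sum]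
    refine Finset.sum_congr rfl fun p hp => ?_
    obtain ⟨j, i⟩ := p
    obtain rfl := mem_antidiagonal.1 hp
    simp only [uh_mul_assoc, mul_smul, smul_mul_assoc, mul_smul_comm, ← Kz_add,
      (isWt_E_pow _).Kz_mul_assoc, (isWt_F_pow _).Kz_mul_assoc, hz.Kz_mul_assoc, Kz_mul_F_pow,
      E_pow_mul_E_pow_mul, rCoeff_smul, sh_pow_smul_vPow_smul, qfInv_smul_vPow_smul,
      neg_one_pow_smul_vPow_smul, qfInv_smul_sh_pow_smul, neg_one_pow_smul_sh_pow_smul,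
      neg_one_pow_smul_qfInv_smul, sh_pow_smul_sh_pow_smul, vPow_smul_smul,
      neg_one_pow_smul_neg_one_pow_smul, Prod.swap]
    rw [smul_comm (qfInv i), ← add_assoc j j i, pow_add (-1 : Rh) (j + j), Even.neg_one_pow ⟨j, rfl⟩,
      one_mul, show (-((j + i : ℕ) : ℤ) + -(m - (j + i : ℕ)) + (i + j)) = j - m + i by push_cast; ring]
    congr 2
    push_cast
    ring

theorem bAntipodeInv_one : bAntipodeInv 1 = 1 := by
  have h : ∀ n, ad (F ^ (n + 1)) 1 = 0 := fun n => by
    rw [pow_succ, ad_mul, ad_F, mul_one, one_mul, sub_self, zero_mul, map_zero]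
  refine (hasHSum_bAntipodeInv isWt_one).unique ?_
  have := hasHSum_single (a := fun n : ℕ =>
    rCoeff n • (antipodeInv (ad (F ^ n) 1) * (Kz (0 - n) * E ^ n))) fun n => by
      rw [h, map_zero, zero_mul, smul_zero]
  simpa [rCoeff_zero, ad_one, antipodeInv_one, Kz_zero] using this

/-- The inverse braided antipode fixes 1, so the preceding regrouping at z = 1 is a series for 1.
Moving t to the front past the powers of E turns its terms into those of t w. -/
theorem tElt_mul_wElt : tElt * wElt = 1 := by
  have h1 := hasHSum_antipode_bAntipodeInv isWt_one
  rw [bAntipodeInv_one, antipode_one] at h1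
  refine (hasHSum_wElt.map (LinearMap.mulLeft Rh tElt)).unique (h1.congr fun n => ?_)
  rw [LinearMap.mulLeft_apply, mul_smul_comm, mul_smul_comm, uh_mul_assoc, tElt_mul_E_pow, one_mul,
    ← Kz_mul_tElt, Kz_mul_Kz_assoc, (isWt_E_pow n).Kz_mul_assoc, smul_comm (rCoeff n) (vPow _),
    smul_comm (rCoeff n) (vPow _), vPow_smul_smul, vPow_smul_smul, Kz_mul_tElt, sub_zero,
    show (2 * n + -n : ℤ) = n by ring, Kz_mul_tElt]
  congr 2
  ring

/-- The dual regrouping: S reverses Fⁱ x Fʲ, so the powers Fʲ now stand to the left of S(x) and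
combine with Eʲ into w. -/
theorem hasHSum_bAntipode_wElt {m : ℤ} {x : Uh} (hx : IsWt m x) :
    HasHSum (fun n : ℕ => vPow (-(2 * n * n)) • rCoeff n •
      (Kz m * (E ^ n * (Kz (-(2 * n)) * (wElt * (antipode x * antipode (F ^ n))))))) (bAntipode x) := by
  refine (hasHSum_antidiagonal (s := fun i j => vPow (-(2 * i * i)) • rCoeff i •
    vPow (2 * j - 2 * j * j) • rCoeff j • (Kz m * (E ^ i * (Kz (-(2 * i)) *
      (E ^ j * Kz (-j) * F ^ j * (antipode x * antipode (F ^ i))))))) fun i => ?_).1 ?_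
  · refine (hasHSum_wElt.map (vPow (-(2 * i * i)) • rCoeff i • (LinearMap.mulLeft Rh (Kz m) ∘ₗ
      LinearMap.mulLeft Rh (E ^ i) ∘ₗ LinearMap.mulLeft Rh (Kz (-(2 * i))) ∘ₗ
        LinearMap.mulRight Rh (antipode x * antipode (F ^ i))))).congr fun j => ?_
    simp only [map_smul, LinearMap.smul_apply, LinearMap.comp_apply, LinearMap.mulLeft_apply,
      LinearMap.mulRight_apply]
    simp only [smul_smul]
    congr 1
    ring
  · refine (hasHSum_bAntipode hx).congr fun n => ?_
    rw [rCoeff, mul_smul, ← mul_smul_comm, ← map_smul, ad_F_pow, map_sum, Finset.mul_sum,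
      Finset.smul_sum]
    refine Finset.sum_congr rfl fun p hp => ?_
    obtain ⟨i, j⟩ := p
    obtain rfl := mem_antidiagonal.1 hp
    dsimp only
    rw [map_smul, map_smul, antipode_mul, antipode_mul, antipode_mul, antipode_Kz, antipode_F_pow j]
    simp only [uh_mul_assoc, mul_smul, smul_mul_assoc, mul_smul_comm, Kz_mul_Kz_assoc,
      (isWt_E_pow _).Kz_mul_assoc, (isWt_F_pow _).Kz_mul_assoc, hx.antipode.Kz_mul_assoc,
      E_pow_mul_E_pow_mul, rCoeff_smul, sh_pow_smul_vPow_smul, qfInv_smul_vPow_smul,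
      neg_one_pow_smul_vPow_smul, qfInv_smul_sh_pow_smul, sh_pow_smul_sh_pow_smul, vPow_smul_smul,
      neg_one_pow_smul_neg_one_pow_smul]
    rw [Even.neg_one_pow ⟨j, rfl⟩, one_smul,
      show (m - (i + j : ℕ) + (-(i + j) + j) : ℤ) = m + (-(2 * i) + -j) by push_cast; ring]
    congr 2
    push_cast
    ring

/-- In the composite series t passes the powers of E and K and cancels with w. For i + j = n all
terms are then multiples of Eⁿ S(x) Fⁿ Kⁿ, and their coefficients add up to the alternating sum,
which vanishes unless n = 0. -/
theorem antipode_bAntipodeInv_bAntipode {m : ℤ} {x : Uh} (hx : IsWt m x) :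
    antipode (bAntipodeInv (bAntipode x)) = antipode x := by
  have hz : IsWt m (bAntipode x) := IsWt.of_hasHSum (hasHSum_bAntipode hx) fun n =>
    ((((isWt_Kz _).mul (isWt_E_pow n)).mul (hx.isWt_ad_F_pow n).antipode).smul _).congr (by ring)
  have h1 := (hasHSum_antidiagonal (s := fun j i => vPow (-(2 * j * j)) • rCoeff j •
    vPow (-(2 * i * i)) • rCoeff i • (Kz (j - m) * (E ^ j * (tElt *
      (Kz m * (E ^ i * (Kz (-(2 * i)) * (wElt * (antipode x * antipode (F ^ i))))) * F ^ j)))))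
        fun j => ?_).2 (hasHSum_antipode_bAntipodeInv hz)
  · have h2 : ∀ j i : ℕ, vPow (-(2 * j * j)) • rCoeff j •
      vPow (-(2 * i * i)) • rCoeff i • (Kz (j - m) * (E ^ j * (tElt *
      (Kz m * (E ^ i * (Kz (-(2 * i)) * (wElt * (antipode x * antipode (F ^ i))))) * F ^ j)))) =
      (qfInv j * qfInv i * ((-1) ^ j * vPow (i * (i - 1)))) •
        ((-1) ^ (j + i) * sh ^ (j + i) * vPow (-((j + i : ℕ) * ((j + i : ℕ) + 1)))) •
          (E ^ (j + i) * antipode x * F ^ (j + i) * Kz (j + i : ℕ)) := fun j i => by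
      have h3 : ∀ y, tElt * (Kz m * (E ^ i * (Kz (-(2 * i)) * (wElt * y)))) =
          vPow (2 * i * (i - 1)) • (Kz m * (E ^ i * y)) := fun y => by
        rw [← Kz_mul_tElt, tElt_mul_E_pow, ← Kz_mul_tElt, Kz_mul_Kz_assoc, add_neg_cancel, Kz_zero,
          one_mul, ← uh_mul_assoc tElt, tElt_mul_wElt, one_mul, mul_smul_comm]
      rw [uh_mul_assoc (Kz m), uh_mul_assoc (E ^ i), uh_mul_assoc (Kz _), uh_mul_assoc wElt, h3,
        antipode_F_pow]
      simp only [uh_mul_assoc, mul_smul, smul_mul_assoc, mul_smul_comm, ← Kz_add,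
        (isWt_E_pow _).Kz_mul_assoc, (isWt_F_pow _).Kz_mul_assoc, hx.antipode.Kz_mul_assoc,
        E_pow_mul_E_pow_mul, F_pow_mul_F_pow_mul, Kz_mul_F_pow, rCoeff_smul, sh_pow_smul_vPow_smul,
        qfInv_smul_vPow_smul,
        neg_one_pow_smul_vPow_smul, qfInv_smul_sh_pow_smul, neg_one_pow_smul_sh_pow_smul,
        sh_pow_smul_sh_pow_smul, vPow_smul_smul,
        neg_one_pow_smul_neg_one_pow_smul]
      rw [← add_assoc j j i, pow_add (-1 : Rh) (j + j), Even.neg_one_pow ⟨j, rfl⟩, one_mul,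
        add_comm i j, show (j - m + (m + i) : ℤ) = (j + i : ℕ) by push_cast; ring]
      congr 2
      push_cast
      ring
    simp only [h2] at h1
    refine (h1.unique (hasHSum_single fun n => ?_)).trans ?_
    · have h3 := congrArg (fun c : Rh => c • ((-1 : Rh) ^ (n + 1) * sh ^ (n + 1) *
        vPow (-((n + 1 : ℕ) * ((n + 1 : ℕ) + 1)))) •
          (E ^ (n + 1) * antipode x * F ^ (n + 1) * Kz (n + 1 : ℕ))) (sum_neg_one_pow_qfInv n)
      rw [zero_smul, Finset.sum_smul] at h3
      refine Eq.trans (Finset.sum_congr rfl fun p hp => ?_) h3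
      rw [mem_antidiagonal.1 hp]
    · simp [qfInv_zero, vPow_zero, Kz_zero]
  · refine ((hasHSum_bAntipode_wElt hx).map (vPow (-(2 * j * j)) • rCoeff j •
      (LinearMap.mulLeft Rh (Kz (j - m)) ∘ₗ
      LinearMap.mulLeft Rh (E ^ j) ∘ₗ LinearMap.mulLeft Rh tElt ∘ₗ
        LinearMap.mulRight Rh (F ^ j)))).congr fun i => ?_
    simp only [map_smul, LinearMap.smul_apply, LinearMap.comp_apply, LinearMap.mulLeft_apply,
      LinearMap.mulRight_apply]
    simp only [smul_smul]
    congr 1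
    ring

theorem bAntipodeInv_comp_bAntipode : bAntipodeInv ∘ₗ bAntipode = LinearMap.id :=
  uh_ext fun m x hx => by
    have := congrArg antipodeInv (antipode_bAntipodeInv_bAntipode hx)
    rwa [antipodeInv_antipode, antipodeInv_antipode] at this

/-! ### Inversion of the braiding -/

theorem braiding_comp_braidingInv : braiding ∘ₗ braidingInv = LinearMap.id :=
  uh2_ext_wt fun m m' x y hx hy => by
    rw [LinearMap.comp_apply, LinearMap.id_apply]
    have h1 := (hasHSum_antidiagonal (s := fun n k =>
      (rCoeff n * ((-1) ^ n * vPow (-(2 * m' * m) - n * (n - 1)))) •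
        (rCoeff k * vPow (2 * (m' - n - k) * (m + n + k))) •
          tm (ad (E ^ k) (ad (E ^ n) x)) (ad (F ^ k) (ad (F ^ n) y))) fun n => ?_).2
            ((hasHSum_braidingInv hx hy).map braiding)
    -- Up to scalars all terms with the same n + k are the same tensor; isolating the dependence on
    -- the splitting exposes the alternating q-binomial sum.
    · have h2 : ∀ n k : ℕ, (rCoeff n * ((-1) ^ n * vPow (-(2 * m' * m) - n * (n - 1)))) •
        (rCoeff k * vPow (2 * (m' - n - k) * (m + n + k))) •
          tm (ad (E ^ k) (ad (E ^ n) x)) (ad (F ^ k) (ad (F ^ n) y)) =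
        (qfInv n * qfInv k * ((-1) ^ n * vPow (k * (k - 1)))) •
          (sh ^ (n + k) * vPow (-(2 * m' * m) + 2 * (m' - (n + k : ℕ)) * (m + (n + k : ℕ)))) •
          tm (ad (E ^ (n + k)) x) (ad (F ^ (n + k)) y) := fun n k => by
        rw [← ad_mul, ← ad_mul, ← pow_add, ← pow_add, add_comm k n]
        simp only [mul_smul, rCoeff_smul, sh_pow_smul_vPow_smul, qfInv_smul_vPow_smul,
          neg_one_pow_smul_vPow_smul, qfInv_smul_sh_pow_smul, neg_one_pow_smul_sh_pow_smul,
          neg_one_pow_smul_qfInv_smul, sh_pow_smul_sh_pow_smul, vPow_smul_smul]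
        congr 2
        push_cast
        ring
      simp only [h2] at h1
      refine (h1.unique (hasHSum_single fun n => ?_)).trans ?_
      · have h3 := congrArg (fun c : Rh => c • (sh ^ (n + 1) *
          vPow (-(2 * m' * m) + 2 * (m' - (n + 1 : ℕ)) * (m + (n + 1 : ℕ)))) •
            tm (ad (E ^ (n + 1)) x) (ad (F ^ (n + 1)) y)) (sum_neg_one_pow_qfInv n)
        rw [zero_smul, Finset.sum_smul] at h3
        refine Eq.trans (Finset.sum_congr rfl fun p hp => ?_) h3
        rw [mem_antidiagonal.1 hp]
      · have h3 : -(2 * m' * m) + 2 * m' * m = 0 := by ring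
        simp [qfInv_zero, vPow_zero, ad_one, h3]
    · rw [map_smul]
      exact (hasHSum_braiding (hy.isWt_ad_F_pow n) (hx.isWt_ad_E_pow n)).map
        (LinearMap.lsmul Rh Uh2 (rCoeff n * ((-1) ^ n * vPow (-(2 * m' * m) - n * (n - 1)))))

/-! ### The structure maps modulo `h` -/

/-- R ≡ 1 ⊗ 1 modulo h, since D ≡ 1 and the terms with n ≥ 1 carry a factor h. This is used to turn
one-sided inverses into two-sided ones. -/
theorem ext2_Rmat_sub_mem {N : Type*} [AddCommGroup N] [Module Rh N] [IsAdicComplete hId N]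
    (f : Uh ⊗[Rh] Uh →ₗ[Rh] N) : ext2 f Rmat - f (1 ⊗ₜ 1) ∈ hPow N 1 := by
  have h1 := hasHSum_Rmat f 1
  have h2 : Dmat - 1 ∈ hPow Uh2 1 := by
    have h := hSum_spec (expS (cst (1 / 4) • tm H H)) 1
    have h' : PowerSeries.coeff 0 (expS (cst (1 / 4) • tm H H)) = 1 := by simp [expS]
    rwa [Finset.sum_range_one, pow_zero, one_smul, h'] at h
  have h3 : ext2 f Dmat - f (1 ⊗ₜ 1) ∈ hPow N 1 := by
    have := map_mem_hPow (ext2 f) h2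
    rwa [map_sub, show (1 : Uh2) = tm 1 1 from (map_one toUh2).symm, ext2_tm] at this
  have h4 : tm 1 1 = (1 : Uh2) := map_one toUh2
  simp only [Finset.range_one, Finset.sum_singleton, pow_zero, one_smul, rCoeff_zero, h4,
    mul_one] at h1
  simpa using add_mem h1 h3

/-- Modulo h the inverse braided antipode is S⁻¹, so its composite with S is injective and so is the
map itself. An injective left inverse is a two-sided inverse. -/
theorem bAntipode_comp_bAntipodeInv : bAntipode ∘ₗ bAntipodeInv = LinearMap.id := by
  have h1 : Function.Injective (antipode ∘ₗ bAntipodeInv) := by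
    refine injective_of_sub_mem_hPow _ fun x => ?_
    have := map_mem_hPow antipode (ext2_Rmat_sub_mem (LinearMap.mul' Rh Uh ∘ₗ
      TensorProduct.map (antipodeInv ∘ₗ ad.flip x) LinearMap.id))
    have h2 : (LinearMap.mul' Rh Uh ∘ₗ TensorProduct.map (antipodeInv ∘ₗ ad.flip x) LinearMap.id)
      (1 ⊗ₜ 1) = antipodeInv (ad 1 x) * 1 := rfl
    rw [h2, mul_one, ad_one, map_sub, antipode_antipodeInv] at this
    exact this
  ext x
  refine h1 (congrArg antipode ?_)
  exact LinearMap.congr_fun bAntipodeInv_comp_bAntipode (bAntipodeInv x)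

theorem braiding_sub_mem (x y : Uh) : braiding (tm x y) - tm y x ∈ hPow Uh2 1 := by
  have := ext2_Rmat_sub_mem (swapMap₂ (ad.flip x) (ad.flip y))
  rw [swapMap₂_tmul, LinearMap.flip_apply, LinearMap.flip_apply, ad_one, ad_one] at this
  have h : braiding (tm x y) = ext2 (swapMap₂ (ad.flip x) (ad.flip y)) Rmat := ext2_tm _ _ _
  rwa [h]

theorem braidingInv_sub_mem (x y : Uh) : braidingInv (tm x y) - tm y x ∈ hPow Uh2 1 := by
  have := ext2_Rmat_sub_mem (toUh2.toLinearMap ∘ₗ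
      TensorProduct.map (ad.flip y ∘ₗ antipode) (ad.flip x))
  have h' : (toUh2.toLinearMap ∘ₗ
      TensorProduct.map (ad.flip y ∘ₗ antipode) (ad.flip x)) (1 ⊗ₜ 1) =
        tm (ad (antipode 1) y) (ad 1 x) := rfl
  rw [h', antipode_one, ad_one, ad_one] at this
  have h : braidingInv (tm x y) = ext2 (toUh2.toLinearMap ∘ₗ
      TensorProduct.map (ad.flip y ∘ₗ antipode) (ad.flip x)) Rmat := ext2_tm _ _ _
  rwa [h]

/-- Both braidings reduce to the flip modulo h, so ψ⁻¹ ψ is injective. It is idempotent because ψ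
ψ⁻¹ = 1, hence it is the identity. -/
theorem braidingInv_comp_braiding : braidingInv ∘ₗ braiding = LinearMap.id := by
  have h0 : ∀ z : Uh2, (braidingInv ∘ₗ braiding) z - z ∈ hPow Uh2 1 := fun z => by
    obtain ⟨a, ha⟩ : ∃ a, z - toUh2 a ∈ hPow Uh2 1 :=
      exists_hof_sub_mem (M := Uh ⊗[Rh] Uh) z 1
    have h1 : (braidingInv ∘ₗ braiding) (toUh2 a) - toUh2 a ∈ hPow Uh2 1 := by
      clear ha
      induction a using TensorProduct.induction_on with
      | zero => simp
      | tmul x y =>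
        have := add_mem (map_mem_hPow braidingInv (braiding_sub_mem x y)) (braidingInv_sub_mem y x)
        rwa [map_sub, sub_add_sub_cancel] at this
      | add a b ha hb =>
        rw [map_add, map_add, add_sub_add_comm]
        exact add_mem ha hb
    have h2 := sub_mem (add_mem (map_mem_hPow (braidingInv ∘ₗ braiding) ha) h1) ha
    rw [map_sub] at h2
    convert h2 using 1
    abel
  have h1 := injective_of_sub_mem_hPow _ h0
  ext z
  refine h1 (congrArg braidingInv ?_)
  exact LinearMap.congr_fun braiding_comp_braidingInv (braiding z)

/-! ### The even integral form -/

section Scalars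

variable {M : Type*} [AddCommGroup M] [Module Rh M]

theorem vPow_mem_Zq {a : ℤ} (ha : Even a) : vPow a ∈ Zq := by
  have h1 : ∀ n : ℕ, vPow (2 * n) ∈ Zq ∧ vPow (-(2 * n)) ∈ Zq := fun n => by
    induction n with
    | zero => simp [vPow_zero, one_mem]
    | succ n ih =>
      push_cast
      rw [mul_add, neg_add, vPow_add, vPow_add]
      exact ⟨mul_mem ih.1 (Subring.subset_closure (by simp)),
        mul_mem ih.2 (Subring.subset_closure (by simp))⟩
  obtain ⟨b, rfl⟩ := ha
  rw [← two_mul]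
  obtain ⟨n, rfl | rfl⟩ := b.eq_nat_or_neg
  · exact (h1 n).1
  · rw [mul_neg]
    exact (h1 n).2

theorem Zq_smul_mem (S : Submodule Zq M) {c : Rh} (hc : c ∈ Zq) {x : M} (hx : x ∈ S) :
    c • x ∈ S := S.smul_mem ⟨c, hc⟩ hx

theorem vPow_smul_mem (S : Submodule Zq M) {a : ℤ} (ha : Even a) {x : M} (hx : x ∈ S) :
    vPow a • x ∈ S := Zq_smul_mem S (vPow_mem_Zq ha) hx

theorem neg_one_pow_smul_mem (S : Submodule Zq M) (n : ℕ) {x : M} (hx : x ∈ S) :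
    (-1 : Rh) ^ n • x ∈ S := Zq_smul_mem S (pow_mem (neg_mem (one_mem _)) n) hx

end Scalars

theorem e_pow (n : ℕ) : e ^ n = (PowerSeries.X * sh : Rh) ^ n • E ^ n := by
  rw [e, ← X_mul_sh, smul_pow]

theorem isWt_e : IsWt 1 e := isWt_E.smul _

theorem isWt_e_pow (n : ℕ) : IsWt n (e ^ n) := (isWt_e.pow n).congr (mul_one _)

theorem e_mem_Uev : e ∈ Uev := Algebra.subset_adjoin (by simp)

theorem Fdiv_eq (n : ℕ) : Fdiv n = qfInv n • (F ^ n * Kz n) := by rw [Fdiv, K_pow, qfInv]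

theorem isWt_Fdiv (n : ℕ) : IsWt (-n) (Fdiv n) := by
  rw [Fdiv_eq]
  exact (((isWt_F_pow n).mul (isWt_Kz n)).smul _).congr (add_zero _)

theorem Fdiv_zero : Fdiv 0 = 1 := by simp [Fdiv_eq, qfInv_zero, Kz_zero]

theorem Fdiv_mem_Uev (n : ℕ) : Fdiv n ∈ Uev := by
  rcases n with _ | n
  · rw [Fdiv_zero]
    exact one_mem _
  · exact Algebra.subset_adjoin (Or.inr ⟨n + 1, by omega, rfl⟩)

theorem Kz_mem_Uev {a : ℤ} (ha : Even a) : Kz a ∈ Uev := by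
  have h1 : ∀ n : ℕ, Kz (2 * n) ∈ Uev ∧ Kz (-(2 * n)) ∈ Uev := fun n => by
    induction n with
    | zero => simp [Kz_zero, one_mem]
    | succ n ih =>
      push_cast
      rw [mul_add, neg_add, Kz_add, Kz_add]
      refine ⟨mul_mem ih.1 (Algebra.subset_adjoin ?_), mul_mem ih.2 (Algebra.subset_adjoin ?_)⟩
      · left; left
        rw [K_pow]
        rfl
      · left; right; left
        rw [Kinv_pow]
        rfl
  obtain ⟨b, rfl⟩ := ha
  rw [← two_mul]
  obtain ⟨n, rfl | rfl⟩ := b.eq_nat_or_neg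
  · exact (h1 n).1
  · rw [mul_neg]
    exact (h1 n).2

theorem mem_fil1_zero {x : Uh} : x ∈ fil1 0 ↔ x ∈ Uev := by
  constructor
  · intro h
    have : fil1 0 ≤ Subalgebra.toSubmodule Uev := Submodule.span_le.2 <| by
      rintro _ ⟨a, ha, b, hb, rfl⟩
      rw [pow_zero, mul_one]
      exact Uev.mul_mem ha hb
    exact this h
  · intro h
    exact Submodule.subset_span ⟨x, h, 1, one_mem _, by simp⟩

theorem fil1_antitone : Antitone fil1 := fun p q h => Submodule.span_le.2 <| by
  rintro _ ⟨a, ha, b, hb, rfl⟩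
  refine Submodule.subset_span ⟨a, ha, e ^ (q - p) * b, mul_mem (pow_mem e_mem_Uev _) hb, ?_⟩
  rw [← mul_assoc, mul_assoc a (e ^ p), ← pow_add, Nat.add_sub_cancel' h]

theorem mul_mem_fil1_left {p : ℕ} {a x : Uh} (ha : a ∈ Uev) (hx : x ∈ fil1 p) :
    a * x ∈ fil1 p := by
  induction hx using Submodule.span_induction with
  | mem x hx =>
    obtain ⟨b, hb, c, hc, rfl⟩ := hx
    exact Submodule.subset_span ⟨a * b, mul_mem ha hb, c, hc, by simp only [mul_assoc]⟩
  | zero => simp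
  | add x y _ _ hx hy => rw [mul_add]; exact add_mem hx hy
  | smul c x _ hx => rw [mul_smul_comm]; exact Submodule.smul_mem _ _ hx

theorem mul_mem_fil1_right {p : ℕ} {a x : Uh} (ha : a ∈ Uev) (hx : x ∈ fil1 p) :
    x * a ∈ fil1 p := by
  induction hx using Submodule.span_induction with
  | mem x hx =>
    obtain ⟨b, hb, c, hc, rfl⟩ := hx
    exact Submodule.subset_span ⟨b, hb, c * a, mul_mem hc ha, by simp only [mul_assoc]⟩
  | zero => simp
  | add x y _ _ hx hy => rw [add_mul]; exact add_mem hx hy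
  | smul c x _ hx => rw [smul_mul_assoc]; exact Submodule.smul_mem _ _ hx

theorem fil1_le_Uev {p : ℕ} {x : Uh} (hx : x ∈ fil1 p) : x ∈ Uev :=
  mem_fil1_zero.1 (fil1_antitone (Nat.zero_le p) hx)

/-- Only the two-sided ideal property is behind this; the argument never needs degrees to add. -/
theorem mul_mem_fil1 {p q : ℕ} {x y : Uh} (hx : x ∈ fil1 p) (hy : y ∈ fil1 q) :
    x * y ∈ fil1 (max p q) := by
  rcases le_total p q with h | h
  · rw [max_eq_right h]
    exact mul_mem_fil1_left (fil1_le_Uev hx) hy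
  · rw [max_eq_left h]
    exact mul_mem_fil1_right (fil1_le_Uev hy) hx

theorem e_pow_mem_fil1 (p : ℕ) : e ^ p ∈ fil1 p :=
  Submodule.subset_span ⟨1, one_mem _, 1, one_mem _, by simp⟩

theorem e_pow_mem_hPow (p : ℕ) : e ^ p ∈ hPow Uh p := by
  rw [e_pow, mul_pow, mul_smul]
  exact X_pow_smul_mem_hPow _ _

/-- Because h divides e, filtration convergence implies h-adic convergence. -/
theorem mem_hPow_of_mem_fil1 (p : ℕ) (x : Uh) (hx : x ∈ fil1 p) : x ∈ hPow Uh p := by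
  induction hx using Submodule.span_induction with
  | mem x hx =>
    obtain ⟨a, ha, b, hb, rfl⟩ := hx
    exact map_mem_hPow (LinearMap.mulRight Rh b)
      (map_mem_hPow (LinearMap.mulLeft Rh a) (e_pow_mem_hPow p))
  | zero => exact zero_mem _
  | add x y _ _ hx hy => exact add_mem hx hy
  | smul c x _ hx => exact Submodule.smul_mem _ (c : Rh) hx

theorem tm_mem_fil2 {p q : ℕ} {x y : Uh} (hx : x ∈ fil1 p) (hy : y ∈ fil1 q) :
    tm x y ∈ fil2 (max p q) := by
  rcases le_total p q with h | h
  · rw [max_eq_right h]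
    exact Submodule.mem_sup_right (Submodule.subset_span ⟨x, fil1_le_Uev hx, y, hy, rfl⟩)
  · rw [max_eq_left h]
    exact Submodule.mem_sup_left (Submodule.subset_span ⟨x, hx, y, fil1_le_Uev hy, rfl⟩)

theorem fil2_le {p : ℕ} {S : Submodule Zq Uh2} (h1 : ∀ x ∈ fil1 p, ∀ y ∈ Uev, tm x y ∈ S)
    (h2 : ∀ x ∈ Uev, ∀ y ∈ fil1 p, tm x y ∈ S) : fil2 p ≤ S := by
  refine sup_le (Submodule.span_le.2 ?_) (Submodule.span_le.2 ?_)
  · rintro _ ⟨x, hx, y, hy, rfl⟩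
    exact h1 x hx y hy
  · rintro _ ⟨x, hx, y, hy, rfl⟩
    exact h2 x hx y hy

theorem fil2_antitone : Antitone fil2 := fun p q h => by
  refine fil2_le (fun x hx y hy => ?_) fun x hx y hy => ?_
  · exact Submodule.mem_sup_left (Submodule.subset_span ⟨x, fil1_antitone h hx, y, hy, rfl⟩)
  · exact Submodule.mem_sup_right (Submodule.subset_span ⟨x, hx, y, fil1_antitone h hy, rfl⟩)

theorem mem_hPow_of_mem_fil2 (p : ℕ) (z : Uh2) (hz : z ∈ fil2 p) : z ∈ hPow Uh2 p := by
  have : fil2 p ≤ (hPow Uh2 p).restrictScalars Zq := by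
    refine fil2_le (fun x hx y hy => ?_) fun x hx y hy => ?_
    · exact map_mem_hPow (tmL.flip y) (mem_hPow_of_mem_fil1 p x hx)
    · exact map_mem_hPow (tmL x) (mem_hPow_of_mem_fil1 p y hy)
  exact this hz

/-! ### Weight vectors in the even integral form -/

/-- The weight vectors `x` in the `p`-th step of the filtration for which `K ^ m S(x)` and
`S⁻¹(x) K ^ m` are also in the `p`-th step, where `m` is the weight of `x`. -/
noncomputable def filWt (m : ℤ) (p : ℕ) : Submodule Zq Uh where
  carrier := {x | IsWt m x ∧ x ∈ fil1 p ∧ Kz m * antipode x ∈ fil1 p ∧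
    antipodeInv x * Kz m ∈ fil1 p}
  add_mem' := by
    rintro x y ⟨h1, h2, h3, h4⟩ ⟨h1', h2', h3', h4'⟩
    refine ⟨h1.add h1', add_mem h2 h2', ?_, ?_⟩
    · rw [map_add, mul_add]
      exact add_mem h3 h3'
    · rw [map_add, add_mul]
      exact add_mem h4 h4'
  zero_mem' := ⟨isWt_zero m, zero_mem _, by simp, by simp⟩
  smul_mem' := by
    rintro c x ⟨h1, h2, h3, h4⟩
    refine ⟨h1.smul (c : Rh), Submodule.smul_mem _ c h2, ?_, ?_⟩
    · have := Submodule.smul_mem _ c h3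
      rwa [← mul_smul_comm, show c • antipode x = antipode (c • x) from
        (map_smul antipode (c : Rh) x).symm] at this
    · have := Submodule.smul_mem _ c h4
      rwa [← smul_mul_assoc, show c • antipodeInv x = antipodeInv (c • x) from
        (map_smul antipodeInv (c : Rh) x).symm] at this

/-- The twist repairs, for example, S(e) = -K⁻¹ e, whose odd power of K disappears in K S(e) = -e.
It is multiplicative: Kᵐ⁺ⁿ S(x y) equals Kⁿ S(y) Kᵐ S(x) up to a power of q, and similarly for S⁻¹.
So membership need only be checked on generators. -/
theorem mul_mem_filWt {m n : ℤ} {p q : ℕ} {x y : Uh} (hx : x ∈ filWt m p) (hy : y ∈ filWt n q) :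
    x * y ∈ filWt (m + n) (max p q) := by
  obtain ⟨h1, h2, h3, h4⟩ := hx
  obtain ⟨h1', h2', h3', h4'⟩ := hy
  refine ⟨h1.mul h1', mul_mem_fil1 h2 h2', ?_, ?_⟩
  · rw [antipode_mul, add_comm, Kz_add, uh_mul_assoc, h1'.antipode.Kz_mul_assoc, mul_smul_comm,
      ← uh_mul_assoc, max_comm]
    exact vPow_smul_mem _ (by rw [mul_assoc]; exact even_two_mul _) (mul_mem_fil1 h3' h3)
  · rw [antipodeInv_mul, add_comm, Kz_add, uh_mul_assoc, ← uh_mul_assoc (antipodeInv x),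
      h1.antipodeInv.mul_Kz, smul_mul_assoc, mul_smul_comm, uh_mul_assoc, ← uh_mul_assoc, max_comm]
    exact vPow_smul_mem _ (by rw [mul_assoc]; exact (even_two_mul _).neg) (mul_mem_fil1 h4' h4)

theorem Kz_mem_filWt {a : ℤ} (ha : Even a) : Kz a ∈ filWt 0 0 := by
  refine ⟨isWt_Kz a, mem_fil1_zero.2 (Kz_mem_Uev ha), ?_, ?_⟩
  · rw [Kz_zero, one_mul, antipode_Kz]
    exact mem_fil1_zero.2 (Kz_mem_Uev ha.neg)
  · rw [Kz_zero, mul_one, antipodeInv_Kz]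
    exact mem_fil1_zero.2 (Kz_mem_Uev ha.neg)

theorem one_mem_filWt : (1 : Uh) ∈ filWt 0 0 := Kz_zero ▸ Kz_mem_filWt Even.zero

theorem antipodeInv_of_antipode {x : Uh} {n : ℕ} {a b : ℤ}
    (h : antipode x = ((-1) ^ n * vPow a) • (x * Kz b)) :
    antipodeInv x = ((-1) ^ n * vPow (-a)) • (Kz b * x) := by
  have h1 := congrArg antipodeInv h
  rw [antipodeInv_antipode, map_smul, antipodeInv_mul, antipodeInv_Kz] at h1
  have h2 : ((-1) ^ n * vPow (-a)) * ((-1) ^ n * vPow a) = (1 : Rh) := by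
    rw [mul_mul_mul_comm, ← mul_pow, neg_one_mul, neg_neg, one_pow, one_mul, mul_comm,
      vPow_mul_neg]
  nth_rewrite 2 [h1]
  rw [mul_smul_comm, smul_smul, h2, one_smul, ← mul_assoc, Kz_mul_neg, one_mul]

theorem antipodeInv_E_pow (n : ℕ) :
    antipodeInv (E ^ n) = ((-1) ^ n * vPow (- -(n * (n + 1)))) • (Kz (-n) * E ^ n) :=
  antipodeInv_of_antipode (antipode_E_pow n)

theorem antipodeInv_F_pow (n : ℕ) :
    antipodeInv (F ^ n) = ((-1) ^ n * vPow (- -(n * (n - 1)))) • (Kz n * F ^ n) :=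
  antipodeInv_of_antipode (antipode_F_pow n)

theorem e_pow_mem_filWt (p : ℕ) : e ^ p ∈ filWt p p := by
  refine ⟨isWt_e_pow p, e_pow_mem_fil1 p, ?_, ?_⟩
  · rw [e_pow, map_smul, antipode_E_pow, mul_smul_comm, mul_smul_comm, ← mul_assoc, Kz_mul_E_pow,
      smul_mul_assoc, mul_assoc (E ^ p), Kz_mul_neg, mul_one, smul_comm, smul_comm _ (vPow _), ← e_pow,
      mul_smul]
    exact neg_one_pow_smul_mem _ _ (vPow_smul_mem _ (Int.even_mul_succ_self _).neg
      (vPow_smul_mem _ (by rw [mul_assoc]; exact even_two_mul _) (e_pow_mem_fil1 p)))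
  · rw [e_pow, map_smul, antipodeInv_E_pow, smul_mul_assoc, smul_mul_assoc, Kz_mul_E_pow,
      smul_mul_assoc, mul_assoc (E ^ p), Kz_neg_mul, mul_one, smul_comm, smul_comm _ (vPow _), ← e_pow,
      mul_smul]
    exact neg_one_pow_smul_mem _ _ (vPow_smul_mem _ (Int.even_mul_succ_self _).neg.neg
      (vPow_smul_mem _ (by rw [mul_assoc]; exact even_two_mul _) (e_pow_mem_fil1 p)))

theorem Fdiv_mem_filWt (n : ℕ) : Fdiv n ∈ filWt (-n) 0 := by
  refine ⟨isWt_Fdiv n, mem_fil1_zero.2 (Fdiv_mem_Uev n), ?_, ?_⟩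
  · have : Kz (-n) * antipode (Fdiv n) =
        (-1 : Rh) ^ n • vPow (-(n * (n - 1))) • (Kz (-(2 * n)) * Fdiv n) := by
      rw [Fdiv_eq, map_smul, antipode_mul, antipode_Kz, antipode_F_pow, mul_smul_comm, mul_smul_comm,
        mul_smul_comm, Kz_mul_Kz_assoc, smul_comm (qfInv n), mul_smul, mul_smul_comm,
        show (-n + -n : ℤ) = -(2 * n) by ring]
    rw [this]
    exact neg_one_pow_smul_mem _ _ (vPow_smul_mem _ (Int.even_mul_pred_self _).neg
      (mem_fil1_zero.2 (mul_mem (Kz_mem_Uev (even_two_mul _).neg) (Fdiv_mem_Uev n))))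
  · have : antipodeInv (Fdiv n) * Kz (-n) =
        (-1 : Rh) ^ n • vPow (- -(n * (n - 1))) • (Fdiv n * Kz (-(2 * n))) := by
      rw [Fdiv_eq, map_smul, antipodeInv_mul, antipodeInv_Kz, antipodeInv_F_pow, smul_mul_assoc,
        mul_smul_comm, smul_mul_assoc, ← mul_assoc (Kz (-n)), Kz_neg_mul, one_mul,
        smul_comm (qfInv n), mul_smul, smul_mul_assoc, mul_assoc (F ^ n), ← Kz_add,
        show (n + -(2 * n) : ℤ) = -n by ring]
    rw [this]
    exact neg_one_pow_smul_mem _ _ (vPow_smul_mem _ (Int.even_mul_pred_self _).neg.neg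
      (mem_fil1_zero.2 (mul_mem (Fdiv_mem_Uev n) (Kz_mem_Uev (even_two_mul _).neg))))

theorem Uev_le_span : Subalgebra.toSubmodule Uev ≤ Submodule.span Zq {x | ∃ m, x ∈ filWt m 0} := by
  rw [Uev, Algebra.adjoin_eq_span]
  refine Submodule.span_mono fun x hx => ?_
  induction hx using Submonoid.closure_induction with
  | mem x hx =>
    rcases hx with (rfl | rfl | rfl) | ⟨n, _, rfl⟩
    · rw [K_pow]
      exact ⟨0, Kz_mem_filWt (by simp)⟩
    · rw [Kinv_pow]
      exact ⟨0, Kz_mem_filWt (by simp)⟩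
    · refine ⟨1, ⟨isWt_e, mem_fil1_zero.2 e_mem_Uev, ?_, ?_⟩⟩
      · have := (e_pow_mem_filWt 1).2.2.1
        rw [pow_one] at this
        exact fil1_antitone (Nat.zero_le _) this
      · have := (e_pow_mem_filWt 1).2.2.2
        rw [pow_one] at this
        exact fil1_antitone (Nat.zero_le _) this
    · exact ⟨_, Fdiv_mem_filWt n⟩
  | one => exact ⟨0, one_mem_filWt⟩
  | mul x y _ _ hx hy =>
    obtain ⟨m, hx⟩ := hx
    obtain ⟨n, hy⟩ := hy
    have := mul_mem_filWt hx hy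
    rw [max_self] at this
    exact ⟨m + n, this⟩

theorem fil1_le_span (p : ℕ) : fil1 p ≤ Submodule.span Zq {x | ∃ m, x ∈ filWt m p} := by
  refine Submodule.span_le.2 ?_
  rintro _ ⟨a, ha, b, hb, rfl⟩
  have h1 := Submodule.mul_mem_mul (Submodule.mul_mem_mul (Uev_le_span ha)
    (Submodule.mem_span_singleton_self (R := Zq) (e ^ p))) (Uev_le_span hb)
  rw [Submodule.span_mul_span, Submodule.span_mul_span] at h1
  refine Submodule.span_mono ?_ h1
  rintro _ ⟨_, ⟨x, ⟨m, hx⟩, _, rfl, rfl⟩, y, ⟨n, hy⟩, rfl⟩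
  have := mul_mem_filWt (mul_mem_filWt hx (e_pow_mem_filWt p)) hy
  rw [Nat.zero_max, Nat.max_zero] at this
  exact ⟨_, this⟩

section Induction

variable {M : Type*} [AddCommGroup M] [Module Rh M]
variable {N : Type*} [AddCommGroup N] [Module Rh N] {S : Submodule Zq N} {p : ℕ}

theorem map_span_mem {f : M →ₗ[Rh] N} {T : Set M} (h : ∀ x ∈ T, f x ∈ S) {x : M}
    (hx : x ∈ Submodule.span Zq T) : f x ∈ S := by
  induction hx using Submodule.span_induction with
  | mem x hx => exact h x hx
  | zero => simp
  | add x y _ _ hx hy => rw [map_add]; exact add_mem hx hy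
  | smul c x _ hx => exact (map_smul f (c : Rh) x).symm ▸ Submodule.smul_mem S c hx

/-- To control a linear map on a step of the filtration, it suffices to control it on weight
vectors. -/
theorem map_fil1_mem {f : Uh →ₗ[Rh] N} (h : ∀ m, ∀ x ∈ filWt m p, f x ∈ S) (x : Uh)
    (hx : x ∈ fil1 p) : f x ∈ S :=
  map_span_mem (fun x hx => h _ x hx.choose_spec) (fil1_le_span p hx)

theorem map_fil2_mem {f : Uh2 →ₗ[Rh] N}
    (h : ∀ m n a b, p ≤ max a b → ∀ x ∈ filWt m a, ∀ y ∈ filWt n b, f (tm x y) ∈ S) (z : Uh2)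
    (hz : z ∈ fil2 p) : f z ∈ S := by
  have h1 : ∀ a b, p ≤ max a b → ∀ x ∈ fil1 a, ∀ y ∈ fil1 b, f (tm x y) ∈ S :=
    fun a b hab x hx y hy => map_fil1_mem (f := f ∘ₗ tmL.flip y) (fun m x hx =>
      map_fil1_mem (f := f ∘ₗ tmL x) (fun n y hy => h m n a b hab x hx y hy) y hy) x hx
  rcases Submodule.mem_sup.1 hz with ⟨z₁, hz₁, z₂, hz₂, rfl⟩
  rw [map_add]
  refine add_mem (map_span_mem ?_ hz₁) (map_span_mem ?_ hz₂)
  · rintro _ ⟨x, hx, y, hy, rfl⟩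
    exact h1 p 0 (le_max_left _ _) x hx y (mem_fil1_zero.2 hy)
  · rintro _ ⟨x, hx, y, hy, rfl⟩
    exact h1 0 p (le_max_right _ _) x (mem_fil1_zero.2 hx) y hy

end Induction

/-! ### Integrality of the adjoint action -/

theorem ad_e_pow (n : ℕ) (y : Uh) :
    ad (e ^ n) y = (PowerSeries.X * sh : Rh) ^ n • ad (E ^ n) y := by
  rw [e_pow, map_smul, LinearMap.smul_apply]

theorem IsWt.ad_e {m : ℤ} {y : Uh} (hy : IsWt m y) :
    ad e y = e * y - vPow (2 * m) • (y * e) := by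
  rw [e, map_smul, LinearMap.smul_apply, hy.ad_E, smul_sub, smul_mul_assoc, mul_smul_comm,
    smul_comm (vPow (2 * m))]

theorem ad_e_pow_mem_span {m : ℤ} {y : Uh} (hy : IsWt m y) (n : ℕ) :
    ad (e ^ n) y ∈ Submodule.span Zq {z | ∃ i j, i + j = n ∧ z = e ^ i * y * e ^ j} := by
  induction n with
  | zero =>
    rw [pow_zero, ad_one]
    exact Submodule.subset_span ⟨0, 0, rfl, by simp⟩
  | succ n ih =>
    rw [pow_succ', ad_mul]
    refine map_span_mem ?_ ih
    rintro _ ⟨i, j, hij, rfl⟩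
    rw [(((isWt_e_pow i).mul hy).mul (isWt_e_pow j)).ad_e]
    refine sub_mem (Submodule.subset_span ⟨i + 1, j, by omega, ?_⟩)
      (vPow_smul_mem _ (even_two_mul _) (Submodule.subset_span ⟨i, j + 1, by omega, ?_⟩))
    · rw [pow_succ']
      simp only [mul_assoc]
    · rw [pow_succ]
      simp only [mul_assoc]

/-- In eⁱ y eʲ with i + j = n the larger exponent is at least n / 2. This makes the series of the
braiding converge for the filtration. -/
theorem ad_e_pow_mem_fil1 {m : ℤ} {p : ℕ} {y : Uh} (hy : y ∈ filWt m p) (n : ℕ) :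
    ad (e ^ n) y ∈ fil1 (max p (n / 2)) := by
  refine Submodule.span_le.2 ?_ (ad_e_pow_mem_span hy.1 n)
  rintro _ ⟨i, j, hij, rfl⟩
  refine fil1_antitone ?_ (mul_mem_fil1 (mul_mem_fil1 (e_pow_mem_fil1 i) hy.2.1) (e_pow_mem_fil1 j))
  omega

theorem Fdiv_mul_mul_Fdiv {m : ℤ} {x : Uh} (hx : IsWt m x) (i j : ℕ) :
    Fdiv i * x * Fdiv j = vPow (2 * i * (m - j)) • (qfInv i * qfInv j) •
      (F ^ i * x * F ^ j * Kz (i + j)) := by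
  rw [Fdiv_eq, Fdiv_eq]
  simp only [smul_mul_assoc, mul_smul_comm, uh_mul_assoc, hx.Kz_mul_assoc,
    (isWt_F_pow j).Kz_mul_assoc, ← Kz_add, vPow_smul_smul, qfInv_smul_vPow_smul, mul_smul]
  rw [smul_comm (qfInv j) (qfInv i)]
  congr 2
  ring

/-- The inverse factorials in `ad_F_pow` are absorbed into the divided powers, so each summand is ±
a power of q times F̃⁽ⁱ⁾ x F̃⁽ʲ⁾, and `filWt` is stable under such products. -/
theorem ad_F_pow_mem_filWt {m : ℤ} {p : ℕ} {x : Uh} (hx : x ∈ filWt m p) (n : ℕ) :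
    qfInv n • ad (F ^ n) x ∈ filWt (m - n) p := by
  rw [ad_F_pow]
  refine sum_mem fun q hq => ?_
  obtain ⟨i, j⟩ := q
  obtain rfl := mem_antidiagonal.1 hq
  have h1 : (qfInv i * qfInv j) • ((-1 : Rh) ^ j * vPow (-(j * (j - 1)) - 2 * i * j)) •
      (F ^ i * x * F ^ j * Kz (i + j)) = (-1 : Rh) ^ j • vPow (-(j * (j - 1)) - 2 * (i * m)) •
        (Fdiv i * x * Fdiv j) := by
    rw [Fdiv_mul_mul_Fdiv hx.1, vPow_smul_smul, smul_comm, mul_smul]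
    congr 3
    ring
  dsimp only
  rw [h1]
  refine neg_one_pow_smul_mem _ _ (vPow_smul_mem _
    ((Int.even_mul_pred_self _).neg.sub (even_two_mul _)) ?_)
  have h2 := mul_mem_filWt (mul_mem_filWt (Fdiv_mem_filWt i) hx) (Fdiv_mem_filWt j)
  rw [Nat.zero_max, Nat.max_zero] at h2
  rwa [show m - (i + j : ℕ) = -i + m + -j by push_cast; ring]

/-- The scalars are distributed for later use: (h `sh`)ⁿ turns Eⁿ into eⁿ, and 1/[n]_q! is left for
Fⁿ. -/
theorem X_pow_smul_rCoeff_smul {M : Type*} [AddCommGroup M] [Module Rh M] (n : ℕ) (z : M) :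
    (PowerSeries.X : Rh) ^ n • rCoeff n • z =
      vPow (n * (n - 1)) • qfInv n • (PowerSeries.X * sh : Rh) ^ n • z := by
  rw [rCoeff]
  simp only [smul_smul]
  congr 1
  ring

theorem even_two_mul_mul (a b : ℤ) : Even (2 * a * b) := by
  rw [mul_assoc]
  exact even_two_mul _

/-! ### Integrality of the braiding and the braided antipode -/

theorem braiding_mem {m n : ℤ} {a b : ℕ} {x y : Uh} (hx : x ∈ filWt m a) (hy : y ∈ filWt n b) :
    braiding (tm x y) ∈ complFil fil2 (max a b) := by
  refine mem_complFil_of_hasHSum fil2_antitone mem_hPow_of_mem_fil2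
    (hasHSum_braiding hx.1 hy.1) fun k => ?_
  rw [mul_smul, X_pow_smul_rCoeff_smul, smul_comm _ (vPow (2 * _ * _)),
    smul_comm (qfInv k) (vPow (2 * _ * _)), ← tm_smul_left, ← ad_e_pow, ← tm_smul_right]
  refine vPow_smul_mem _ (Int.even_mul_pred_self _) (vPow_smul_mem _ (even_two_mul_mul _ _) ?_)
  refine fil2_antitone ?_
    (tm_mem_fil2 (ad_e_pow_mem_fil1 hy k) (ad_F_pow_mem_filWt hx k).2.1)
  omega

theorem braidingInv_mem {m n : ℤ} {a b : ℕ} {x y : Uh} (hx : x ∈ filWt m a) (hy : y ∈ filWt n b) :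
    braidingInv (tm x y) ∈ complFil fil2 (max a b) := by
  refine mem_complFil_of_hasHSum fil2_antitone mem_hPow_of_mem_fil2
    (hasHSum_braidingInv hx.1 hy.1) fun k => ?_
  rw [mul_smul, X_pow_smul_rCoeff_smul, smul_comm _ ((-1) ^ k * _ : Rh),
    smul_comm (qfInv k) ((-1) ^ k * _ : Rh), ← tm_smul_right, ← ad_e_pow, ← tm_smul_left, mul_smul]
  refine vPow_smul_mem _ (Int.even_mul_pred_self _) (neg_one_pow_smul_mem _ _ (vPow_smul_mem _
    ((even_two_mul_mul _ _).neg.sub (Int.even_mul_pred_self _)) ?_))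
  refine fil2_antitone ?_
    (tm_mem_fil2 (ad_F_pow_mem_filWt hy k).2.1 (ad_e_pow_mem_fil1 hx k))
  omega

theorem qfInv_smul_mul_E_pow_mul (k : ℕ) (x y : Uh) :
    qfInv k • (PowerSeries.X * sh : Rh) ^ k • (x * E ^ k * y) = x * e ^ k * qfInv k • y := by
  rw [e_pow]
  simp only [mul_smul_comm, smul_mul_assoc]

theorem bAntipode_mem {m : ℤ} {p : ℕ} {x : Uh} (hx : x ∈ filWt m p) :
    bAntipode x ∈ complFil fil1 p := by
  refine mem_complFil_of_hasHSum fil1_antitone mem_hPow_of_mem_fil1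
    (hasHSum_bAntipode hx.1) fun k => ?_
  -- Once moved past eᵏ, the factor Kᵐ⁻ᵏ coming from D is the twist for Fᵏ ▷ x, which has weight m -
  -- k.
  have h := (ad_F_pow_mem_filWt hx k).2.2.1
  rw [X_pow_smul_rCoeff_smul, qfInv_smul_mul_E_pow_mul, ← map_smul antipode, (isWt_e_pow k).Kz_mul,
    smul_mul_assoc, uh_mul_assoc]
  refine vPow_smul_mem _ (Int.even_mul_pred_self _) (vPow_smul_mem _ (even_two_mul_mul _ _) ?_)
  refine fil1_antitone ?_ (mul_mem_fil1 (e_pow_mem_fil1 k) h)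
  omega

theorem bAntipodeInv_mem {m : ℤ} {p : ℕ} {x : Uh} (hx : x ∈ filWt m p) :
    bAntipodeInv x ∈ complFil fil1 p := by
  refine mem_complFil_of_hasHSum fil1_antitone mem_hPow_of_mem_fil1
    (hasHSum_bAntipodeInv hx.1) fun k => ?_
  -- Here Kᵐ⁻ᵏ already stands to the right of S⁻¹, which is the other twisted condition.
  have h := (ad_F_pow_mem_filWt hx k).2.2.2
  have h1 : qfInv k • (PowerSeries.X * sh : Rh) ^ k • (antipodeInv (ad (F ^ k) x) *
      (Kz (m - k) * E ^ k)) = antipodeInv (qfInv k • ad (F ^ k) x) * (Kz (m - k) * e ^ k) := by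
    rw [e_pow, map_smul]
    simp only [mul_smul_comm, smul_mul_assoc]
    rw [smul_comm]
  rw [X_pow_smul_rCoeff_smul, h1, ← mul_assoc]
  refine vPow_smul_mem _ (Int.even_mul_pred_self _) ?_
  refine fil1_antitone ?_ (mul_mem_fil1 h (e_pow_mem_fil1 k))
  omega

/-! ### Integrality of the comultiplication -/

/-- The span of the tensors `x ⊗ y` in `U_h ⊗̂ U_h` for which `y` is a weight vector of weight `m`
in the even integral form and `x K ^ (-m)` is in the even integral form, with one of them in the
`p`-th step of the filtration. -/
noncomputable def twFil (p : ℕ) : Submodule Zq Uh2 :=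
  Submodule.span Zq {z | ∃ (m n : ℤ) (a b : ℕ) (x y : Uh), p ≤ max a b ∧ IsWt n x ∧
    x * Kz (-m) ∈ fil1 a ∧ y ∈ filWt m b ∧ z = tm x y}

/-- The weights of the second factors add, and so do the twists on the first. Moving K⁻ᵐ past x'
costs an even power of v because x' is itself a weight vector; this is why `twFil` asks for a weight
of the first factor too. -/
theorem mul_mem_twFil {p q : ℕ} {z w : Uh2} (hz : z ∈ twFil p) (hw : w ∈ twFil q) :
    z * w ∈ twFil (max p q) := by
  have h1 := Submodule.mul_mem_mul hz hw
  rw [twFil, twFil, Submodule.span_mul_span] at h1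
  refine Submodule.span_mono ?_ h1
  rintro _ ⟨_, ⟨m, n, a, b, x, y, hab, hn, hx, hy, rfl⟩, _,
    ⟨m', n', a', b', x', y', hab', hn', hx', hy', rfl⟩, rfl⟩
  refine ⟨m + m', n + n', max a a', max b b', x * x', y * y', by omega, hn.mul hn', ?_,
    mul_mem_filWt hy hy', tm_mul _ _ _ _⟩
  rw [neg_add, Kz_add, uh_mul_assoc, ← uh_mul_assoc x', hn'.mul_Kz, smul_mul_assoc, mul_smul_comm,
    uh_mul_assoc, ← uh_mul_assoc]
  exact vPow_smul_mem _ (even_two_mul_mul _ _).neg (mul_mem_fil1 hx hx')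

theorem comul_Kz (a : ℤ) : comul (Kz a) = tm (Kz a) (Kz a) := by
  rw [Kz, map_hExp, map_smul, comul_H, ← inl_apply, ← inr_apply, smul_add,
    hExp_add (((commute_inl_inr H H).smul_left _).smul_right _), ← map_smul, ← map_smul, ← map_hExp,
    ← map_hExp, ← tm_eq]

theorem comul_Kz_mem {a : ℤ} (ha : Even a) : comul (Kz a) ∈ twFil 0 := by
  rw [comul_Kz]
  refine Submodule.subset_span ⟨0, 0, 0, 0, _, _, Nat.zero_le _, isWt_Kz a, ?_, Kz_mem_filWt ha, rfl⟩
  rw [neg_zero, Kz_zero, mul_one]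
  exact mem_fil1_zero.2 (Kz_mem_Uev ha)

theorem comul_e : comul e = tm e 1 + tm (Kz 1) e := by
  rw [e, map_smul, comul_E, smul_add, ← tm_smul_left, ← tm_smul_right, Kz_one]

theorem comul_e_pow_mem_span (p : ℕ) : comul (e ^ p) ∈
    Submodule.span Zq {z | ∃ i j : ℕ, i + j = p ∧ z = tm (e ^ i * Kz j) (e ^ j)} := by
  induction p with
  | zero =>
    refine Submodule.subset_span ⟨0, 0, rfl, ?_⟩
    rw [pow_zero, map_one, Nat.cast_zero, Kz_zero, mul_one]
    exact (map_one toUh2).symm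
  | succ p ih =>
    rw [pow_succ', map_mul]
    refine map_span_mem (f := LinearMap.mulLeft Rh (comul e)) ?_ ih
    rintro _ ⟨i, j, hij, rfl⟩
    rw [LinearMap.mulLeft_apply, comul_e, add_mul, tm_mul, tm_mul, one_mul, ← mul_assoc, ← pow_succ',
      ← pow_succ', (isWt_e_pow i).Kz_mul_assoc, tm_smul_left, ← Kz_add]
    refine add_mem (Submodule.subset_span ⟨i + 1, j, by omega, rfl⟩)
      (vPow_smul_mem _ (even_two_mul_mul _ _) (Submodule.subset_span ⟨i, j + 1, by omega, ?_⟩))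
    rw [add_comm 1 (j : ℤ), Nat.cast_succ]

/-- In eⁱ Kʲ ⊗ eʲ the factor Kʲ is the twist allowed by the weight j of eʲ. As i + j = p, only one
tensor factor of degree at least p / 2 is guaranteed, whence the halving. -/
theorem comul_e_pow_mem (p : ℕ) : comul (e ^ p) ∈ twFil (p / 2) := by
  refine Submodule.span_le.2 ?_ (comul_e_pow_mem_span p)
  rintro _ ⟨i, j, hij, rfl⟩
  refine Submodule.subset_span ⟨j, i, i, j, _, _, by omega,
    ((isWt_e_pow i).mul (isWt_Kz j)).congr (add_zero _), ?_, e_pow_mem_filWt j, rfl⟩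
  rw [mul_assoc, Kz_mul_neg, mul_one]
  exact e_pow_mem_fil1 i

/-- The q-binomial theorem for the two summands of Δ(F): the summands are F̃⁽ⁱ⁾ Kʲ ⊗ F̃⁽ʲ⁾. -/
theorem comul_Fdiv (n : ℕ) : comul (Fdiv n) = ∑ p ∈ antidiagonal n,
    (qfInv p.1 * qfInv p.2) • tm (F ^ p.1 * Kz (p.1 + p.2)) (F ^ p.2 * Kz p.2) := by
  rw [Fdiv_eq, map_smul]
  induction n with
  | zero =>
    simp only [qfInv_zero, pow_zero, Nat.cast_zero, Kz_zero, mul_one, map_one,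
      Finset.Nat.antidiagonal_zero, Finset.sum_singleton, one_smul, add_zero]
    exact (map_one toUh2).symm
  | succ n ih =>
    refine (isUnit_qIntQ_succ n).smul_left_cancel.1 ?_
    have h1 : F ^ (n + 1) * Kz (n + 1 : ℕ) = F * (F ^ n * Kz n) * Kz 1 := by
      rw [pow_succ', uh_mul_assoc, uh_mul_assoc, uh_mul_assoc, ← Kz_add, Nat.cast_succ]
    rw [smul_smul, qIntQ_mul_qfInv, h1, map_mul, map_mul, ← smul_mul_assoc, ← mul_smul_comm, ih,
      qIntQ_smul_sum (fun i j => tm (F ^ i * Kz (i + j)) (F ^ j * Kz j)), Finset.mul_sum,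
      Finset.sum_mul]
    refine Finset.sum_congr rfl fun p _ => ?_
    obtain ⟨i, j⟩ := p
    dsimp only
    rw [mul_smul_comm, smul_mul_assoc, comul_F, comul_Kz, add_mul, add_mul, tm_mul, tm_mul, tm_mul,
      tm_mul, one_mul, ← Kz_neg_one, add_comm]
    congr 2
    · rw [pow_succ' F j]
      simp only [uh_mul_assoc, ← Kz_add]
      push_cast
      rw [add_assoc]
    · rw [(isWt_F_pow j).Kz_mul_assoc, ← tm_smul_right, smul_mul_assoc, pow_succ' F i]
      simp only [uh_mul_assoc, ← Kz_add]
      rw [tm_smul_right, show (i + j + 1 : ℤ) = (i + 1 : ℕ) + j by push_cast; ring,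
        show (-1 + j + 1 : ℤ) = j by ring, tm_smul_right]
      congr 2
      ring

theorem comul_Fdiv_mem (n : ℕ) : comul (Fdiv n) ∈ twFil 0 := by
  rw [comul_Fdiv]
  refine sum_mem fun p _ => ?_
  obtain ⟨i, j⟩ := p
  -- F̃⁽ʲ⁾ has weight -j, so the twist multiplies Kʲ by another Kʲ and gives the even power K²ʲ.
  refine Submodule.subset_span ⟨-j, -i, 0, 0, Fdiv i * Kz j, Fdiv j, Nat.zero_le _,
    ((isWt_Fdiv i).mul (isWt_Kz j)).congr (add_zero _), ?_, Fdiv_mem_filWt j, ?_⟩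
  · rw [neg_neg, mul_assoc, ← Kz_add]
    exact mem_fil1_zero.2 (mul_mem (Fdiv_mem_Uev i) (Kz_mem_Uev ⟨_, rfl⟩))
  · rw [Fdiv_eq, Fdiv_eq, smul_mul_assoc, tm_smul_left, tm_smul_right, smul_smul, mul_assoc,
      ← Kz_add]

theorem comul_mem_of_mem_Uev {x : Uh} (hx : x ∈ Uev) : comul x ∈ twFil 0 := by
  induction hx using Algebra.adjoin_induction with
  | mem x hx =>
    rcases hx with (rfl | rfl | rfl) | ⟨n, _, rfl⟩
    · rw [K_pow]
      exact comul_Kz_mem (by simp)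
    · rw [Kinv_pow]
      exact comul_Kz_mem (by simp)
    · have := comul_e_pow_mem 1
      rwa [pow_one] at this
    · exact comul_Fdiv_mem n
  | algebraMap c =>
    rw [Algebra.algebraMap_eq_smul_one]
    have := comul_Kz_mem Even.zero
    rw [Kz_zero] at this
    exact (map_smul comul (c : Rh) 1).symm ▸ Submodule.smul_mem _ c this
  | add x y _ _ hx hy => rw [map_add]; exact add_mem hx hy
  | mul x y _ _ hx hy =>
    have := mul_mem_twFil hx hy
    rwa [max_self, ← map_mul] at this

theorem comul_mem_of_mem_fil1 {p : ℕ} {x : Uh} (hx : x ∈ fil1 p) : comul x ∈ twFil (p / 2) := by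
  refine map_span_mem (f := comul.toLinearMap) ?_ hx
  rintro _ ⟨a, ha, b, hb, rfl⟩
  have := mul_mem_twFil (mul_mem_twFil (comul_mem_of_mem_Uev ha) (comul_e_pow_mem p))
    (comul_mem_of_mem_Uev hb)
  rwa [Nat.zero_max, Nat.max_zero, ← map_mul, ← map_mul] at this

/-! ### Integrality of the braided comultiplication -/

theorem bComul_mem {p : ℕ} {x : Uh} (hx : x ∈ fil1 p) : bComul x ∈ complFil fil2 (p / 2) := by
  rw [bComul_apply]
  refine map_span_mem ?_ (comul_mem_of_mem_fil1 hx)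
  rintro _ ⟨m, n, a, b, x, y, hab, hn, hx, hy, rfl⟩
  refine mem_complFil_of_hasHSum fil2_antitone mem_hPow_of_mem_fil2
    (hasHSum_bComulAux x hy.1) fun k => ?_
  -- The K⁻ᵏ in S(Eᵏ) reduces Kᵏ⁻ᵐ to K⁻ᵐ, the twist that returns x to the even form.
  have h1 : (PowerSeries.X * sh : Rh) ^ k • (x * antipode (E ^ k) * Kz (k - m)) =
      (-1 : Rh) ^ k • vPow (-(k * (k + 1))) • vPow (-(2 * -m * k)) • (x * Kz (-m) * e ^ k) := by
    rw [antipode_E_pow, e_pow]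
    simp only [mul_smul_comm, smul_mul_assoc, uh_mul_assoc, ← Kz_add, mul_smul]
    rw [show (-k + (k - m) : ℤ) = -m by ring, (isWt_E_pow k).mul_Kz, mul_smul_comm]
    simp only [smul_smul]
    congr 1
    ring
  rw [X_pow_smul_rCoeff_smul, ← tm_smul_left, h1, ← tm_smul_right]
  simp only [tm_smul_left]
  refine vPow_smul_mem _ (Int.even_mul_pred_self _) (neg_one_pow_smul_mem _ _ (vPow_smul_mem _
    (Int.even_mul_succ_self _).neg (vPow_smul_mem _ (even_two_mul_mul _ _).neg ?_)))
  refine fil2_antitone ?_ (tm_mem_fil2 (mul_mem_fil1 hx (e_pow_mem_fil1 k))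
    (ad_F_pow_mem_filWt hy k).2.1)
  omega

/-! ### Multiplication, unit and counit -/

theorem mult_mem {p : ℕ} {z : Uh2} (hz : z ∈ fil2 p) : mult z ∈ fil1 p := by
  refine map_fil2_mem (fun m n a b hab x hx y hy => ?_) z hz
  rw [show mult (tm x y) = x * y from ext2_tm _ _ _]
  exact fil1_antitone hab (mul_mem_fil1 hx.2.1 hy.2.1)

theorem mem_fil0_zero {c : Rh} : c ∈ fil0 0 ↔ c ∈ Zq := by
  rw [fil0, if_pos rfl, Submodule.mem_one]
  exact ⟨fun ⟨y, hy⟩ => hy ▸ y.2, fun h => ⟨⟨c, h⟩, rfl⟩⟩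

theorem fil0_succ (p : ℕ) : fil0 (p + 1) = ⊥ := if_neg (Nat.succ_ne_zero p)

theorem fil0_antitone : Antitone fil0 := fun p q h => by
  rcases q with _ | q
  · rw [Nat.le_zero.1 h]
  · rw [fil0_succ]
    exact bot_le

theorem mem_hPow_of_mem_fil0 (p : ℕ) (x : Rh) (hx : x ∈ fil0 p) : x ∈ hPow Rh p := by
  rcases p with _ | p
  · exact mem_hPow_zero x
  · rw [fil0_succ, Submodule.mem_bot] at hx
    rw [hx]
    exact zero_mem _

theorem unit_mem {p : ℕ} {c : Rh} (hc : c ∈ fil0 p) : unit c ∈ fil1 p := by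
  rcases p with _ | p
  · rw [mem_fil0_zero] at hc
    have : unit c = c • 1 := Algebra.algebraMap_eq_smul_one c
    rw [this]
    exact Zq_smul_mem _ hc (mem_fil1_zero.2 (one_mem _))
  · rw [fil0_succ, Submodule.mem_bot] at hc
    rw [hc, map_zero]
    exact zero_mem _

theorem counit_gen (g : Gen) : counit (gen g) = 0 := uhLift_gen _ satRel_counit g

theorem counit_Kz (a : ℤ) : counit (Kz a) = 1 := by
  rw [Kz, map_hExp, map_smul, show counit H = 0 from counit_gen .H, smul_zero, hExp_zero]

theorem counit_e : counit e = 0 := by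
  rw [e, map_smul, show counit E = 0 from counit_gen .E, smul_zero]

theorem counit_mem_of_mem_Uev {x : Uh} (hx : x ∈ Uev) : counit x ∈ Zq := by
  induction hx using Algebra.adjoin_induction with
  | mem x hx =>
    rcases hx with (rfl | rfl | rfl) | ⟨n, hn, rfl⟩
    · rw [K_pow, counit_Kz]
      exact one_mem _
    · rw [Kinv_pow, counit_Kz]
      exact one_mem _
    · rw [counit_e]
      exact zero_mem _
    · rw [Fdiv_eq, map_smul, map_mul, map_pow, show counit F = 0 from counit_gen .F,
        zero_pow (by omega), zero_mul, smul_zero]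
      exact zero_mem _
  | algebraMap c =>
    have : counit (algebraMap Zq Uh c) = c := counit.commutes (c : Rh)
    rw [this]
    exact c.2
  | add x y _ _ hx hy => rw [map_add]; exact add_mem hx hy
  | mul x y _ _ hx hy => rw [map_mul]; exact mul_mem hx hy

/-- Since ε(e) = 0, the counit kills every positive step, as the discrete target demands. -/
theorem counit_mem {p : ℕ} {x : Uh} (hx : x ∈ fil1 p) : counit x ∈ fil0 p := by
  rcases p with _ | p
  · exact mem_fil0_zero.2 (counit_mem_of_mem_Uev (fil1_le_Uev hx))
  · refine map_span_mem (f := counit.toLinearMap) ?_ hx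
    rintro _ ⟨a, ha, b, hb, rfl⟩
    have : counit (a * e ^ (p + 1) * b) = 0 := by
      rw [map_mul, map_mul, map_pow, counit_e, zero_pow (Nat.succ_ne_zero p), mul_zero, zero_mul]
    rw [AlgHom.toLinearMap_apply, this]
    exact zero_mem _

/-- The passage to a weaker step of a completion. -/
theorem mem_complFil_half {M : Type*} [AddCommGroup M] [Module Rh M] {L : ℕ → Submodule Zq M}
    (hL : Antitone L) {p : ℕ} {x : M} (hx : x ∈ L p) : x ∈ complFil L (p / 2) :=
  le_complFil hL _ (hL (Nat.div_le_self p 2) hx)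

theorem complFil_antitone {M : Type*} [AddCommGroup M] [Module Rh M] {L : ℕ → Submodule Zq M} :
    Antitone (complFil L) := fun p q h x hx => by
  obtain ⟨w, h1, h2, h3, h4⟩ := exists_seq_of_mem_complFil hx
  -- A representative that vanishes up to q also vanishes at p ≤ q, so no monotonicity of `L` is
  -- needed.
  exact ⟨w, h1, h2, by rw [h3 p h]; exact zero_mem _, h4⟩

end QuantumSl2

theorem mainTheorem6 :
    -- each structure map preserves the completed tensor powers and is continuous there
    (QuantumSl2.RestrictsContinuously QuantumSl2.braiding QuantumSl2.fil2 QuantumSl2.fil2 ∧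
      QuantumSl2.RestrictsContinuously QuantumSl2.braidingInv QuantumSl2.fil2 QuantumSl2.fil2 ∧
      QuantumSl2.RestrictsContinuously QuantumSl2.mult QuantumSl2.fil2 QuantumSl2.fil1 ∧
      QuantumSl2.RestrictsContinuously QuantumSl2.unit QuantumSl2.fil0 QuantumSl2.fil1 ∧
      QuantumSl2.RestrictsContinuously QuantumSl2.bComul QuantumSl2.fil1 QuantumSl2.fil2 ∧
      QuantumSl2.RestrictsContinuously QuantumSl2.counit.toLinearMap
        QuantumSl2.fil1 QuantumSl2.fil0 ∧
      QuantumSl2.RestrictsContinuously QuantumSl2.bAntipode QuantumSl2.fil1 QuantumSl2.fil1 ∧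
      QuantumSl2.RestrictsContinuously QuantumSl2.bAntipodeInv QuantumSl2.fil1 QuantumSl2.fil1) ∧
    -- the braiding and the braided antipode are invertible, with the stated inverses
    (QuantumSl2.braidingInv ∘ₗ QuantumSl2.braiding = LinearMap.id ∧
      QuantumSl2.braiding ∘ₗ QuantumSl2.braidingInv = LinearMap.id) ∧
    (QuantumSl2.bAntipodeInv ∘ₗ QuantumSl2.bAntipode = LinearMap.id ∧
      QuantumSl2.bAntipode ∘ₗ QuantumSl2.bAntipodeInv = LinearMap.id) := by
  open QuantumSl2 in
  -- Only `bComul_mem` yields step p / 2; the estimates for the other maps keep step p and are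
  -- weakened to the common criterion.
  refine ⟨⟨.of_map_mem mem_hPow_of_mem_fil2 fun p => map_fil2_mem fun m n a b hab x hx y hy => ?_,
    .of_map_mem mem_hPow_of_mem_fil2 fun p => map_fil2_mem fun m n a b hab x hx y hy => ?_,
    .of_map_mem mem_hPow_of_mem_fil1 fun p z hz => mem_complFil_half fil1_antitone (mult_mem hz),
    .of_map_mem mem_hPow_of_mem_fil1 fun p z hz => mem_complFil_half fil1_antitone (unit_mem hz),
    .of_map_mem mem_hPow_of_mem_fil2 fun p x hx => bComul_mem hx,
    .of_map_mem mem_hPow_of_mem_fil0 fun p x hx => mem_complFil_half fil0_antitone (counit_mem hx),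
    .of_map_mem mem_hPow_of_mem_fil1 fun p => map_fil1_mem fun m x hx => ?_,
    .of_map_mem mem_hPow_of_mem_fil1 fun p => map_fil1_mem fun m x hx => ?_⟩,
    ⟨braidingInv_comp_braiding, braiding_comp_braidingInv⟩,
    bAntipodeInv_comp_bAntipode, bAntipode_comp_bAntipodeInv⟩
  · exact QuantumSl2.complFil_antitone (by omega) (QuantumSl2.braiding_mem hx hy)
  · exact QuantumSl2.complFil_antitone (by omega) (QuantumSl2.braidingInv_mem hx hy)
  · exact QuantumSl2.complFil_antitone (by omega) (QuantumSl2.bAntipode_mem hx)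
  · exact QuantumSl2.complFil_antitone (by omega) (QuantumSl2.bAntipodeInv_mem hx)
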